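/- Let $l\ge -\tfrac12$ and let $q\in L^1_{\mathrm{loc}}(0,\infty)$ be real-valued with $x\,q(x)\in L^1(0,1)$ if $l>-\tfrac12$ and $x(1-\log x)\,q(x)\in L^1(0,1)$ if $l=-\tfrac12$. Put $\tau=-\frac{d^2}{dx^2}+\frac{l(l+1)}{x^2}+q(x)$ and assume that $\tau$ is limit point at $\infty$. Let $H$ be the self-adjoint operator $f\mapsto\tau f$ in $L^2(0,\infty)$ whose domain consists of all $f\in L^2(0,\infty)$ such that $f,f'$ are locally absolutely continuous on $(0,\infty)$, $\tau f\in L^2(0,\infty)$ and, if $l<\tfrac12$, $\lim_{x\to0}x^l\big((l+1)f(x)-xf'(x)\big)=0$. For an integer $n\ge0$ let $\mathfrak H_n=\mathfrak D(|H|^{n/2})$ with norm $\|\psi\|_{\mathfrak H_n}=\|(1+|H|^{1/2})^{n}\psi\|$, and let $\mathfrak H_{-n}$ be the completion of $L^2(0,\infty)$ with respect to $\|\psi\|_{\mathfrak H_{-n}}=\|(1+|H|^{1/2})^{-n}\psi\|$; the pairing of $\mathfrak H_{-n}$ with $\mathfrak H_n$ is the continuous extension of $(\psi,f)\mapsto\int_0^\infty\overline{\psi}f\,dx$.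 A function $g$ on $(0,\infty)$ is said to lie in $\mathfrak H_{-n}$ if there is an element of $\mathfrak H_{-n}$ whose pairing with every $f\in\mathfrak H_n$ is the absolutely convergent integral $\int_0^\infty\overline{g(x)}f(x)\,dx$. Let $0\le n\le\lfloor l+1\rfloor$, and assume that $H$ is bounded from below or that $n$ is even. Then: 1. Every $f\in\mathfrak H_n$ is of the form $f(x)=x^n\tilde f(x)$ on $(0,1)$ with $\tilde f\in L^2(0,1)$. If $n\ge1$, then (the representative of) $f$ can be chosen continuous on $(0,1)$ and there is a constant $C$ (depending on $f$) with $|\tilde f(x)|\le C/\sqrt x$ for all $x\in(0,1)$. If $n\ge2$, then moreover $f$ is differentiable on $(0,1)$ and $f'(x)=x^{n-1}\hat f(x)$ with $\hat f\in L^2(0,1)$ and $|\hat f(x)|\le C/\sqrt x$ for all $x\in(0,1)$ and some constant $C$. 2. Conversely, every function $g$ on $(0,\infty)$ with $g(x)=x^{-n}\tilde g(x)$ on $(0,1)$, $\tilde g\in L^2(0,1)$, and $g\in L^2(1,\infty)$, lies in $\mathfrak H_{-n}$. -/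

import Mathlib

open MeasureTheory Set Filter Topology
open scoped ComplexConjugate

noncomputable section

namespace PerturbedBessel

/-! ### The scale of Hilbert spaces of a self-adjoint operator -/

section Scale

variable {E : Type*} [NormedAddCommGroup E] [InnerProductSpace ℂ E] [CompleteSpace E]

/-- The closure of the graph of `A` as a closed subspace of the Hilbert space `E ⊕ E`. -/
def closedGraph (A : E →ₗ.[ℂ] E) : Submodule ℂ (WithLp 2 (E × E)) :=
  (A.graph.map (WithLp.linearEquiv 2 ℂ (E × E)).symm.toLinearMap).topologicalClosure

instance (A : E →ₗ.[ℂ] E) : CompleteSpace (closedGraph A) :=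
  (Submodule.isClosed_topologicalClosure _).completeSpace_coe

/-- The bounded operator `(1 + A* A)⁻¹` of a closed operator `A`, that is `(1 + A²)⁻¹ = (1 + |A|²)⁻¹`
if `A` is self-adjoint: `(1 + A* A)⁻¹ f` is the first component of the orthogonal projection of
`(f, 0)` onto the graph of `A`. (Indeed `(f - u, 0 - A u)` is orthogonal to the graph
iff `A u` is in the domain of `A*` and `f - u = A* A u`.) -/
def invOneAddSq (A : E →ₗ.[ℂ] E) : E →L[ℂ] E :=
  (ContinuousLinearMap.fst ℂ E E) ∘L
    (WithLp.prodContinuousLinearEquiv 2 ℂ E E).toContinuousLinearMap ∘L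
    (closedGraph A).starProjection ∘L
    (WithLp.prodContinuousLinearEquiv 2 ℂ E E).symm.toContinuousLinearMap ∘L
    (ContinuousLinearMap.inl ℂ E E)

/-- The bounded operator `(1 + |A|^{1/2})⁻¹`, obtained from `B = (1 + |A|²)⁻¹` by the continuous
functional calculus: with `t = 1 / (1 + s²)`, `s ≥ 0`, one has
`t^{1/4} / (t^{1/4} + (1 - t)^{1/4}) = 1 / (1 + s^{1/2})`. -/
def invOneAddSqrtAbs (A : E →ₗ.[ℂ] E) : E →L[ℂ] E :=
  cfc (fun t : ℝ => t ^ (1 / 4 : ℝ) / (t ^ (1 / 4 : ℝ) + (1 - t) ^ (1 / 4 : ℝ)))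
    (invOneAddSq A)

/-- The space `𝔥ₙ = D(|A|^{n/2})`, `n ≥ 0`, which is the domain of `(1 + |A|^{1/2})ⁿ`, that is
the range of `(1 + |A|^{1/2})⁻ⁿ`. -/
def scale (A : E →ₗ.[ℂ] E) (n : ℕ) : Submodule ℂ E :=
  LinearMap.range ((invOneAddSqrtAbs A ^ n : E →L[ℂ] E) : E →ₗ[ℂ] E)

/-- The Hilbert space `E`, to be equipped with the norm `‖ψ‖₋ₙ = ‖(1 + |A|^{1/2})⁻ⁿ ψ‖`. -/
def PreNegScale (_A : E →ₗ.[ℂ] E) (_n : ℕ) : Type _ := E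

instance (A : E →ₗ.[ℂ] E) (n : ℕ) : AddCommGroup (PreNegScale A n) :=
  inferInstanceAs (AddCommGroup E)

/-- The map `ψ ↦ (1 + |A|^{1/2})⁻ⁿ ψ` as an additive map on `PreNegScale A n`. -/
def PreNegScale.toE (A : E →ₗ.[ℂ] E) (n : ℕ) : PreNegScale A n →+ E :=
  ((invOneAddSqrtAbs A ^ n : E →L[ℂ] E) : E →ₗ[ℂ] E).toAddMonoidHom

instance (A : E →ₗ.[ℂ] E) (n : ℕ) : SeminormedAddCommGroup (PreNegScale A n) :=
  SeminormedAddCommGroup.induced _ _ (PreNegScale.toE A n)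

/-- The space `𝔥₋ₙ`, `n ≥ 0`: the completion of `E` with respect to
`‖ψ‖₋ₙ = ‖(1 + |A|^{1/2})⁻ⁿ ψ‖`. -/
abbrev NegScale (A : E →ₗ.[ℂ] E) (n : ℕ) : Type _ := UniformSpace.Completion (PreNegScale A n)

/-- The dual pairing of `G ∈ 𝔥₋ₙ` with `f ∈ 𝔥ₙ`: the continuous extension of
`ψ ↦ ⟪ψ, f⟫`, `ψ ∈ E`, to the completion `𝔥₋ₙ` (see `pairing_coe`). -/
def pairing (A : E →ₗ.[ℂ] E) (n : ℕ) (G : NegScale A n) (f : E) : ℂ :=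
  UniformSpace.Completion.extension
    (fun ψ : PreNegScale A n => inner ℂ (show E from ψ) f) G

/-- For `f ∈ 𝔥ₙ` the functional `ψ ↦ ⟪ψ, f⟫` is uniformly continuous for `‖·‖₋ₙ`. -/
theorem uniformContinuous_inner (A : E →ₗ.[ℂ] E) (n : ℕ) {f : E} (hf : f ∈ scale A n) :
    UniformContinuous (fun ψ : PreNegScale A n => inner ℂ (show E from ψ) f) := by
  obtain ⟨h, rfl⟩ := hf
  have hsa : IsSelfAdjoint (invOneAddSqrtAbs A ^ n) := by
    apply IsSelfAdjoint.pow
    exact cfc_predicate _ _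
  have key : ∀ ψ : PreNegScale A n,
      inner ℂ (show E from ψ) ((invOneAddSqrtAbs A ^ n : E →L[ℂ] E) h)
        = inner ℂ (PreNegScale.toE A n ψ) h := by
    intro ψ
    exact (hsa.isSymmetric (show E from ψ) h).symm
  have h1 : UniformContinuous (PreNegScale.toE A n) :=
    (AddMonoidHomClass.isometry_of_norm _ (fun _ => rfl)).uniformContinuous
  have h2 : UniformContinuous (fun e : E => inner ℂ e h) := by
    have : (fun e : E => inner ℂ e h) = fun e => conj (innerSL ℂ h e) := by
      ext e; simp [inner_conj_symm]
    rw [this]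
    exact (RCLike.conjLIE (K := ℂ)).isometry.uniformContinuous.comp
      (innerSL ℂ h).uniformContinuous
  have h3 : (fun ψ : PreNegScale A n =>
      inner ℂ (show E from ψ) ((invOneAddSqrtAbs A ^ n : E →L[ℂ] E) h))
        = (fun e : E => inner ℂ e h) ∘ PreNegScale.toE A n := funext key
  exact h3 ▸ h2.comp h1

theorem pairing_coe (A : E →ₗ.[ℂ] E) (n : ℕ) {f : E} (hf : f ∈ scale A n)
    (ψ : PreNegScale A n) : pairing A n (ψ : NegScale A n) f = inner ℂ (show E from ψ) f :=
  UniformSpace.Completion.extension_coe (uniformContinuous_inner A n hf) ψ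

/-- `A` is bounded from below. -/
def IsBoundedBelow (A : E →ₗ.[ℂ] E) : Prop :=
  ∃ c : ℝ, ∀ u : A.domain, c * ‖(u : E)‖ ^ 2 ≤ (inner ℂ (u : E) (A u)).re

end Scale

/-! ### Perturbed Bessel operators on the half-line -/

/-- Lebesgue measure on `(0, ∞)`. -/
abbrev volPos : Measure ℝ := volume.restrict (Ioi 0)

/-- The Hilbert space `L²(0, ∞)`. -/
abbrev L2 : Type := Lp ℂ 2 volPos

/-- `f` is continuously differentiable on `(0, ∞)` and `f'` is locally absolutely continuous
there. -/
def IsRegular (f : ℝ → ℂ) : Prop :=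
  DifferentiableOn ℝ f (Ioi 0) ∧
    ∀ a b : ℝ, 0 < a → a ≤ b → AbsolutelyContinuousOnInterval (deriv f) a b

/-- The differential expression `τ = -d²/dx² + l(l+1)/x² + q(x)`. -/
def tau (l : ℝ) (q : ℝ → ℝ) (f : ℝ → ℂ) (x : ℝ) : ℂ :=
  -deriv (deriv f) x + ((l * (l + 1) / x ^ 2 + q x : ℝ) : ℂ) * f x

/-- `f` belongs to the maximal domain of `τ` in `L²(0, ∞)`. -/
def InMaximalDomain (l : ℝ) (q : ℝ → ℝ) (f : ℝ → ℂ) : Prop :=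
  IsRegular f ∧ MemLp f 2 volPos ∧ MemLp (tau l q f) 2 volPos

/-- `τ` is limit point at `∞`: the Wronskian of any two functions in the maximal domain
vanishes at `∞`. (Since `q` is real, the maximal domain is closed under complex conjugation.) -/
def LimitPointAtTop (l : ℝ) (q : ℝ → ℝ) : Prop :=
  ∀ f g : ℝ → ℂ, InMaximalDomain l q f → InMaximalDomain l q g →
    Tendsto (fun x => f x * deriv g x - deriv f x * g x) atTop (𝓝 0)

/-- The standing assumptions on the parameter `l` and the real potential `q`. -/
structure Hypothesis (l : ℝ) (q : ℝ → ℝ) : Prop where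
  l_ge : -(1 / 2) ≤ l
  locallyIntegrable : LocallyIntegrableOn q (Ioi 0)
  integrable_of_gt : -(1 / 2) < l → IntegrableOn (fun x => x * q x) (Ioo 0 1)
  integrable_of_eq : l = -(1 / 2) →
    IntegrableOn (fun x => x * (1 - Real.log x) * q x) (Ioo 0 1)
  limitPoint : LimitPointAtTop l q

/-- The boundary condition `lim_{x → 0} x^l ((l+1) f(x) - x f'(x)) = 0`, imposed only for
`l < 1/2`. -/
def BoundaryCondition (l : ℝ) (f : ℝ → ℂ) : Prop :=
  l < 1 / 2 →
    Tendsto (fun x : ℝ => ((x ^ l : ℝ) : ℂ) * (((l + 1 : ℝ) : ℂ) * f x - (x : ℂ) * deriv f x))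
      (𝓝[>] 0) (𝓝 0)

theorem IsRegular.hasDerivAt {f : ℝ → ℂ} (hf : IsRegular f) {x : ℝ} (hx : 0 < x) :
    HasDerivAt f (deriv f x) x :=
  (hf.1.differentiableAt (Ioi_mem_nhds hx)).hasDerivAt

theorem acOn_congr {f g : ℝ → ℂ} {a b : ℝ} (hab : a ≤ b) (h : ∀ x ∈ Icc a b, f x = g x)
    (hf : AbsolutelyContinuousOnInterval f a b) : AbsolutelyContinuousOnInterval g a b := by
  rw [absolutelyContinuousOnInterval_iff] at hf ⊢
  intro ε hε
  obtain ⟨δ, hδ, H⟩ := hf ε hε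
  refine ⟨δ, hδ, fun E hE hlt => ?_⟩
  have := H E hE hlt
  have hmem := hE.1
  rw [uIcc_of_le hab] at hmem
  refine lt_of_eq_of_lt (Finset.sum_congr rfl fun i hi => ?_) this
  have := hmem i hi
  rw [h _ this.1, h _ this.2]

theorem IsRegular.ae_differentiableAt_deriv {f : ℝ → ℂ} (hf : IsRegular f) :
    ∀ᵐ x ∂volPos, DifferentiableAt ℝ (deriv f) x := by
  rw [ae_restrict_iff' measurableSet_Ioi]
  have h : ∀ k : ℕ, ∀ᵐ x : ℝ, x ∈ Icc (1 / ((k : ℝ) + 1)) ((k : ℝ) + 1) →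
      x ∈ interior (Icc (1 / ((k : ℝ) + 1)) ((k : ℝ) + 1)) →
      DifferentiableAt ℝ (deriv f) x := by
    intro k
    have hk : (0 : ℝ) < 1 / ((k : ℝ) + 1) := by positivity
    have hk2 : 1 / ((k : ℝ) + 1) ≤ (k : ℝ) + 1 := by
      have : (0 : ℝ) ≤ k := by positivity
      rw [div_le_iff₀ (by positivity)]
      nlinarith
    have hbv := (hf.2 _ _ hk hk2).boundedVariationOn.locallyBoundedVariationOn
    rw [uIcc_of_le hk2] at hbv
    filter_upwards [hbv.ae_differentiableWithinAt_of_mem] with x hx hxm hxi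
    exact (hx hxm).differentiableAt (mem_interior_iff_mem_nhds.1 hxi)
  filter_upwards [ae_all_iff.2 h] with x hx hx0
  obtain ⟨k, hk⟩ := exists_nat_gt (max x (1 / x))
  have hx0' : (0 : ℝ) < x := hx0
  have h1 : x < (k : ℝ) + 1 := lt_trans (lt_of_le_of_lt (le_max_left _ _) hk) (by linarith)
  have h2 : 1 / ((k : ℝ) + 1) < x := by
    have h3 : 1 / x < (k : ℝ) + 1 :=
      lt_trans (lt_of_le_of_lt (le_max_right _ _) hk) (by linarith)
    rw [div_lt_iff₀ hx0'] at h3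
    rw [div_lt_iff₀ (by positivity)]
    linarith
  exact hx k ⟨h2.le, h1.le⟩ (by rw [interior_Icc]; exact ⟨h2, h1⟩)

theorem IsRegular.deriv_add {f g : ℝ → ℂ} (hf : IsRegular f) (hg : IsRegular g) {x : ℝ}
    (hx : 0 < x) : deriv (f + g) x = (deriv f + deriv g) x :=
  ((hf.hasDerivAt hx).add (hg.hasDerivAt hx)).deriv

theorem IsRegular.deriv_smul (c : ℂ) {f : ℝ → ℂ} (hf : IsRegular f) {x : ℝ}
    (hx : 0 < x) : deriv (c • f) x = (c • deriv f) x :=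
  ((hf.hasDerivAt hx).const_smul c).deriv

theorem IsRegular.add {f g : ℝ → ℂ} (hf : IsRegular f) (hg : IsRegular g) :
    IsRegular (f + g) := by
  refine ⟨hf.1.add hg.1, fun a b ha hab => ?_⟩
  refine acOn_congr hab (fun x hx => ?_) ((hf.2 a b ha hab).add (hg.2 a b ha hab))
  exact (hf.deriv_add hg (lt_of_lt_of_le ha hx.1)).symm

theorem IsRegular.smul (c : ℂ) {f : ℝ → ℂ} (hf : IsRegular f) : IsRegular (c • f) := by
  refine ⟨hf.1.const_smul c, fun a b ha hab => ?_⟩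
  refine acOn_congr hab (fun x hx => ?_) ((hf.2 a b ha hab).const_smul c)
  exact (hf.deriv_smul c (lt_of_lt_of_le ha hx.1)).symm

theorem IsRegular.tau_add (l : ℝ) (q : ℝ → ℝ) {f g : ℝ → ℂ} (hf : IsRegular f)
    (hg : IsRegular g) : tau l q (f + g) =ᵐ[volPos] tau l q f + tau l q g := by
  filter_upwards [hf.ae_differentiableAt_deriv, hg.ae_differentiableAt_deriv,
    ae_restrict_mem measurableSet_Ioi] with x h1 h2 hx
  have h3 : deriv (f + g) =ᶠ[𝓝 x] deriv f + deriv g := by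
    filter_upwards [Ioi_mem_nhds (show (0 : ℝ) < x from hx)] with y hy
    exact hf.deriv_add hg hy
  simp only [tau, h3.deriv_eq, (h1.hasDerivAt.add h2.hasDerivAt).deriv, Pi.add_apply]
  ring

theorem IsRegular.tau_smul (l : ℝ) (q : ℝ → ℝ) (c : ℂ) {f : ℝ → ℂ} (hf : IsRegular f) :
    tau l q (c • f) =ᵐ[volPos] c • tau l q f := by
  filter_upwards [hf.ae_differentiableAt_deriv, ae_restrict_mem measurableSet_Ioi] with x h1 hx
  have h3 : deriv (c • f) =ᶠ[𝓝 x] c • deriv f := by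
    filter_upwards [Ioi_mem_nhds (show (0 : ℝ) < x from hx)] with y hy
    exact hf.deriv_smul c hy
  simp only [tau, h3.deriv_eq, (h1.hasDerivAt.const_smul c).deriv, Pi.smul_apply, smul_eq_mul]
  ring

/-- The graph of `H`: pairs `(f, τ f)` of elements of `L²(0, ∞)` with `f ∈ C¹(0, ∞)`, `f'`
locally absolutely continuous, and `f` subject to the boundary condition at `0` if `l < 1/2`. -/
def graphH (l : ℝ) (q : ℝ → ℝ) : Submodule ℂ (L2 × L2) where
  carrier := {p | ∃ f : ℝ → ℂ, IsRegular f ∧ BoundaryCondition l f ∧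
    f =ᵐ[volPos] p.1 ∧ tau l q f =ᵐ[volPos] p.2}
  add_mem' := by
    rintro ⟨u, v⟩ ⟨u', v'⟩ ⟨f, hf, hb, h1, h2⟩ ⟨g, hg, hc, h3, h4⟩
    refine ⟨f + g, hf.add hg, fun hl => ?_, ?_, ?_⟩
    · have := (hb hl).add (hc hl)
      rw [add_zero] at this
      refine this.congr' ?_
      filter_upwards [self_mem_nhdsWithin] with x hx
      rw [hf.deriv_add hg hx]
      simp only [Pi.add_apply]
      ring
    · exact (h1.add h3).trans (Lp.coeFn_add u u').symm
    · exact (hf.tau_add l q hg).trans ((h2.add h4).trans (Lp.coeFn_add v v').symm)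
  zero_mem' := by
    refine ⟨0, ⟨differentiableOn_const 0, fun a b _ hab => ?_⟩, fun _ => ?_, ?_, ?_⟩
    · have h0 : deriv (0 : ℝ → ℂ) = fun _ => 0 := by ext x; exact deriv_const x (0 : ℂ)
      rw [h0, absolutelyContinuousOnInterval_iff]
      exact fun ε hε => ⟨1, one_pos, fun E _ _ => by simpa using hε⟩
    · have h0 : deriv (0 : ℝ → ℂ) = fun _ => 0 := by ext x; exact deriv_const x (0 : ℂ)
      simp [h0]
    · exact (Lp.coeFn_zero ℂ 2 volPos).symm
    · have h0 : deriv (0 : ℝ → ℂ) = fun _ => 0 := by ext x; exact deriv_const x (0 : ℂ)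
      have h5 : tau l q 0 = 0 := by
        ext x
        simp [tau, h0]
      rw [h5]
      exact (Lp.coeFn_zero ℂ 2 volPos).symm
  smul_mem' := by
    rintro c ⟨u, v⟩ ⟨f, hf, hb, h1, h2⟩
    refine ⟨c • f, hf.smul c, fun hl => ?_, ?_, ?_⟩
    · have := (hb hl).const_mul c
      rw [mul_zero] at this
      refine this.congr' ?_
      filter_upwards [self_mem_nhdsWithin] with x hx
      rw [hf.deriv_smul c hx]
      simp only [Pi.smul_apply, smul_eq_mul]
      ring
    · exact (h1.const_smul c).trans (Lp.coeFn_smul c u).symm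
    · exact (hf.tau_smul l q c).trans ((h2.const_smul c).trans (Lp.coeFn_smul c v).symm)

/-- `τ f` is determined by the class of `f` in `L²(0, ∞)`. -/
theorem graphH_functional (l : ℝ) (q : ℝ → ℝ) :
    ∀ p ∈ graphH l q, p.1 = 0 → p.2 = 0 := by
  rintro ⟨u, v⟩ ⟨f, hf, -, h1, h2⟩ hu
  simp only at hu h1 h2 ⊢
  subst hu
  have h3 : f =ᵐ[volPos] 0 := h1.trans (Lp.coeFn_zero ℂ 2 volPos)
  have h4 : EqOn f 0 (Ioi 0) :=
    MeasureTheory.Measure.eqOn_of_ae_eq h3 hf.1.continuousOn continuousOn_const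
      (by rw [interior_Ioi]; exact subset_closure)
  have h5 : ∀ x : ℝ, 0 < x → deriv f x = 0 := fun x hx => by
    have : f =ᶠ[𝓝 x] fun _ => 0 := by
      filter_upwards [Ioi_mem_nhds hx] with y hy using h4 hy
    rw [this.deriv_eq, deriv_const]
  have h6 : tau l q f =ᵐ[volPos] 0 := by
    filter_upwards [ae_restrict_mem measurableSet_Ioi] with x hx
    have h7 : deriv f =ᶠ[𝓝 x] fun _ => 0 := by
      filter_upwards [Ioi_mem_nhds (show (0 : ℝ) < x from hx)] with y hy using h5 y hy
    simp [tau, h7.deriv_eq, h4 hx]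
  exact (Lp.eq_zero_iff_ae_eq_zero).2 (h2.symm.trans h6)

/-- The operator `H` in `L²(0, ∞)` associated with `τ = -d²/dx² + l(l+1)/x² + q` and the
boundary condition at `0`. -/
def H (l : ℝ) (q : ℝ → ℝ) : L2 →ₗ.[ℂ] L2 := (graphH l q).toLinearPMap

theorem graph_H (l : ℝ) (q : ℝ → ℝ) : (H l q).graph = graphH l q :=
  Submodule.toLinearPMap_graph_eq _ (graphH_functional l q)

/-- The function `g` lies in `𝔥₋ₙ`: there is an element `G` of the completion `𝔥₋ₙ` whose pairing
with every `f ∈ 𝔥ₙ` is the absolutely convergent integral `∫₀^∞ conj (g x) f(x) dx`. -/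
def MemNegScale (l : ℝ) (q : ℝ → ℝ) (n : ℕ) (g : ℝ → ℂ) : Prop :=
  ∃ G : NegScale (H l q) n, ∀ f ∈ scale (H l q) n,
    Integrable (fun x => conj (g x) * f x) volPos ∧
      pairing (H l q) n G f = ∫ x, conj (g x) * f x ∂volPos

end PerturbedBessel

end

open MeasureTheory Set Filter Topology
open scoped ComplexConjugate

noncomputable section

namespace PerturbedBessel

/-! ### Absolutely continuous primitives and the Lagrange identity. -/

section Calculus

/-! Decay at 0 is gained two powers of x at a time. The powers x^(l+1) and x^(-l) solve the
unperturbed equation, so the Wronskians of f with them turn τ f = g into an integral inequality with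
kernel k(x,s) = min(x^(-l) s^(l+1), x^(l+1) s^(-l)). The boundary condition, or f ∈ L² when l ≥ 1/2,
makes the Wronskian with x^(l+1) vanish at 0, which excludes the behaviour x^(-l). Since s|q(s)| has
small integral near 0, the potential is absorbed by a fixed-point estimate, and |f| and x|f'| are
bounded by a multiple of x^(l+1) + ∫ k(x,s)|g(s)| ds (`Hypothesis.exists_bound`). If g = s^m p with
p ∈ L²(0,1) and m + 2 ≤ l + 1, then k(x,s) s^m ≤ x^(m+2) / max(x,s) (`besselKernel_mul_pow_le`), and
the kernel 1/max(x,s) maps L²(0,1) into itself (Schur test) with values O(1/√x).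

For the induction from n to n + 2, the condition n + 2 ≤ l + 1 gives l ≥ 1, so no boundary condition
is imposed. Regularity of weak solutions shows that H extends its adjoint (`Hypothesis.adjointLE`),
Green's identity and the limit point condition show that H is symmetric, and the functional calculus
then shows that H maps 𝔥ₙ₊₂ to 𝔥ₙ. The induction for even n starts at the trivial case n = 0.

For odd n it starts at n = 1, where the lower bound of H enters. A cutoff away from 0 yields
functions in the domain of H, whose form is bounded below; the localization formula and the form
smallness of q then give ∫₀¹ |f'|² ≤ 2 Re ⟨f, H f⟩ + C ‖f‖² (`Hypothesis.exists_kinetic_le`). For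
every densely defined symmetric A and u in the range of (1 + A*A)^(-1/2) one has Re ⟨u, A u⟩ ≤ ‖(1 +
A*A)^(1/4) u‖² in terms of the closure (`GraphSymmetric.re_inner_boundedTransform_le`), so the
estimate passes to 𝔥₁. Its elements are thus primitives of L² functions near 0, and their quotient
by x is again dominated by the kernel 1/max(x,s).

The second claim is dual to the first. The integral of conj g · f converges absolutely for f ∈ 𝔥ₙ;
it is the limit of the integrals with g truncated to (δ, ∞), which are bounded functionals. By
Banach-Steinhaus the limit is bounded as a functional of h, where f = (1 + |H|^(1/2))⁻ⁿ h, and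
`exists_pairing_eq` represents it in 𝔥₋ₙ. -/

theorem ac_of_dist_le {X Y : Type*} [PseudoMetricSpace X] [PseudoMetricSpace Y] {f : ℝ → X}
    {g : ℝ → Y} {a b : ℝ} (h : ∀ x y, dist (g x) (g y) ≤ dist (f x) (f y))
    (hf : AbsolutelyContinuousOnInterval f a b) : AbsolutelyContinuousOnInterval g a b := by
  rw [absolutelyContinuousOnInterval_iff] at hf ⊢
  intro ε hε
  obtain ⟨δ, hδ, H⟩ := hf ε hε
  exact ⟨δ, hδ, fun E hE hlt => (Finset.sum_le_sum fun i _ => h _ _).trans_lt (H E hE hlt)⟩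

theorem ac_re {f : ℝ → ℂ} {a b : ℝ} (hf : AbsolutelyContinuousOnInterval f a b) :
    AbsolutelyContinuousOnInterval (fun x => (f x).re) a b :=
  ac_of_dist_le (fun x y => by
    rw [Real.dist_eq, Complex.dist_eq, ← Complex.sub_re]; exact Complex.abs_re_le_norm _) hf

theorem ac_im {f : ℝ → ℂ} {a b : ℝ} (hf : AbsolutelyContinuousOnInterval f a b) :
    AbsolutelyContinuousOnInterval (fun x => (f x).im) a b :=
  ac_of_dist_le (fun x y => by
    rw [Real.dist_eq, Complex.dist_eq, ← Complex.sub_im]; exact Complex.abs_im_le_norm _) hf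

theorem ac_ofReal {f : ℝ → ℝ} {a b : ℝ} (hf : AbsolutelyContinuousOnInterval f a b) :
    AbsolutelyContinuousOnInterval (fun x => (f x : ℂ)) a b :=
  ac_of_dist_le (fun _ _ => (Complex.isometry_ofReal.dist_eq _ _).le) hf

theorem intervalIntegrable_ofReal {p : ℝ → ℝ} {a b : ℝ} (hp : IntervalIntegrable p volume a b) :
    IntervalIntegrable (fun x => (p x : ℂ)) volume a b :=
  ⟨hp.1.ofReal, hp.2.ofReal⟩

theorem ac_ae_differentiableAt {f : ℝ → ℂ} {a b : ℝ} (hf : AbsolutelyContinuousOnInterval f a b) :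
    ∀ᵐ x : ℝ, x ∈ uIcc a b → DifferentiableAt ℝ f x :=
  hf.boundedVariationOn.ae_differentiableAt_of_mem_uIcc

theorem ac_intervalIntegrable_deriv {f : ℝ → ℂ} {a b : ℝ}
    (hf : AbsolutelyContinuousOnInterval f a b) : IntervalIntegrable (deriv f) volume a b := by
  have h1 := (ac_re hf).intervalIntegrable_deriv
  have h2 := (ac_im hf).intervalIntegrable_deriv
  have h3 : IntervalIntegrable (fun x => ((deriv (fun x => (f x).re) x : ℝ) : ℂ)
      + Complex.I * ((deriv (fun x => (f x).im) x : ℝ) : ℂ)) volume a b :=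
    (intervalIntegrable_ofReal h1).add ((intervalIntegrable_ofReal h2).const_mul _)
  refine h3.congr_ae ?_
  rw [EventuallyEq, ae_restrict_iff' measurableSet_uIoc]
  filter_upwards [ac_ae_differentiableAt hf] with x hx hxm
  have h4 := (hx (uIoc_subset_uIcc hxm)).hasDerivAt
  have h5 : HasDerivAt (fun x => (f x).re) (deriv f x).re x :=
    Complex.reCLM.hasFDerivAt.comp_hasDerivAt x h4
  have h6 : HasDerivAt (fun x => (f x).im) (deriv f x).im x :=
    Complex.imCLM.hasFDerivAt.comp_hasDerivAt x h4
  rw [h5.deriv, h6.deriv, mul_comm]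
  exact Complex.re_add_im _

/-- The real and imaginary parts are primitives of integrable real functions, and absolute
continuity is inherited by their combination. -/
theorem ac_integral {p : ℝ → ℂ} {a b c : ℝ} (hp : IntervalIntegrable p volume a b)
    (hc : c ∈ uIcc a b) : AbsolutelyContinuousOnInterval (fun x => ∫ t in c..x, p t) a b := by
  have h1 : IntervalIntegrable (fun t => (p t).re) volume a b :=
    ⟨hp.1.re, hp.2.re⟩
  have h2 : IntervalIntegrable (fun t => (p t).im) volume a b :=
    ⟨hp.1.im, hp.2.im⟩
  have h3 := (ac_ofReal (h1.absolutelyContinuousOnInterval_intervalIntegral hc)).add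
    ((ac_ofReal (h2.absolutelyContinuousOnInterval_intervalIntegral hc)).const_smul Complex.I)
  rw [absolutelyContinuousOnInterval_iff] at h3 ⊢
  intro ε hε
  obtain ⟨δ, hδ, H⟩ := h3 ε hε
  refine ⟨δ, hδ, fun E hE hlt => lt_of_eq_of_lt (Finset.sum_congr rfl fun i hi => ?_) (H E hE hlt)⟩
  have key : ∀ x ∈ uIcc a b, ∫ t in c..x, p t = ((∫ t in c..x, (p t).re : ℝ) : ℂ)
      + Complex.I • ((∫ t in c..x, (p t).im : ℝ) : ℂ) := by
    intro x hx
    have hcx : uIcc c x ⊆ uIcc a b := uIcc_subset_uIcc hc hx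
    rw [← intervalIntegral.integral_ofReal, ← intervalIntegral.integral_ofReal,
      smul_eq_mul, ← intervalIntegral.integral_const_mul, ← intervalIntegral.integral_add
      (intervalIntegrable_ofReal (h1.mono_set hcx))
      ((intervalIntegrable_ofReal (h2.mono_set hcx)).const_mul Complex.I)]
    refine intervalIntegral.integral_congr fun t _ => ?_
    rw [mul_comm]
    exact (Complex.re_add_im _).symm
  have hm := hE.1 i hi
  rw [key _ hm.1, key _ hm.2]
  rfl

/-- `P` is a primitive on `[a, b]` of the integrable function `p`. -/
def IsPrim (P p : ℝ → ℂ) (a b : ℝ) : Prop :=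
  IntervalIntegrable p volume a b ∧ ∀ x ∈ Icc a b, P x = P a + ∫ t in a..x, p t

theorem IsPrim.sub_eq {P p : ℝ → ℂ} {a b : ℝ} (h : IsPrim P p a b) (hab : a ≤ b) :
    P b - P a = ∫ t in a..b, p t := by
  rw [h.2 b (right_mem_Icc.2 hab)]; ring

theorem IsPrim.ac {P p : ℝ → ℂ} {a b : ℝ} (h : IsPrim P p a b) (hab : a ≤ b) :
    AbsolutelyContinuousOnInterval P a b := by
  refine acOn_congr hab (f := (fun _ => P a) + fun x => ∫ t in a..x, p t)
    (fun x hx => (h.2 x hx).symm) ?_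
  refine AbsolutelyContinuousOnInterval.add ?_ (ac_integral h.1 left_mem_uIcc)
  exact (LipschitzWith.const (P a)).lipschitzOnWith.absolutelyContinuousOnInterval

theorem IsPrim.continuousOn {P p : ℝ → ℂ} {a b : ℝ} (h : IsPrim P p a b) (hab : a ≤ b) :
    ContinuousOn P (Icc a b) := by
  rw [← uIcc_of_le hab]; exact (h.ac hab).continuousOn

theorem IsPrim.ae_hasDerivAt {P p : ℝ → ℂ} {a b : ℝ} (h : IsPrim P p a b) :
    ∀ᵐ x : ℝ, x ∈ Ioo a b → HasDerivAt P (p x) x := by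
  filter_upwards [h.1.ae_hasDerivAt_integral] with x hx hxm
  have hab : a ≤ b := (hxm.1.trans hxm.2).le
  have h1 := (hx (by rw [uIcc_of_le hab]; exact Ioo_subset_Icc_self hxm) a left_mem_uIcc).const_add
    (P a)
  refine h1.congr_of_eventuallyEq ?_
  filter_upwards [Ioo_mem_nhds hxm.1 hxm.2] with y hy using h.2 y (Ioo_subset_Icc_self hy)

/-- An absolutely continuous function is a primitive of its derivative. -/
theorem isPrim_of_ac {P p : ℝ → ℂ} {a b : ℝ} (hab : a ≤ b)
    (hP : AbsolutelyContinuousOnInterval P a b)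
    (hp : ∀ᵐ x : ℝ, x ∈ Ioo a b → HasDerivAt P (p x) x) : IsPrim P p a b := by
  have h0 : ∀ᵐ x : ℝ, x ≠ b := by simp [ae_iff, measure_singleton]
  have h0' : ∀ᵐ x : ℝ, x ≠ a := by simp [ae_iff, measure_singleton]
  have h1 : deriv P =ᵐ[volume.restrict (uIoc a b)] p := by
    rw [EventuallyEq, ae_restrict_iff' measurableSet_uIoc]
    filter_upwards [hp, h0] with x hx hxb hxm
    rw [uIoc_of_le hab] at hxm
    exact (hx ⟨hxm.1, lt_of_le_of_ne hxm.2 hxb⟩).deriv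
  have h2 : IntervalIntegrable p volume a b := (ac_intervalIntegrable_deriv hP).congr_ae h1
  refine ⟨h2, fun x hx => ?_⟩
  have h3 := hP.sub (ac_integral h2 (left_mem_uIcc))
  have h4 : ∀ᵐ x : ℝ, x ∈ uIcc a b →
      HasDerivAt (P - fun x => ∫ t in a..x, p t) 0 x := by
    filter_upwards [hp, h0, h0', h2.ae_hasDerivAt_integral] with x hx hb ha hx2 hxm
    have hm := hxm
    rw [uIcc_of_le hab] at hm
    have := (hx ⟨lt_of_le_of_ne hm.1 ha.symm, lt_of_le_of_ne hm.2 hb⟩).sub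
      (hx2 hxm a left_mem_uIcc)
    rwa [sub_self] at this
  obtain ⟨C, hC⟩ := h3.const_of_ae_hasDerivAt_zero h4
  rw [uIcc_of_le hab] at hC
  have h5 := hC a (left_mem_Icc.2 hab)
  have h6 := hC x hx
  simp only [Pi.sub_apply, intervalIntegral.integral_same, sub_zero] at h5 h6
  rw [h5, ← h6]; ring

theorem isPrim_of_hasDerivAt {P p : ℝ → ℂ} {a b : ℝ}
    (hP : ∀ x ∈ Icc a b, HasDerivAt P (p x) x) (hp : ContinuousOn p (Icc a b)) (hab : a ≤ b) :
    IsPrim P p a b := by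
  refine ⟨ContinuousOn.intervalIntegrable_of_Icc hab hp, fun x hx => ?_⟩
  have hsub : Icc a x ⊆ Icc a b := Icc_subset_Icc_right hx.2
  rw [intervalIntegral.integral_eq_sub_of_hasDerivAt (f := P)]
  · ring
  · intro y hy
    rw [uIcc_of_le hx.1] at hy
    exact hP y (hsub hy)
  · exact ContinuousOn.intervalIntegrable_of_Icc hx.1 (hp.mono hsub)

theorem IsPrim.mul {P p Q q : ℝ → ℂ} {a b : ℝ} (hP : IsPrim P p a b) (hQ : IsPrim Q q a b)
    (hab : a ≤ b) : IsPrim (fun x => P x * Q x) (fun x => p x * Q x + P x * q x) a b := by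
  refine isPrim_of_ac hab ?_ ?_
  · exact (hP.ac hab).smul (hQ.ac hab)
  · filter_upwards [hP.ae_hasDerivAt, hQ.ae_hasDerivAt] with x h1 h2 hx
    exact (h1 hx).mul (h2 hx)

theorem IsPrim.sub {P p Q q : ℝ → ℂ} {a b : ℝ} (hP : IsPrim P p a b) (hQ : IsPrim Q q a b)
    (hab : a ≤ b) : IsPrim (fun x => P x - Q x) (fun x => p x - q x) a b := by
  refine isPrim_of_ac hab ((hP.ac hab).sub (hQ.ac hab)) ?_
  filter_upwards [hP.ae_hasDerivAt, hQ.ae_hasDerivAt] with x h1 h2 hx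
  exact (h1 hx).sub (h2 hx)

theorem IsPrim.add_const_mul {P p Q q : ℝ → ℂ} {a b : ℝ} (hP : IsPrim P p a b)
    (hQ : IsPrim Q q a b) (c : ℂ) (hab : a ≤ b) :
    IsPrim (fun x => P x + c * Q x) (fun x => p x + c * q x) a b := by
  refine isPrim_of_ac hab ((hP.ac hab).add ((hQ.ac hab).const_smul c)) ?_
  filter_upwards [hP.ae_hasDerivAt, hQ.ae_hasDerivAt] with x h1 h2 hx
  exact (h1 hx).add ((h2 hx).const_mul c)

theorem IsPrim.congr_right {P p q : ℝ → ℂ} {a b : ℝ} (hP : IsPrim P p a b) (hab : a ≤ b)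
    (h : ∀ x ∈ Icc a b, p x = q x) : IsPrim P q a b := by
  refine isPrim_of_ac hab (hP.ac hab) ?_
  filter_upwards [hP.ae_hasDerivAt] with x h1 hx
  rw [← h x (Ioo_subset_Icc_self hx)]; exact h1 hx

theorem IsPrim.congr_left {P Q p : ℝ → ℂ} {a b : ℝ} (hP : IsPrim P p a b)
    (h : ∀ x ∈ Icc a b, P x = Q x) : IsPrim Q p a b :=
  ⟨hP.1, fun x hx => by
    rw [← h x hx, ← h a (left_mem_Icc.2 (hx.1.trans hx.2))]; exact hP.2 x hx⟩

theorem IsPrim.conj {P p : ℝ → ℂ} {a b : ℝ} (hP : IsPrim P p a b) (hab : a ≤ b) :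
    IsPrim (fun x => conj (P x)) (fun x => conj (p x)) a b := by
  refine isPrim_of_ac hab ?_ ?_
  · exact ac_of_dist_le (fun _ _ => (Complex.isometry_conj.dist_eq _ _).le) (hP.ac hab)
  · filter_upwards [hP.ae_hasDerivAt] with x h1 hx
    exact (Complex.conjCLE.toContinuousLinearMap.hasFDerivAt.comp_hasDerivAt x (h1 hx))

/-- The Lagrange identity. -/
theorem IsPrim.wronskian {f f' F g g' G : ℝ → ℂ} {a b : ℝ} (hab : a ≤ b)
    (hf : IsPrim f f' a b) (hf' : IsPrim f' F a b) (hg : IsPrim g g' a b)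
    (hg' : IsPrim g' G a b) :
    IsPrim (fun x => f' x * g x - f x * g' x) (fun x => F x * g x - f x * G x) a b :=
  ((hf'.mul hg hab).sub (hf.mul hg' hab) hab).congr_right hab fun x _ => by ring

theorem IsRegular.isPrim_deriv {f : ℝ → ℂ} (hf : IsRegular f) {a b : ℝ} (ha : 0 < a)
    (hab : a ≤ b) : IsPrim (deriv f) (deriv (deriv f)) a b := by
  refine isPrim_of_ac hab (hf.2 a b ha hab) ?_
  filter_upwards [ac_ae_differentiableAt (hf.2 a b ha hab)] with x h1 hx
  exact (h1 (by rw [uIcc_of_le hab]; exact Ioo_subset_Icc_self hx)).hasDerivAt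

theorem IsRegular.continuousOn_deriv {f : ℝ → ℂ} (hf : IsRegular f) :
    ContinuousOn (deriv f) (Ioi 0) := by
  intro x hx
  have hx : 0 < x := hx
  have h1 := (hf.isPrim_deriv (half_pos hx) (by linarith : x / 2 ≤ x + 1)).continuousOn
    (by linarith)
  exact (h1.continuousAt (Icc_mem_nhds (by linarith) (by linarith))).continuousWithinAt

theorem IsRegular.isPrim {f : ℝ → ℂ} (hf : IsRegular f) {a b : ℝ} (ha : 0 < a)
    (hab : a ≤ b) : IsPrim f (deriv f) a b :=
  isPrim_of_hasDerivAt (fun _ hx => hf.hasDerivAt (ha.trans_le hx.1))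
    (hf.continuousOn_deriv.mono fun _ hx => ha.trans_le hx.1) hab

theorem deriv_deriv_eq (l : ℝ) (q : ℝ → ℝ) (f : ℝ → ℂ) (x : ℝ) :
    deriv (deriv f) x = ((l * (l + 1) / x ^ 2 + q x : ℝ) : ℂ) * f x - tau l q f x := by
  rw [tau]; ring

theorem IsRegular.of_isPrim {f f' F : ℝ → ℂ} (h1 : ∀ x, 0 < x → HasDerivAt f (f' x) x)
    (h2 : ∀ a b, 0 < a → a ≤ b → IsPrim f' F a b) : IsRegular f := by
  refine ⟨fun x hx => (h1 x hx).differentiableAt.differentiableWithinAt, fun a b ha hab => ?_⟩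
  exact acOn_congr hab (fun x hx => (h1 x (ha.trans_le hx.1)).deriv.symm) ((h2 a b ha hab).ac hab)

/-- The half-line is a countable union of the intervals (1/(k+1), k+1). -/
theorem ae_volPos_of_forall_Ioo {p : ℝ → Prop}
    (h : ∀ a b : ℝ, 0 < a → a ≤ b → ∀ᵐ x : ℝ, x ∈ Ioo a b → p x) : ∀ᵐ x ∂volPos, p x := by
  rw [ae_restrict_iff' measurableSet_Ioi]
  have hk1 : ∀ k : ℕ, (0 : ℝ) < 1 / ((k : ℝ) + 1) := fun k => by positivity
  have hk2 : ∀ k : ℕ, 1 / ((k : ℝ) + 1) ≤ (k : ℝ) + 1 := fun k => by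
    rw [div_le_iff₀ (by positivity)]
    nlinarith [k.cast_nonneg (α := ℝ)]
  filter_upwards [ae_all_iff.2 fun k : ℕ => h _ _ (hk1 k) (hk2 k)] with x hx hx0
  obtain ⟨k, hk⟩ := exists_nat_gt (max x (1 / x))
  have hx0' : (0 : ℝ) < x := hx0
  have h1 : x < (k : ℝ) + 1 := lt_trans (lt_of_le_of_lt (le_max_left _ _) hk) (by linarith)
  have h2 : 1 / ((k : ℝ) + 1) < x := by
    have h3 : 1 / x < (k : ℝ) + 1 :=
      lt_trans (lt_of_le_of_lt (le_max_right _ _) hk) (by linarith)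
    rw [div_lt_iff₀ hx0'] at h3
    rw [div_lt_iff₀ (by positivity)]
    linarith
  exact hx k ⟨h2, h1⟩

theorem deriv_deriv_ae_eq {f f' F : ℝ → ℂ} (h1 : ∀ x, 0 < x → HasDerivAt f (f' x) x)
    (h2 : ∀ a b, 0 < a → a ≤ b → IsPrim f' F a b) : deriv (deriv f) =ᵐ[volPos] F := by
  refine ae_volPos_of_forall_Ioo fun a b ha hab => ?_
  filter_upwards [(h2 a b ha hab).ae_hasDerivAt] with x hx hxm
  have h3 : deriv f =ᶠ[𝓝 x] f' := by
    filter_upwards [Ioi_mem_nhds (ha.trans hxm.1)] with y hy using (h1 y hy).deriv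
  rw [h3.deriv_eq, (hx hxm).deriv]

end Calculus

set_option linter.unusedSectionVars false

/-! ### Powers of (1 + A*A)⁻¹ and the bounded transform A(1 + A*A)^(-1/2). -/

section OperatorTheory

variable {E : Type*} [NormedAddCommGroup E] [InnerProductSpace ℂ E] [CompleteSpace E]

/-- The orthogonal projection of `(h, 0)` onto the closed graph of `A`. -/
def graphProj (A : E →ₗ.[ℂ] E) : E →L[ℂ] WithLp 2 (E × E) :=
  (closedGraph A).starProjection ∘L
    (WithLp.prodContinuousLinearEquiv 2 ℂ E E).symm.toContinuousLinearMap ∘L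
    (ContinuousLinearMap.inl ℂ E E)

/-- The bounded operator `A (1 + A* A)⁻¹`. -/
def mulInvOneAddSq (A : E →ₗ.[ℂ] E) : E →L[ℂ] E :=
  (ContinuousLinearMap.snd ℂ E E) ∘L
    (WithLp.prodContinuousLinearEquiv 2 ℂ E E).toContinuousLinearMap ∘L graphProj A

theorem graphProj_fst (A : E →ₗ.[ℂ] E) (h : E) : (graphProj A h).fst = invOneAddSq A h := rfl

theorem graphProj_snd (A : E →ₗ.[ℂ] E) (h : E) : (graphProj A h).snd = mulInvOneAddSq A h := rfl

theorem graphProj_mem (A : E →ₗ.[ℂ] E) (h : E) : graphProj A h ∈ closedGraph A :=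
  Submodule.starProjection_apply_mem _ _

theorem mem_closedGraph_of_mem_graph {A : E →ₗ.[ℂ] E} {p : E × E} (hp : p ∈ A.graph) :
    WithLp.toLp 2 p ∈ closedGraph A :=
  Submodule.le_topologicalClosure _ ⟨p, hp, rfl⟩

/-- An identity between continuous functions which holds on the graph holds on its closure. -/
theorem closedGraph_induction {A : E →ₗ.[ℂ] E} {P : WithLp 2 (E × E) → Prop}
    (hP : IsClosed {p | P p}) (h : ∀ p ∈ A.graph, P (WithLp.toLp 2 p)) :
    ∀ p ∈ closedGraph A, P p := by
  intro p hp
  have h1 : (closedGraph A : Set (WithLp 2 (E × E))) ⊆ {p | P p} := by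
    rw [closedGraph, Submodule.topologicalClosure_coe]
    refine closure_minimal ?_ hP
    rintro _ ⟨p, hp, rfl⟩
    exact h p hp
  exact h1 hp

/-- The vector (h, 0) minus its projection is orthogonal to the closed graph. All properties of (1 +
A*A)⁻¹ used here follow from this relation. -/
theorem graphProj_inner (A : E →ₗ.[ℂ] E) (h : E) {p : WithLp 2 (E × E)}
    (hp : p ∈ closedGraph A) :
    inner ℂ h p.fst = inner ℂ (invOneAddSq A h) p.fst + inner ℂ (mulInvOneAddSq A h) p.snd := by
  have h1 := Submodule.starProjection_inner_eq_zero (K := closedGraph A)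
    ((WithLp.prodContinuousLinearEquiv 2 ℂ E E).symm (ContinuousLinearMap.inl ℂ E E h)) p hp
  rw [inner_sub_left, sub_eq_zero] at h1
  have h2 : inner ℂ (graphProj A h) p = inner ℂ (invOneAddSq A h) p.fst
      + inner ℂ (mulInvOneAddSq A h) p.snd := WithLp.prod_inner_apply _ _
  rw [← h2]
  refine Eq.trans ?_ h1
  rw [WithLp.prod_inner_apply]
  simp

theorem inner_invOneAddSq (A : E →ₗ.[ℂ] E) (h k : E) :
    inner ℂ h (invOneAddSq A k) = inner ℂ (invOneAddSq A h) (invOneAddSq A k)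
      + inner ℂ (mulInvOneAddSq A h) (mulInvOneAddSq A k) :=
  graphProj_inner A h (graphProj_mem A k)

theorem norm_graphProj_sq (A : E →ₗ.[ℂ] E) (h : E) :
    ‖graphProj A h‖ ^ 2 = RCLike.re (inner ℂ h (invOneAddSq A h)) := by
  rw [inner_invOneAddSq, WithLp.prod_norm_sq_eq_of_L2, map_add, inner_self_eq_norm_sq,
    inner_self_eq_norm_sq]
  rfl

/-- By `inner_invOneAddSq`, the sesquilinear form of this operator is the Gram form of the
projections onto the graph. -/
theorem invOneAddSq_isPositive (A : E →ₗ.[ℂ] E) : (invOneAddSq A).IsPositive := by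
  rw [ContinuousLinearMap.isPositive_def]
  refine ⟨fun h k => ?_, fun h => ?_⟩
  · have h1 := inner_invOneAddSq A h k
    have h2 := congrArg conj (inner_invOneAddSq A k h)
    simp only [map_add, inner_conj_symm] at h2
    exact h2.trans h1.symm
  · rw [ContinuousLinearMap.reApplyInnerSelf_apply, ← inner_conj_symm, RCLike.conj_re,
      ← norm_graphProj_sq]
    positivity

theorem invOneAddSq_nonneg (A : E →ₗ.[ℂ] E) : 0 ≤ invOneAddSq A :=
  (ContinuousLinearMap.nonneg_iff_isPositive _).2 (invOneAddSq_isPositive A)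

theorem invOneAddSq_isSelfAdjoint (A : E →ₗ.[ℂ] E) : IsSelfAdjoint (invOneAddSq A) :=
  (invOneAddSq_isPositive A).isSelfAdjoint

theorem norm_invOneAddSq_le (A : E →ₗ.[ℂ] E) : ‖invOneAddSq A‖ ≤ 1 := by
  refine ContinuousLinearMap.opNorm_le_bound _ zero_le_one fun h => ?_
  rw [one_mul]
  have h1 : ‖invOneAddSq A h‖ ^ 2 ≤ ‖graphProj A h‖ ^ 2 := by
    rw [WithLp.prod_norm_sq_eq_of_L2, graphProj_fst]
    nlinarith [sq_nonneg ‖(graphProj A h).snd‖]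
  rw [norm_graphProj_sq] at h1
  have h2 := (RCLike.re_le_norm _).trans (norm_inner_le_norm (𝕜 := ℂ) h (invOneAddSq A h))
  rcases eq_or_lt_of_le (norm_nonneg (invOneAddSq A h)) with h3 | h3
  · rw [← h3]; positivity
  · nlinarith

theorem spectrum_invOneAddSq (A : E →ₗ.[ℂ] E) : spectrum ℝ (invOneAddSq A) ⊆ Icc 0 1 := by
  rcases subsingleton_or_nontrivial E with hE | hE
  · intro x hx
    exact absurd (spectrum.of_subsingleton (R := ℝ) (invOneAddSq A)) (Set.nonempty_iff_ne_empty.1 ⟨x, hx⟩)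
  intro x hx
  refine ⟨spectrum_nonneg_of_nonneg (invOneAddSq_nonneg A) hx, ?_⟩
  have h1 := IsometricContinuousFunctionalCalculus.norm_spectrum_le (𝕜 := ℝ) (invOneAddSq A) hx
    (invOneAddSq_isSelfAdjoint A)
  exact (le_abs_self x).trans (h1.trans (norm_invOneAddSq_le A))

/-- The power `(1 + A* A)^{-s}`. -/
def invPow (A : E →ₗ.[ℂ] E) (s : ℝ) : E →L[ℂ] E := cfc (fun t : ℝ => t ^ s) (invOneAddSq A)

theorem continuousOn_rpow_spectrum (A : E →ₗ.[ℂ] E) {s : ℝ} (hs : 0 ≤ s) :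
    ContinuousOn (fun t : ℝ => t ^ s) (spectrum ℝ (invOneAddSq A)) :=
  (Real.continuous_rpow_const hs).continuousOn

theorem invPow_mul (A : E →ₗ.[ℂ] E) {s t : ℝ} (hs : 0 < s) (ht : 0 < t) :
    invPow A s * invPow A t = invPow A (s + t) := by
  rw [invPow, invPow, ← cfc_mul _ _ _ (continuousOn_rpow_spectrum A hs.le)
    (continuousOn_rpow_spectrum A ht.le)]
  exact cfc_congr fun x hx => (Real.rpow_add_of_nonneg (spectrum_invOneAddSq A hx).1 hs.le ht.le).symm

theorem invPow_one (A : E →ₗ.[ℂ] E) : invPow A 1 = invOneAddSq A := by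
  rw [invPow]
  simp only [Real.rpow_one]
  exact cfc_id' ℝ _ (invOneAddSq_isSelfAdjoint A)

theorem invPow_isSelfAdjoint (A : E →ₗ.[ℂ] E) (s : ℝ) : IsSelfAdjoint (invPow A s) :=
  cfc_predicate _ _

theorem invPow_inner (A : E →ₗ.[ℂ] E) (s : ℝ) (x y : E) :
    inner ℂ (invPow A s x) y = inner ℂ x (invPow A s y) :=
  (invPow_isSelfAdjoint A s).isSymmetric x y

theorem invPow_comp (A : E →ₗ.[ℂ] E) {s t : ℝ} (hs : 0 < s) (ht : 0 < t) (x : E) :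
    invPow A s (invPow A t x) = invPow A (s + t) x := by
  rw [← invPow_mul A hs ht]; rfl

/-- This isometry identity is what allows `graphProj A` to be factored through (1 + A*A)^(-1/2). -/
theorem norm_invPow_half_sq (A : E →ₗ.[ℂ] E) (h : E) :
    ‖invPow A (1 / 2) h‖ ^ 2 = ‖graphProj A h‖ ^ 2 := by
  rw [norm_graphProj_sq, ← inner_self_eq_norm_sq (𝕜 := ℂ), invPow_inner,
    invPow_comp A (by norm_num) (by norm_num)]
  norm_num [invPow_one]

/-- The denominator t^(1/4) + (1-t)^(1/4) does not vanish on [0, 1], so its inverse is continuous on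
the spectrum. Hence 𝔥₁ lies in the range of (1 + A*A)^(-1/4), whose powers are easier to multiply.
-/
theorem exists_invOneAddSqrtAbs_eq (A : E →ₗ.[ℂ] E) :
    ∃ c : ℝ → ℝ, invOneAddSqrtAbs A = invPow A (1 / 4) * cfc c (invOneAddSq A) := by
  refine ⟨fun t => (t ^ (1 / 4 : ℝ) + (1 - t) ^ (1 / 4 : ℝ))⁻¹, ?_⟩
  have h1 : ContinuousOn (fun t : ℝ => (t ^ (1 / 4 : ℝ) + (1 - t) ^ (1 / 4 : ℝ))⁻¹)
      (spectrum ℝ (invOneAddSq A)) := by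
    refine ContinuousOn.mono (ContinuousOn.inv₀ ?_ ?_) (spectrum_invOneAddSq A)
    · exact ((Real.continuous_rpow_const (by norm_num)).add
        ((Real.continuous_rpow_const (by norm_num)).comp
          (continuous_const.sub continuous_id))).continuousOn
    · intro t ht
      rcases eq_or_lt_of_le ht.1 with h0 | h0
      · rw [← h0]; norm_num
      · have := Real.rpow_pos_of_pos h0 (1 / 4)
        have := Real.rpow_nonneg (sub_nonneg.2 ht.2) (1 / 4 : ℝ)
        positivity
  rw [invPow, ← cfc_mul _ _ _ (continuousOn_rpow_spectrum A (by norm_num)) h1]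
  rfl

/-- The operator `A` has trivial orthogonal complement of its domain. -/
def DenseDomain (A : E →ₗ.[ℂ] E) : Prop :=
  ∀ w : E, (∀ p ∈ A.graph, inner ℂ p.1 w = 0) → w = 0

/-- The operator `A` is symmetric. -/
def GraphSymmetric (A : E →ₗ.[ℂ] E) : Prop :=
  ∀ p ∈ A.graph, ∀ p' ∈ A.graph, inner ℂ p.2 p'.1 = inner ℂ p.1 p'.2

/-- The operator `A` is an extension of its adjoint. -/
def AdjointLE (A : E →ₗ.[ℂ] E) : Prop :=
  ∀ z w : E, (∀ p ∈ A.graph, inner ℂ p.2 z = inner ℂ p.1 w) → (z, w) ∈ A.graph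

/-- If w is orthogonal to the domain, then (0, w) is in the graph of the adjoint relation, hence in
the graph of A, and w = A 0 = 0. -/
theorem AdjointLE.denseDomain {A : E →ₗ.[ℂ] E} (hA : AdjointLE A) : DenseDomain A := by
  intro w hw
  have h1 := hA 0 w fun p hp => by rw [hw p hp, inner_zero_right]
  exact LinearPMap.graph_fst_eq_zero_snd A h1 rfl

theorem DenseDomain.invOneAddSq_injective {A : E →ₗ.[ℂ] E} (hA : DenseDomain A) {x : E}
    (hx : invOneAddSq A x = 0) : x = 0 := by
  have h0 : graphProj A x = 0 := by
    have h1 := norm_graphProj_sq A x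
    rw [hx, inner_zero_right, map_zero] at h1
    simpa using h1
  have h2 : mulInvOneAddSq A x = 0 := by rw [← graphProj_snd, h0]; rfl
  refine hA x fun p hp => ?_
  have h3 := graphProj_inner A x (mem_closedGraph_of_mem_graph hp)
  rw [hx, h2, inner_zero_left, inner_zero_left, add_zero] at h3
  exact (inner_eq_zero_symm.1 (by simpa using h3))

/-- The orthogonal complement of the range of the self-adjoint B^s, with B = (1 + A*A)⁻¹, is its
kernel; it lies in the kernel of B = B^(1-s) B^s, which is trivial. -/
theorem DenseDomain.denseRange_invPow {A : E →ₗ.[ℂ] E} (hA : DenseDomain A) {s : ℝ}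
    (hs : 0 < s) (hs1 : s < 1) : DenseRange (invPow A s) := by
  have h1 : ((invPow A s : E →L[ℂ] E) : E →ₗ[ℂ] E).range.topologicalClosure = ⊤ := by
    rw [Submodule.topologicalClosure_eq_top_iff, ContinuousLinearMap.orthogonal_range,
      (ContinuousLinearMap.isSelfAdjoint_iff').1 (invPow_isSelfAdjoint A s), LinearMap.ker_eq_bot']
    intro x hx
    apply hA.invOneAddSq_injective
    have h2 := invPow_comp A (sub_pos.2 hs1) hs x
    rw [show invPow A s x = 0 from hx, map_zero, sub_add_cancel, invPow_one] at h2
    exact h2.symm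
  exact Submodule.dense_iff_topologicalClosure_eq_top.2 h1

/-- The isometry of `E` into the closed graph of `A` with `(1 + A* A)^{-1/2} h ↦ graphProj A h`. -/
def graphMap (A : E →ₗ.[ℂ] E) : E →L[ℂ] WithLp 2 (E × E) :=
  ((graphProj A : E →L[ℂ] WithLp 2 (E × E)) : E →ₗ[ℂ] WithLp 2 (E × E)).extendOfNorm
    ((invPow A (1 / 2) : E →L[ℂ] E) : E →ₗ[ℂ] E)

/-- The bounded operator `A (1 + A* A)^{-1/2}`. -/
def boundedTransform (A : E →ₗ.[ℂ] E) : E →L[ℂ] E :=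
  (ContinuousLinearMap.snd ℂ E E) ∘L
    (WithLp.prodContinuousLinearEquiv 2 ℂ E E).toContinuousLinearMap ∘L graphMap A

theorem norm_graphProj_le (A : E →ₗ.[ℂ] E) (h : E) :
    ‖graphProj A h‖ ≤ 1 * ‖invPow A (1 / 2) h‖ := by
  rw [one_mul]
  exact (pow_le_pow_iff_left₀ (norm_nonneg _) (norm_nonneg _) two_ne_zero).1
    (norm_invPow_half_sq A h).ge

variable {A : E →ₗ.[ℂ] E}

theorem DenseDomain.graphMap_apply (hA : DenseDomain A) (h : E) :
    graphMap A (invPow A (1 / 2) h) = graphProj A h :=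
  LinearMap.extendOfNorm_eq (hA.denseRange_invPow (by norm_num) (by norm_num))
    ⟨1, norm_graphProj_le A⟩ h

theorem DenseDomain.norm_graphMap_le (hA : DenseDomain A) (h : E) : ‖graphMap A h‖ ≤ ‖h‖ := by
  have := LinearMap.norm_extendOfNorm_apply_le
    (hA.denseRange_invPow (s := 1 / 2) (by norm_num) (by norm_num)) 1 (norm_graphProj_le A) h
  rwa [one_mul] at this

theorem DenseDomain.graphMap_mem (hA : DenseDomain A) (h : E) : graphMap A h ∈ closedGraph A := by
  refine (hA.denseRange_invPow (s := 1 / 2) (by norm_num) (by norm_num)).induction_on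
    (p := fun h => graphMap A h ∈ closedGraph A) h ?_ fun k => ?_
  · exact (Submodule.isClosed_topologicalClosure _).preimage (graphMap A).continuous
  · rw [hA.graphMap_apply]; exact graphProj_mem A k

theorem DenseDomain.graphMap_fst (hA : DenseDomain A) (h : E) :
    (graphMap A h).fst = invPow A (1 / 2) h := by
  refine (hA.denseRange_invPow (s := 1 / 2) (by norm_num) (by norm_num)).induction_on
    (p := fun h => (graphMap A h).fst = invPow A (1 / 2) h) h ?_ fun k => ?_
  · exact isClosed_eq (by fun_prop) (by fun_prop)
  · rw [hA.graphMap_apply, invPow_comp A (by norm_num) (by norm_num), graphProj_fst]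
    norm_num [invPow_one]

theorem graphMap_snd (h : E) : (graphMap A h).snd = boundedTransform A h := rfl

theorem DenseDomain.boundedTransform_apply (hA : DenseDomain A) (h : E) :
    boundedTransform A (invPow A (1 / 2) h) = mulInvOneAddSq A h := by
  rw [← graphMap_snd, hA.graphMap_apply]; rfl

theorem DenseDomain.norm_boundedTransform_le (hA : DenseDomain A) (h : E) :
    ‖boundedTransform A h‖ ≤ ‖h‖ :=
  (WithLp.norm_snd_le _ _).trans (hA.norm_graphMap_le h)

theorem GraphSymmetric.inner_closedGraph (hA : GraphSymmetric A) :
    ∀ p ∈ closedGraph A, ∀ p' ∈ closedGraph A, inner ℂ p.snd p'.fst = inner ℂ p.fst p'.snd := by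
  have h1 : ∀ p ∈ A.graph, ∀ p' ∈ closedGraph A, inner ℂ p.2 p'.fst = inner ℂ p.1 p'.snd := by
    intro p hp
    refine closedGraph_induction (P := fun p' => inner ℂ p.2 p'.fst = inner ℂ p.1 p'.snd)
      (isClosed_eq (by fun_prop) (by fun_prop)) fun p' hp' => hA p hp p' hp'
  intro p hp p' hp'
  exact closedGraph_induction (P := fun p => inner ℂ p.snd p'.fst = inner ℂ p.fst p'.snd)
      (isClosed_eq (by fun_prop) (by fun_prop)) (fun q hq => h1 q hq p' hp') p hp

end OperatorTheory

/-! ### Self-adjoint operators on the scale, and form estimates for symmetric operators. -/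

section OperatorTheory

variable {E : Type*} [NormedAddCommGroup E] [InnerProductSpace ℂ E] [CompleteSpace E]
  {A : E →ₗ.[ℂ] E}

/-- The symmetry relation survives passage to the closure, so the closed graph lies in the adjoint,
which A contains. In particular A is closed. -/
theorem AdjointLE.closedGraph_le (hA : AdjointLE A) (hs : GraphSymmetric A)
    {p : WithLp 2 (E × E)} (hp : p ∈ closedGraph A) : (p.fst, p.snd) ∈ A.graph :=
  hA _ _ fun _ hq => hs.inner_closedGraph _ (mem_closedGraph_of_mem_graph hq) p hp

theorem AdjointLE.mem_graph_invOneAddSq (hA : AdjointLE A) (hs : GraphSymmetric A) (x : E) :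
    (invOneAddSq A x, mulInvOneAddSq A x) ∈ A.graph :=
  hA.closedGraph_le hs (graphProj_mem A x)

/-- The conjugated orthogonality relation of the projection says that A* applied to A(1 + A*A)⁻¹ x
is x - (1 + A*A)⁻¹ x. -/
theorem AdjointLE.mem_graph_mulInvOneAddSq (hA : AdjointLE A) (x : E) :
    (mulInvOneAddSq A x, x - invOneAddSq A x) ∈ A.graph := by
  refine hA _ _ fun p hp => ?_
  have h1 := graphProj_inner A x (mem_closedGraph_of_mem_graph hp)
  have h2 := congrArg conj h1
  simp only [map_add, inner_conj_symm] at h2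
  rw [inner_sub_right]
  exact eq_sub_of_add_eq' h2.symm

/-- Uniqueness for (1 + A²)p = x: the difference d of two solutions satisfies ‖A d‖² = ⟨d, A² d⟩ =
-‖d‖². -/
theorem AdjointLE.eq_invOneAddSq (hA : AdjointLE A) (hs : GraphSymmetric A) {x p a : E}
    (h1 : (p, a) ∈ A.graph) (h2 : (a, x - p) ∈ A.graph) : p = invOneAddSq A x := by
  have h3 := A.graph.sub_mem h1 (hA.mem_graph_invOneAddSq hs x)
  have h4 := A.graph.sub_mem h2 (hA.mem_graph_mulInvOneAddSq x)
  simp only [Prod.mk_sub_mk, sub_sub_sub_cancel_left] at h3 h4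
  have h5 := hs _ h3 _ h4
  simp only at h5
  have h6 : ‖a - mulInvOneAddSq A x‖ ^ 2 + ‖p - invOneAddSq A x‖ ^ 2 = 0 := by
    rw [← inner_self_eq_norm_sq (𝕜 := ℂ), h5, ← inner_self_eq_norm_sq (𝕜 := ℂ), ← map_add,
      ← inner_add_right]
    simp
  have h7 : ‖p - invOneAddSq A x‖ ^ 2 = 0 := by nlinarith [sq_nonneg ‖a - mulInvOneAddSq A x‖]
  simpa [sub_eq_zero] using h7

theorem AdjointLE.mulInvOneAddSq_comm (hA : AdjointLE A) (hs : GraphSymmetric A) (x : E) :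
    mulInvOneAddSq A (invOneAddSq A x) = invOneAddSq A (mulInvOneAddSq A x) := by
  have h1 := hA.mem_graph_mulInvOneAddSq (invOneAddSq A x)
  have h2 := A.graph.sub_mem (hA.mem_graph_invOneAddSq hs x)
    (hA.mem_graph_invOneAddSq hs (invOneAddSq A x))
  exact hA.eq_invOneAddSq hs h1 h2

/-- On the dense range of (1 + A*A)^(-1/2) the bounded transform acts as A(1 + A*A)⁻¹, which
commutes with (1 + A*A)⁻¹ by the uniqueness above. -/
theorem AdjointLE.commute_boundedTransform (hA : AdjointLE A) (hs : GraphSymmetric A) :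
    Commute (invOneAddSq A) (boundedTransform A) := by
  have hd := hA.denseDomain
  ext x
  refine (hd.denseRange_invPow (s := 1 / 2) (by norm_num) (by norm_num)).induction_on
    (p := fun x => invOneAddSq A (boundedTransform A x) = boundedTransform A (invOneAddSq A x))
    x (isClosed_eq (by fun_prop) (by fun_prop)) fun y => ?_
  have h1 : invOneAddSq A (invPow A (1 / 2) y) = invPow A (1 / 2) (invOneAddSq A y) := by
    rw [← invPow_one, invPow_comp A (by norm_num) (by norm_num),
      invPow_comp A (by norm_num) (by norm_num), add_comm]
  rw [h1, hd.boundedTransform_apply, hd.boundedTransform_apply, hA.mulInvOneAddSq_comm hs]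

theorem invPow_eq_mul_self (A : E →ₗ.[ℂ] E) :
    invPow A (1 / 2) = invPow A (1 / 4) * invPow A (1 / 4) := by
  rw [invPow_mul A (by norm_num) (by norm_num)]; norm_num

/-- If `A` is self-adjoint, it maps `𝔥ₙ₊₂` to `𝔥ₙ`. -/
theorem AdjointLE.exists_mem_graph_of_mem_scale (hA : AdjointLE A) (hs : GraphSymmetric A) {n : ℕ}
    {u : E} (hu : u ∈ scale A (n + 2)) : ∃ w ∈ scale A n, (u, w) ∈ A.graph := by
  have hd := hA.denseDomain
  obtain ⟨h, rfl⟩ := hu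
  obtain ⟨c, hc⟩ := exists_invOneAddSqrtAbs_eq A
  have hcR : Commute (cfc c (invOneAddSq A)) (invPow A (1 / 4)) := cfc_commute_cfc _ _ _
  -- Two factors (1 + |A|^(1/2))⁻¹ contain one factor (1 + A²)^(-1/2), which A turns into the
  -- bounded transform. The latter commutes with the remaining n factors, so the image stays in 𝔥ₙ.
  have h2 : invOneAddSqrtAbs A ^ 2 = invPow A (1 / 2) * (cfc c (invOneAddSq A)) ^ 2 := by
    rw [hc, hcR.symm.mul_pow, invPow_eq_mul_self, sq (invPow A (1 / 4))]
  have h3 : Commute (invOneAddSqrtAbs A) (invPow A (1 / 2)) := cfc_commute_cfc _ _ _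
  have h4 : Commute (invOneAddSqrtAbs A) (boundedTransform A) :=
    (hA.commute_boundedTransform hs).cfc_real _
  set k := ((cfc c (invOneAddSq A)) ^ 2) h
  have h5 : (invOneAddSqrtAbs A ^ (n + 2)) h = invPow A (1 / 2) ((invOneAddSqrtAbs A ^ n) k) := by
    have : invOneAddSqrtAbs A ^ (n + 2)
        = invPow A (1 / 2) * (invOneAddSqrtAbs A ^ n * (cfc c (invOneAddSq A)) ^ 2) := by
      rw [pow_add, h2, ← mul_assoc, ← mul_assoc, (h3.pow_left n).eq]
    rw [this]; rfl
  refine ⟨boundedTransform A ((invOneAddSqrtAbs A ^ n) k), ⟨boundedTransform A k, ?_⟩, ?_⟩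
  · exact DFunLike.congr_fun (h4.pow_left n).eq k
  · have h6 := hA.closedGraph_le hs (hd.graphMap_mem ((invOneAddSqrtAbs A ^ n) k))
    rw [hd.graphMap_fst, graphMap_snd, ← h5] at h6
    exact h6

/-- With u = R y, R = (1 + A*A)^(-1/2), this bounds Re ⟨u, A u⟩ (for the closure of A) by ‖(1 +
A*A)^(1/4) u‖². The operator T = R V, with V the bounded transform, is symmetric and satisfies T² ≤
R². The square root is operator monotone, so T ≤ |T| ≤ R. Only symmetry and density are needed, not
self-adjointness. -/
theorem GraphSymmetric.re_inner_boundedTransform_le (hs : GraphSymmetric A) (hd : DenseDomain A)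
    (y : E) : (inner ℂ (invPow A (1 / 2) y) (boundedTransform A y)).re
      ≤ ‖invPow A (1 / 4) y‖ ^ 2 := by
  set R := invPow A (1 / 2) with hR
  set V := boundedTransform A with hV
  have hRR : ∀ x, R (R x) = invOneAddSq A x := fun x => by
    rw [hR, invPow_comp A (by norm_num) (by norm_num)]; norm_num [invPow_one]
  set T := R * V with hT
  have hTs : IsSelfAdjoint T := by
    rw [ContinuousLinearMap.isSelfAdjoint_iff_isSymmetric]
    intro x y
    have h1 := hs.inner_closedGraph _ (hd.graphMap_mem x) _ (hd.graphMap_mem y)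
    rw [hd.graphMap_fst, hd.graphMap_fst, graphMap_snd, graphMap_snd] at h1
    calc inner ℂ (R (V x)) y = inner ℂ (V x) (R y) := invPow_inner A _ _ _
      _ = inner ℂ (R x) (V y) := h1
      _ = inner ℂ x (R (V y)) := invPow_inner A _ _ _
  -- By symmetry of T, ‖T x‖² = ⟨x, R V T x⟩ = ⟨R x, V T x⟩, and V is a contraction.
  have hTle : ∀ x, ‖T x‖ ≤ ‖R x‖ := by
    intro x
    have h1 : ‖T x‖ ^ 2 ≤ ‖R x‖ * ‖T x‖ := by
      rw [← inner_self_eq_norm_sq (𝕜 := ℂ)]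
      have h2 : inner ℂ (T x) (T x) = inner ℂ (R x) (V (T x)) := by
        rw [hTs.isSymmetric.apply_clm x (T x)]
        exact (invPow_inner A _ _ _).symm
      rw [h2]
      refine (RCLike.re_le_norm _).trans ((norm_inner_le_norm _ _).trans ?_)
      exact mul_le_mul_of_nonneg_left (hd.norm_boundedTransform_le _) (norm_nonneg _)
    rcases eq_or_lt_of_le (norm_nonneg (T x)) with h3 | h3
    · rw [← h3]; positivity
    · nlinarith
  have hsq : T * T ≤ invOneAddSq A := by
    rw [ContinuousLinearMap.le_def, ContinuousLinearMap.isPositive_def']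
    refine ⟨(invOneAddSq_isSelfAdjoint A).sub (by simpa [sq] using hTs.pow 2), fun x => ?_⟩
    rw [ContinuousLinearMap.reApplyInnerSelf_apply, _root_.sub_apply,
      inner_sub_left, map_sub, sub_nonneg, ← hRR, hR, invPow_inner, ← hR]
    have h1 : inner ℂ ((T * T) x) x = inner ℂ (T x) (T x) := hTs.isSymmetric (T x) x
    rw [h1, inner_self_eq_norm_sq, inner_self_eq_norm_sq]
    exact pow_le_pow_left₀ (norm_nonneg _) (hTle x) 2
  have hRnn : 0 ≤ R := cfc_nonneg fun t ht => Real.rpow_nonneg (spectrum_invOneAddSq A ht).1 _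
  have habs : CFC.abs T ≤ R := by
    have h1 := CFC.sqrt_le_sqrt _ _ hsq
    have h2 : CFC.sqrt (invOneAddSq A) = R := by
      have : invOneAddSq A = R ^ 2 := by ext x; rw [sq]; exact (hRR x).symm
      rw [this, CFC.sqrt_sq R hRnn]
    have h3 : CFC.abs T = CFC.sqrt (T * T) := by rw [CFC.abs, hTs.star_eq]
    rwa [h3, ← h2]
  have hTR : T ≤ R := by
    refine le_trans ?_ habs
    have h1 := CFC.abs_sub_self T hTs
    -- The difference |T| - T is twice the negative part of T.
    rw [← sub_nonneg, h1]
    exact nsmul_nonneg (CFC.negPart_nonneg T) 2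
  have h1 := (ContinuousLinearMap.le_def _ _).1 hTR
  have h2 := h1.re_inner_nonneg_right y
  rw [_root_.sub_apply, inner_sub_right, map_sub, sub_nonneg] at h2
  calc (inner ℂ (R y) (V y)).re = RCLike.re (inner ℂ y (T y)) := by
        rw [hR, invPow_inner]; rfl
    _ ≤ _ := h2
    _ = _ := by
        rw [hR, invPow_eq_mul_self, ← inner_self_eq_norm_sq (𝕜 := ℂ), invPow_inner]; rfl

/-- A form estimate on the graph of a symmetric operator extends to `𝔥₁`. -/
theorem GraphSymmetric.exists_mem_of_mem_scale_one (hs : GraphSymmetric A) (hd : DenseDomain A)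
    {F : Type*} [NormedAddCommGroup F] [InnerProductSpace ℂ F] [CompleteSpace F]
    (T : A.graph →ₗ[ℂ] F) (C : ℝ) (hC : 0 ≤ C)
    (hT : ∀ p : A.graph, ‖T p‖ ^ 2 ≤ 2 * (inner ℂ p.1.1 p.1.2).re + C * ‖p.1.1‖ ^ 2)
    {K : Set (E × F)} (hK : IsClosed K) (hTK : ∀ p : A.graph, (p.1.1, T p) ∈ K)
    {u : E} (hu : u ∈ scale A 1) : ∃ y, (u, y) ∈ K := by
  -- The map T is extended to the closed graph, pulled back to `E` along `graphMap`, and then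
  -- factored through (1 + A*A)^(-1/4). The closed relation K is carried along by density at each
  -- stage, so that the final value is still tied to u.
  have hP0 : DenseRange (invPow A (1 / 4)) := hd.denseRange_invPow (by norm_num) (by norm_num)
  let e : A.graph →ₗ[ℂ] closedGraph A :=
    { toFun := fun p => ⟨WithLp.toLp 2 p.1, mem_closedGraph_of_mem_graph p.2⟩
      map_add' := fun p q => rfl
      map_smul' := fun c p => rfl }
  have he : DenseRange e := by
    intro p
    rw [mem_closure_iff_seq_limit]
    have hp : (p : WithLp 2 (E × E)) ∈ closure ((A.graph.map
        (WithLp.linearEquiv 2 ℂ (E × E)).symm.toLinearMap : Submodule ℂ (WithLp 2 (E × E))) :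
          Set (WithLp 2 (E × E))) := p.2
    rw [mem_closure_iff_seq_limit] at hp
    obtain ⟨x, hx, hlim⟩ := hp
    refine ⟨fun n => ⟨x n, Submodule.le_topologicalClosure _ (hx n)⟩, fun n => ?_, ?_⟩
    · obtain ⟨a, ha, hax⟩ := hx n
      exact ⟨⟨a, ha⟩, Subtype.ext hax⟩
    · exact tendsto_subtype_rng.2 hlim
  -- Since 2 Re ⟨u, A u⟩ ≤ ‖u‖² + ‖A u‖², the form bound gives boundedness in the graph norm.
  have hTe : ∀ p, ‖T p‖ ≤ √(1 + C) * ‖e p‖ := by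
    intro p
    refine (pow_le_pow_iff_left₀ (norm_nonneg _) (by positivity) two_ne_zero).1 ?_
    rw [mul_pow, Real.sq_sqrt (by positivity)]
    have h1 : ‖e p‖ ^ 2 = ‖p.1.1‖ ^ 2 + ‖p.1.2‖ ^ 2 := WithLp.prod_norm_sq_eq_of_L2 _
    have h2 : (inner ℂ p.1.1 p.1.2).re ≤ ‖p.1.1‖ * ‖p.1.2‖ :=
      (Complex.re_le_norm _).trans (norm_inner_le_norm _ _)
    rw [h1]
    nlinarith [hT p, sq_nonneg (‖p.1.1‖ - ‖p.1.2‖), mul_nonneg hC (sq_nonneg ‖p.1.2‖)]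
  set T1 := T.extendOfNorm e with hT1
  have hT1e : ∀ p, T1 (e p) = T p := LinearMap.extendOfNorm_eq he ⟨_, hTe⟩
  have hT1b : ∀ p : closedGraph A,
      ‖T1 p‖ ^ 2 ≤ 2 * (inner ℂ p.1.fst p.1.snd).re + C * ‖p.1.fst‖ ^ 2 := by
    intro p
    refine he.induction_on (p := fun p : closedGraph A =>
      ‖T1 p‖ ^ 2 ≤ 2 * (inner ℂ p.1.fst p.1.snd).re + C * ‖p.1.fst‖ ^ 2) p ?_ fun a => ?_
    · refine isClosed_le (by fun_prop) ?_
      have : Continuous fun p : closedGraph A => (inner ℂ p.1.fst p.1.snd).re :=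
        Complex.continuous_re.comp (by fun_prop)
      fun_prop
    · rw [hT1e]; exact hT a
  have hT1K : ∀ p : closedGraph A, (p.1.fst, T1 p) ∈ K := by
    intro p
    refine he.induction_on (p := fun p : closedGraph A => (p.1.fst, T1 p) ∈ K) p ?_ fun a => ?_
    · exact hK.preimage (by fun_prop)
    · rw [hT1e]; exact hTK a
  set T2 : E →L[ℂ] F := T1 ∘L (graphMap A).codRestrict (closedGraph A) hd.graphMap_mem with hT2
  -- The form term contributes 2‖(1 + A*A)^(-1/4) y‖² by `re_inner_boundedTransform_le`; the term
  -- with C is handled by splitting (1 + A*A)^(-1/2) into two fourth-root factors.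
  have hT2b : ∀ y, ‖T2 y‖ ≤ √(2 + C * ‖invPow A (1 / 4)‖ ^ 2) * ‖invPow A (1 / 4) y‖ := by
    intro y
    refine (pow_le_pow_iff_left₀ (norm_nonneg _) (by positivity) two_ne_zero).1 ?_
    rw [mul_pow, Real.sq_sqrt (by positivity)]
    have h1 := hT1b ⟨graphMap A y, hd.graphMap_mem y⟩
    simp only [hd.graphMap_fst, graphMap_snd] at h1
    have h2 := hs.re_inner_boundedTransform_le hd y
    have h3 : ‖invPow A (1 / 2) y‖ ≤ ‖invPow A (1 / 4)‖ * ‖invPow A (1 / 4) y‖ := by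
      rw [invPow_eq_mul_self]; exact (invPow A (1 / 4)).le_opNorm _
    have h4 := pow_le_pow_left₀ (norm_nonneg _) h3 2
    rw [mul_pow] at h4
    have h5 := mul_le_mul_of_nonneg_left h4 hC
    have h6 : ‖T2 y‖ ^ 2 = ‖T1 ⟨graphMap A y, hd.graphMap_mem y⟩‖ ^ 2 := rfl
    rw [h6]
    nlinarith
  obtain ⟨h, rfl⟩ := hu
  obtain ⟨c, hc⟩ := exists_invOneAddSqrtAbs_eq A
  set T3 := (T2 : E →ₗ[ℂ] F).extendOfNorm ((invPow A (1 / 4) : E →L[ℂ] E) : E →ₗ[ℂ] E) with hT3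
  have hT3e : ∀ y, T3 (invPow A (1 / 4) y) = T2 y :=
    fun y => LinearMap.extendOfNorm_eq hP0 ⟨_, hT2b⟩ y
  -- An element of 𝔥₁ is (1 + A*A)^(-1/4) applied to this vector, and `T3` is T2 composed with the
  -- inverse of that power.
  refine ⟨T3 (cfc c (invOneAddSq A) h), ?_⟩
  have h1 : (invOneAddSqrtAbs A ^ 1) h = invPow A (1 / 4) (cfc c (invOneAddSq A) h) := by
    rw [pow_one, hc]; rfl
  rw [ContinuousLinearMap.coe_coe, h1]
  refine hP0.induction_on (p := fun x => (invPow A (1 / 4) x, T3 x) ∈ K) _ ?_ fun y => ?_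
  · exact hK.preimage (by fun_prop)
  · rw [hT3e]
    have h2 := hT1K ⟨graphMap A y, hd.graphMap_mem y⟩
    simp only [hd.graphMap_fst] at h2
    have h3 : invPow A (1 / 4) (invPow A (1 / 4) y) = invPow A (1 / 2) y := by
      rw [invPow_eq_mul_self]; rfl
    rw [h3]
    exact h2

end OperatorTheory

/-! ### Representation of functionals by elements of 𝔥₋ₙ. -/

section OperatorTheory

variable {E : Type*} [NormedAddCommGroup E] [InnerProductSpace ℂ E] [CompleteSpace E]

theorem invOneAddSqrtAbs_pow_inner (A : E →ₗ.[ℂ] E) (n : ℕ) (x y : E) :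
    inner ℂ ((invOneAddSqrtAbs A ^ n) x) y = inner ℂ x ((invOneAddSqrtAbs A ^ n) y) :=
  ((cfc_predicate _ _ : IsSelfAdjoint (invOneAddSqrtAbs A)).pow n).isSymmetric x y

/-- A continuous functional of `h` which depends only on `(1 + |A|^{1/2})⁻ⁿ h` is given by an
element of `𝔥₋ₙ`. -/
theorem exists_pairing_eq (A : E →ₗ.[ℂ] E) (n : ℕ) (Λ : E →L[ℂ] ℂ)
    (hΛ : ∀ h, (invOneAddSqrtAbs A ^ n) h = 0 → Λ h = 0) :
    ∃ G : NegScale A n, ∀ h, pairing A n G ((invOneAddSqrtAbs A ^ n) h) = Λ h := by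
  set Q := invOneAddSqrtAbs A ^ n with hQ
  have hQs : IsSelfAdjoint Q := (cfc_predicate _ _ : IsSelfAdjoint (invOneAddSqrtAbs A)).pow n
  set η := (InnerProductSpace.toDual ℂ E).symm Λ with hη
  have hηΛ : ∀ h, inner ℂ η h = Λ h := fun h => InnerProductSpace.toDual_symm_apply
  -- The Riesz vector is orthogonal to the kernel of the self-adjoint Q, hence lies in the closure
  -- of its range.
  have h1 : η ∈ ((Q : E →L[ℂ] E) : E →ₗ[ℂ] E).range.topologicalClosure := by
    rw [← Submodule.orthogonal_orthogonal_eq_closure, ContinuousLinearMap.orthogonal_range,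
      (ContinuousLinearMap.isSelfAdjoint_iff').1 hQs, Submodule.mem_orthogonal']
    intro h hh
    rw [hηΛ]
    exact hΛ h hh
  have h2 : η ∈ closure (Set.range Q) := h1
  rw [mem_closure_iff_seq_limit] at h2
  obtain ⟨x, hx, hlim⟩ := h2
  choose ψ hψ using hx
  let Ψ : ℕ → PreNegScale A n := ψ
  -- The norm of 𝔥₋ₙ is ‖Q ·‖, so convergence of Q ψᵢ in `E` is the Cauchy property of ψᵢ; the limit
  -- need not come from a vector of `E`.
  have h3 : CauchySeq Ψ := by
    rw [Metric.cauchySeq_iff]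
    intro ε hε
    obtain ⟨N, hN⟩ := Metric.cauchySeq_iff.1 hlim.cauchySeq ε hε
    refine ⟨N, fun i hi j hj => ?_⟩
    have h4 : dist (Ψ i) (Ψ j) = dist (x i) (x j) := by
      rw [dist_eq_norm, dist_eq_norm, ← hψ i, ← hψ j, ← map_sub]
      rfl
    rw [h4]
    exact hN i hi j hj
  have h4 : CauchySeq fun i => (Ψ i : NegScale A n) :=
    h3.map (UniformSpace.Completion.uniformContinuous_coe _)
  obtain ⟨G, hG⟩ := cauchySeq_tendsto_of_complete h4
  refine ⟨G, fun h => ?_⟩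
  have h5 : Tendsto (fun i => pairing A n (Ψ i : NegScale A n) (Q h)) atTop
      (𝓝 (pairing A n G (Q h))) :=
    (UniformSpace.Completion.continuous_extension.tendsto G).comp hG
  have h6 : Tendsto (fun i => pairing A n (Ψ i : NegScale A n) (Q h)) atTop
      (𝓝 (inner ℂ η h)) := by
    have h7 : ∀ i, pairing A n (Ψ i : NegScale A n) (Q h) = inner ℂ (x i) h := by
      intro i
      rw [← hψ i]
      exact (pairing_coe A n ⟨h, rfl⟩ (Ψ i)).trans (invOneAddSqrtAbs_pow_inner A n (ψ i) h).symm
    simp only [h7]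
    exact hlim.inner tendsto_const_nhds
  rw [tendsto_nhds_unique h5 h6, hηΛ]

end OperatorTheory

/-! ### Local solvability of the differential equation and compactly supported elements of the
domain. -/

section Existence

theorem IsPrim.hasDerivAt {P p : ℝ → ℂ} {a b x : ℝ} (h : IsPrim P p a b) (hx : x ∈ Ioo a b)
    (hp : ContinuousOn p (Icc a b)) : HasDerivAt P (p x) x := by
  have hab : a ≤ b := (hx.1.trans hx.2).le
  have hn : Icc a b ∈ 𝓝 x := Icc_mem_nhds hx.1 hx.2
  have h1 : HasDerivAt (fun y => ∫ t in a..y, p t) (p x) x := by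
    refine intervalIntegral.integral_hasDerivAt_right (h.1.mono_set ?_) ?_ (hp.continuousAt hn)
    · exact uIcc_subset_uIcc left_mem_uIcc (by rw [uIcc_of_le hab]; exact Ioo_subset_Icc_self hx)
    · exact ⟨Icc a b, hn, hp.aestronglyMeasurable measurableSet_Icc⟩
  refine (h1.const_add (P a)).congr_of_eventuallyEq ?_
  filter_upwards [hn] with y hy using h.2 y hy

/-- The initial value problem for `y'' = V y - h` with integrable coefficients on a short
interval. -/
theorem exists_isPrim_isPrim {V h : ℝ → ℂ} {α β e : ℝ} (hαβ : α ≤ β)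
    (hV : IntervalIntegrable V volume α β) (hh : IntervalIntegrable h volume α β)
    (hsmall : (β - α) * ∫ x in α..β, ‖V x‖ ≤ 1 / 2) (he : e ∈ Icc α β) (c₀ c₁ : ℂ) :
    ∃ y y' : ℝ → ℂ, IsPrim y y' α β ∧ IsPrim y' (fun x => V x * y x - h x) α β ∧
      y e = c₀ ∧ y' e = c₁ := by
  let ext : C(Icc α β, ℂ) → ℝ → ℂ := fun p => IccExtend hαβ p
  have hext : ∀ p, Continuous (ext p) := fun p => p.continuous.Icc_extend'
  let Y : C(Icc α β, ℂ) → ℝ → ℂ := fun p x => c₀ + ∫ t in e..x, ext p t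
  have hY : ∀ p, Continuous (Y p) := fun p =>
    continuous_const.add (intervalIntegral.continuous_primitive
      (fun a b => (hext p).intervalIntegrable a b) e)
  let F : C(Icc α β, ℂ) → ℝ → ℂ := fun p x => V x * Y p x - h x
  have hF : ∀ p, IntervalIntegrable (F p) volume α β := fun p =>
    (hV.mul_continuousOn (hY p).continuousOn).sub hh
  have hsub : ∀ x ∈ Icc α β, ∀ y ∈ Icc α β, uIcc x y ⊆ uIcc α β := by
    intro x hx y hy
    rw [← uIcc_of_le hαβ] at hx hy
    exact uIcc_subset_uIcc hx hy
  -- The unknown is p = y', with y = `Y p` recovered by integration. The Lipschitz constant of this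
  -- map is at most (β - α) ∫ ‖V‖ ≤ 1/2.
  let T : C(Icc α β, ℂ) → C(Icc α β, ℂ) := fun p =>
    ⟨fun x => c₁ + ∫ t in e..(x : ℝ), F p t, by
      have h1 : ContinuousOn (fun x => ∫ t in e..x, F p t) (uIcc α β) :=
        intervalIntegral.continuousOn_primitive_interval' (hF p) (by rwa [uIcc_of_le hαβ])
      rw [uIcc_of_le hαβ] at h1
      exact continuous_const.add (continuousOn_iff_continuous_domRestrict.1 h1)⟩
  have hdist : ∀ p r : C(Icc α β, ℂ), ∀ t ∈ Icc α β, ‖Y p t - Y r t‖ ≤ (β - α) * dist p r := by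
    intro p r t ht
    have h1 : Y p t - Y r t = ∫ s in e..t, (ext p s - ext r s) := by
      rw [intervalIntegral.integral_sub ((hext p).intervalIntegrable _ _)
        ((hext r).intervalIntegrable _ _)]
      simp only [Y]; ring
    rw [h1]
    have h2 : ‖∫ s in e..t, (ext p s - ext r s)‖ ≤ dist p r * |t - e| := by
      refine intervalIntegral.norm_integral_le_of_norm_le_const fun s _ => ?_
      rw [← dist_eq_norm]
      exact ContinuousMap.dist_apply_le_dist _
    refine h2.trans ?_
    rw [mul_comm]
    refine mul_le_mul_of_nonneg_right ?_ dist_nonneg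
    rw [abs_le]
    constructor <;> linarith [ht.1, ht.2, he.1, he.2]
  have hT : ContractingWith (1 / 2) T := by
    refine ⟨by rw [← NNReal.coe_lt_coe]; norm_num, LipschitzWith.of_dist_le_mul fun p r => ?_⟩
    rw [ContinuousMap.dist_le (by positivity)]
    intro x
    have hi := hsub e he x x.2
    have h1 : T p x - T r x = ∫ t in e..(x : ℝ), V t * (Y p t - Y r t) := by
      have h2 : ∀ t, V t * (Y p t - Y r t) = F p t - F r t := fun t => by
        simp only [F]; ring
      simp only [h2]
      rw [intervalIntegral.integral_sub ((hF p).mono_set hi) ((hF r).mono_set hi)]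
      simp only [T, ContinuousMap.coe_mk]; ring
    rw [dist_eq_norm, h1]
    have h3 : ‖∫ t in e..(x : ℝ), V t * (Y p t - Y r t)‖
        ≤ |∫ t in e..(x : ℝ), ‖V t‖ * ((β - α) * dist p r)| := by
      refine intervalIntegral.norm_integral_le_abs_of_norm_le ?_
        ((hV.norm.mul_const _).mono_set hi)
      refine ae_restrict_of_forall_mem measurableSet_uIoc fun t ht => ?_
      rw [norm_mul]
      refine mul_le_mul_of_nonneg_left (hdist p r t ?_) (norm_nonneg _)
      have := hi (uIoc_subset_uIcc ht)
      rwa [uIcc_of_le hαβ] at this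
    refine h3.trans ?_
    have h4 : |∫ t in e..(x : ℝ), ‖V t‖ * ((β - α) * dist p r)|
        ≤ |∫ t in α..β, ‖V t‖ * ((β - α) * dist p r)| := by
      refine intervalIntegral.abs_integral_mono_interval ?_ ?_ (hV.norm.mul_const _)
      · rw [uIoc_of_le hαβ]
        intro t ht
        rcases le_total e x with hex | hex
        · rw [uIoc_of_le hex] at ht
          exact ⟨lt_of_le_of_lt he.1 ht.1, ht.2.trans x.2.2⟩
        · rw [uIoc_of_ge hex] at ht
          exact ⟨lt_of_le_of_lt x.2.1 ht.1, ht.2.trans he.2⟩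
      · refine Eventually.of_forall fun t => ?_
        have := sub_nonneg.2 hαβ
        simp only [Pi.zero_apply]
        positivity
    refine h4.trans ?_
    rw [intervalIntegral.integral_mul_const, abs_of_nonneg]
    · have := mul_le_mul_of_nonneg_right hsmall (dist_nonneg (x := p) (y := r))
      push_cast
      linarith
    · have h5 : 0 ≤ ∫ x in α..β, ‖V x‖ :=
        intervalIntegral.integral_nonneg hαβ fun _ _ => norm_nonneg _
      have := sub_nonneg.2 hαβ
      positivity
  have : Nonempty C(Icc α β, ℂ) := ⟨0⟩
  set p := ContractingWith.fixedPoint T hT with hp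
  have hpT : T p = p := hT.fixedPoint_isFixedPt
  have hpe : ∀ x ∈ Icc α β, ext p x = c₁ + ∫ t in e..x, F p t := by
    intro x hx
    have h1 : ext p x = p ⟨x, hx⟩ := IccExtend_of_mem hαβ _ hx
    have h2 : p ⟨x, hx⟩ = T p ⟨x, hx⟩ := by rw [hpT]
    rw [h1, h2]
    rfl
  have hα : α ∈ Icc α β := left_mem_Icc.2 hαβ
  refine ⟨Y p, ext p, ⟨(hext p).intervalIntegrable _ _, fun x hx => ?_⟩, ⟨hF p, fun x hx => ?_⟩,
    by simp [Y], ?_⟩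
  · simp only [Y]
    rw [add_assoc, intervalIntegral.integral_add_adjacent_intervals
      ((hext p).intervalIntegrable _ _) ((hext p).intervalIntegrable _ _)]
  · rw [hpe x hx, hpe α hα, add_assoc, intervalIntegral.integral_add_adjacent_intervals
      ((hF p).mono_set (hsub e he α hα)) ((hF p).mono_set (hsub α hα x hx))]
  · rw [hpe e he]; simp

/-- The potential `l (l + 1) / x² + q`. -/
def pot (l : ℝ) (q : ℝ → ℝ) (x : ℝ) : ℂ := ((l * (l + 1) / x ^ 2 + q x : ℝ) : ℂ)

theorem conj_pot (l : ℝ) (q : ℝ → ℝ) (x : ℝ) : conj (pot l q x) = pot l q x := Complex.conj_ofReal _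

theorem intervalIntegrable_of_locallyIntegrableOn {q : ℝ → ℝ}
    (hq : LocallyIntegrableOn q (Ioi 0)) {a b : ℝ} (ha : 0 < a) (hab : a ≤ b) :
    IntervalIntegrable q volume a b := by
  rw [intervalIntegrable_iff_integrableOn_Icc_of_le hab]
  exact hq.integrableOn_compact_subset (fun x hx => ha.trans_le hx.1) isCompact_Icc

theorem intervalIntegrable_pot {l : ℝ} {q : ℝ → ℝ} (hq : LocallyIntegrableOn q (Ioi 0)) {a b : ℝ}
    (ha : 0 < a) (hab : a ≤ b) : IntervalIntegrable (pot l q) volume a b := by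
  refine intervalIntegrable_ofReal (IntervalIntegrable.add ?_
    (intervalIntegrable_of_locallyIntegrableOn hq ha hab))
  refine ContinuousOn.intervalIntegrable_of_Icc hab ?_
  refine continuousOn_const.div (by fun_prop) fun x hx => ?_
  have := ha.trans_le hx.1
  positivity

theorem exists_small_interval {l : ℝ} {q : ℝ → ℝ} (hq : LocallyIntegrableOn q (Ioi 0)) {x : ℝ}
    (hx : 0 < x) : ∃ α β : ℝ, 0 < α ∧ α < x ∧ x < β ∧
      (β - α) * ∫ t in α..β, ‖pot l q t‖ ≤ 1 / 2 := by
  set M := ∫ t in (x / 2)..(2 * x), ‖pot l q t‖ with hM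
  have hi : IntervalIntegrable (pot l q) volume (x / 2) (2 * x) :=
    intervalIntegrable_pot hq (by linarith) (by linarith)
  have hM0 : 0 ≤ M := intervalIntegral.integral_nonneg (by linarith) fun _ _ => norm_nonneg _
  -- The interval has length 2δ, and 2δM ≤ M / (2(M + 1)) ≤ 1/2; the bound x/2 keeps it inside [x/2,
  -- 2x].
  set δ := min (x / 2) (1 / (4 * (M + 1))) with hδ
  have hδ0 : 0 < δ := by positivity
  have hδx : δ ≤ x / 2 := min_le_left _ _
  have hδM : δ * (4 * (M + 1)) ≤ 1 := by
    rw [← le_div_iff₀ (by positivity)]; exact min_le_right _ _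
  refine ⟨x - δ, x + δ, by linarith, by linarith, by linarith, ?_⟩
  have h1 : ∫ t in (x - δ)..(x + δ), ‖pot l q t‖ ≤ M :=
    intervalIntegral.integral_mono_interval (by linarith) (by linarith) (by linarith)
      (Eventually.of_forall fun _ => norm_nonneg _) hi.norm
  have h2 := mul_le_mul_of_nonneg_left h1 (by linarith : 0 ≤ x + δ - (x - δ))
  nlinarith

/-- A solution of the inhomogeneous equation with vanishing boundary values on an interval,
extended by zero, gives an element of the graph of `H`. -/
theorem exists_mem_graphH {l : ℝ} {q : ℝ → ℝ} {φ φ' h : ℝ → ℂ} {α β : ℝ} (hα : 0 < α)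
    (hαβ : α ≤ β) (hφ : IsPrim φ φ' α β)
    (hφ' : IsPrim φ' (fun x => pot l q x * φ x - h x) α β)
    (hh : MemLp h 2 (volume.restrict (Ioc α β)))
    (h1 : φ α = 0) (h2 : φ' α = 0) (h3 : φ β = 0) (h4 : φ' β = 0) :
    ∃ p ∈ graphH l q, p.1 =ᵐ[volPos] (Ioc α β).indicator φ ∧
      p.2 =ᵐ[volPos] (Ioc α β).indicator h := by
  -- The second derivative is extended by zero and integrated twice from α. Both primitives vanish
  -- beyond β because φ and φ' vanish there, so no jump arises at the endpoints.
  set W : ℝ → ℂ := (Ioc α β).indicator (fun x => pot l q x * φ x - h x) with hW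
  have hWi : Integrable W := by
    rw [hW, integrable_indicator_iff measurableSet_Ioc]
    exact hφ'.1.1
  have hWii : ∀ a b, IntervalIntegrable W volume a b := fun a b => hWi.intervalIntegrable
  set D : ℝ → ℂ := fun x => ∫ t in α..x, W t with hD
  have hDc : Continuous D := intervalIntegral.continuous_primitive hWii α
  have hDle : ∀ x ≤ α, D x = 0 := by
    intro x hx
    refine (intervalIntegral.integral_congr_ae (g := fun _ => (0 : ℂ)) ?_).trans (by simp)
    refine Eventually.of_forall fun t ht => indicator_of_notMem (s := Ioc α β) (fun hm => ?_) _
    rw [uIoc_of_ge hx] at ht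
    exact absurd ht.2 (not_le.2 hm.1)
  have hDm : ∀ x ∈ Icc α β, D x = φ' x := by
    intro x hx
    rw [hφ'.2 x hx, h2, zero_add]
    refine intervalIntegral.integral_congr_ae (Eventually.of_forall fun t ht => ?_)
    rw [uIoc_of_le hx.1] at ht
    have hm : t ∈ Ioc α β := ⟨ht.1, ht.2.trans hx.2⟩
    exact indicator_of_mem hm _
  have hDge : ∀ x, β ≤ x → D x = 0 := by
    intro x hx
    have h5 : D x = D β + ∫ t in β..x, W t :=
      (intervalIntegral.integral_add_adjacent_intervals (hWii _ _) (hWii _ _)).symm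
    rw [h5, hDm β (right_mem_Icc.2 hαβ), h4, zero_add]
    refine (intervalIntegral.integral_congr_ae (g := fun _ => (0 : ℂ)) ?_).trans (by simp)
    refine Eventually.of_forall fun t ht => indicator_of_notMem (s := Ioc α β) (fun hm => ?_) _
    rw [uIoc_of_le hx] at ht
    exact absurd ht.1 (not_lt.2 hm.2)
  have hDi : ∀ a b, IntervalIntegrable D volume a b := fun a b => hDc.intervalIntegrable a b
  set Φ : ℝ → ℂ := fun x => ∫ t in α..x, D t with hΦ
  have hΦd : ∀ x, HasDerivAt Φ (D x) x := fun x =>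
    intervalIntegral.integral_hasDerivAt_right (hDi _ _)
      (hDc.stronglyMeasurableAtFilter _ _) hDc.continuousAt
  have hΦc : Continuous Φ := intervalIntegral.continuous_primitive hDi α
  have hΦle : ∀ x ≤ α, Φ x = 0 := by
    intro x hx
    refine (intervalIntegral.integral_congr (g := fun _ => (0 : ℂ)) fun t ht => ?_).trans (by simp)
    rw [uIcc_of_ge hx] at ht
    exact hDle t ht.2
  have hΦm : ∀ x ∈ Icc α β, Φ x = φ x := by
    intro x hx
    rw [hφ.2 x hx, h1, zero_add]
    refine intervalIntegral.integral_congr fun t ht => ?_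
    rw [uIcc_of_le hx.1] at ht
    exact hDm t ⟨ht.1, ht.2.trans hx.2⟩
  have hΦge : ∀ x, β ≤ x → Φ x = 0 := by
    intro x hx
    have h5 : Φ x = Φ β + ∫ t in β..x, D t :=
      (intervalIntegral.integral_add_adjacent_intervals (hDi _ _) (hDi _ _)).symm
    rw [h5, hΦm β (right_mem_Icc.2 hαβ), h3, zero_add]
    refine (intervalIntegral.integral_congr (g := fun _ => (0 : ℂ)) fun t ht => ?_).trans (by simp)
    rw [uIcc_of_le hx] at ht
    exact hDge t ht.1
  have hΦind : Φ = (Ioc α β).indicator φ := by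
    ext x
    by_cases hx : x ∈ Ioc α β
    · rw [indicator_of_mem hx, hΦm x (Ioc_subset_Icc_self hx)]
    · rw [indicator_of_notMem hx]
      rcases le_or_gt x α with h6 | h6
      · exact hΦle x h6
      · exact hΦge x (le_of_lt (not_le.1 fun h7 => hx ⟨h6, h7⟩))
  have hDprim : ∀ a b, 0 < a → a ≤ b → IsPrim D W a b := fun a b _ _ =>
    ⟨hWii a b, fun x _ =>
      (intervalIntegral.integral_add_adjacent_intervals (hWii _ _) (hWii _ _)).symm⟩
  have hreg : IsRegular Φ := IsRegular.of_isPrim (fun x _ => hΦd x) hDprim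
  have htau : tau l q Φ =ᵐ[volPos] (Ioc α β).indicator h := by
    filter_upwards [deriv_deriv_ae_eq (fun x _ => hΦd x) hDprim] with x hx
    rw [tau, hx, hW, hΦind]
    by_cases hx : x ∈ Ioc α β
    · simp only [indicator_of_mem hx, pot]; ring
    · simp only [indicator_of_notMem hx]; ring
  have hΦL : MemLp Φ 2 volPos := by
    rw [hΦind]
    refine MemLp.restrict _ ((memLp_indicator_iff_restrict measurableSet_Ioc).2 ?_)
    have h5 : ContinuousOn φ (Icc α β) := hφ.continuousOn hαβ
    obtain ⟨C, hC⟩ := isCompact_Icc.exists_bound_of_continuousOn h5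
    have : IsFiniteMeasure (volume.restrict (Ioc α β)) := ⟨by simp⟩
    refine MemLp.of_bound ((h5.mono Ioc_subset_Icc_self).aestronglyMeasurable measurableSet_Ioc)
      C ?_
    exact ae_restrict_of_forall_mem measurableSet_Ioc fun x hx => hC x (Ioc_subset_Icc_self hx)
  have hhL : MemLp ((Ioc α β).indicator h) 2 volPos :=
    MemLp.restrict _ ((memLp_indicator_iff_restrict measurableSet_Ioc).2 hh)
  refine ⟨(hΦL.toLp Φ, hhL.toLp _), ⟨Φ, hreg, fun _ => ?_, hΦL.coeFn_toLp.symm,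
    htau.trans hhL.coeFn_toLp.symm⟩, ?_, hhL.coeFn_toLp⟩
  -- The support starts at α > 0, so the boundary condition holds trivially.
  · refine tendsto_const_nhds.congr' ?_
    filter_upwards [nhdsWithin_le_nhds (Iio_mem_nhds hα)] with x hx
    rw [(hΦd x).deriv, hΦle x hx.le, hDle x hx.le]
    simp
  · rw [← hΦind]; exact hΦL.coeFn_toLp

end Existence

/-! ### Regularity of weak solutions. -/

section WeakSolutions

theorem integral_indicator_inner {u z : L2} {φ : ℝ → ℂ} {α β : ℝ} (hα : 0 < α)
    (hu : u =ᵐ[volPos] (Ioc α β).indicator φ) :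
    inner ℂ u z = ∫ x in Ioc α β, conj (φ x) * z x := by
  rw [MeasureTheory.L2.inner_def]
  have h1 : ∀ᵐ x ∂volPos, inner ℂ (u x) (z x)
      = (Ioc α β).indicator (fun x => conj (φ x) * z x) x := by
    filter_upwards [hu] with x hx
    rw [hx]
    by_cases hm : x ∈ Ioc α β
    · rw [indicator_of_mem hm, indicator_of_mem hm, RCLike.inner_apply, mul_comm]
    · rw [indicator_of_notMem hm, indicator_of_notMem hm, inner_zero_left]
  rw [integral_congr_ae h1, integral_indicator measurableSet_Ioc,
    Measure.restrict_restrict measurableSet_Ioc]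
  congr 2
  exact inter_eq_left.2 fun x hx => hα.trans hx.1

theorem memLp_restrict_Ioc (w : L2) {α β : ℝ} (hα : 0 < α) :
    MemLp w 2 (volume.restrict (Ioc α β)) := by
  have h1 := (Lp.memLp w).restrict (Ioc α β)
  have h2 : Ioc α β ∩ Ioi 0 = Ioc α β := inter_eq_left.2 fun x hx => hα.trans hx.1
  rwa [Measure.restrict_restrict measurableSet_Ioc, h2] at h1

theorem memLp_of_continuousOn_Icc {f : ℝ → ℂ} {α β : ℝ} (hf : ContinuousOn f (Icc α β)) :
    MemLp f 2 (volume.restrict (Ioc α β)) := by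
  obtain ⟨C, hC⟩ := isCompact_Icc.exists_bound_of_continuousOn hf
  exact MemLp.of_bound ((hf.mono Ioc_subset_Icc_self).aestronglyMeasurable measurableSet_Ioc) C
    (ae_restrict_of_forall_mem measurableSet_Ioc fun x hx => hC x (Ioc_subset_Icc_self hx))

theorem intervalIntegrable_of_memLp {f : ℝ → ℂ} {α β : ℝ} (hαβ : α ≤ β)
    (hf : MemLp f 2 (volume.restrict (Ioc α β))) : IntervalIntegrable f volume α β := by
  rw [intervalIntegrable_iff_integrableOn_Ioc_of_le hαβ]
  exact hf.integrable (by norm_num)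

variable {l : ℝ} {q : ℝ → ℝ}

/-- The difference between a weak solution and a particular solution on a short interval is a
solution of the homogeneous equation. -/
theorem exists_local_solution (hq : LocallyIntegrableOn q (Ioi 0)) {z w : L2}
    (h : ∀ p ∈ graphH l q, inner ℂ p.2 z = inner ℂ p.1 w) {x₀ : ℝ} (hx₀ : 0 < x₀) :
    ∃ α β : ℝ, ∃ y y' : ℝ → ℂ, 0 < α ∧ x₀ ∈ Ioo α β ∧ IsPrim y y' α β ∧
      IsPrim y' (fun x => pot l q x * y x - w x) α β ∧
      ∀ᵐ x ∂volume.restrict (Ioc α β), z x = y x := by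
  obtain ⟨α, β, hα, hαx, hxβ, hsmall⟩ := exists_small_interval (l := l) hq hx₀
  have hαβ : α ≤ β := (hαx.trans hxβ).le
  have hV : IntervalIntegrable (pot l q) volume α β := intervalIntegrable_pot hq hα hαβ
  have hwL := memLp_restrict_Ioc w (β := β) hα
  have hzL := memLp_restrict_Ioc z (β := β) hα
  have hw : IntervalIntegrable w volume α β := intervalIntegrable_of_memLp hαβ hwL
  have hαm : α ∈ Icc α β := left_mem_Icc.2 hαβ
  have hβm : β ∈ Icc α β := right_mem_Icc.2 hαβ
  have hz0 : IntervalIntegrable (fun _ => (0 : ℂ)) volume α β := intervalIntegrable_const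
  -- The function y is a particular solution with zero data at α; u and v form a fundamental system
  -- normalized at β.
  obtain ⟨y, y', hy, hy', hyα, hy'α⟩ := exists_isPrim_isPrim hαβ hV hw hsmall hαm 0 0
  obtain ⟨u, u', hu, hu', huβ, hu'β⟩ := exists_isPrim_isPrim hαβ hV hz0 hsmall hβm 0 1
  obtain ⟨v, v', hv, hv', hvβ, hv'β⟩ := exists_isPrim_isPrim hαβ hV hz0 hsmall hβm 1 0
  have hyL := memLp_of_continuousOn_Icc (hy.continuousOn hαβ)
  have huL := memLp_of_continuousOn_Icc (hu.continuousOn hαβ)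
  have hvL := memLp_of_continuousOn_Icc (hv.continuousOn hαβ)
  let S : Submodule ℂ (Lp ℂ 2 (volume.restrict (Ioc α β))) :=
    Submodule.span ℂ {huL.toLp u, hvL.toLp v}
  have hSfin : FiniteDimensional ℂ S := FiniteDimensional.span_of_finite ℂ (by simp)
  have inner_eq : ∀ {f g : ℝ → ℂ} {F G : Lp ℂ 2 (volume.restrict (Ioc α β))},
      F =ᵐ[volume.restrict (Ioc α β)] f → G =ᵐ[volume.restrict (Ioc α β)] g →
      inner ℂ F G = ∫ x in Ioc α β, conj (f x) * g x := by
    intro f g F G hF hG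
    rw [MeasureTheory.L2.inner_def]
    refine integral_congr_ae ?_
    filter_upwards [hF, hG] with x h1 h2
    rw [h1, h2, RCLike.inner_apply, mul_comm]
  -- The span S is finite-dimensional, hence equal to its double orthogonal complement, and it
  -- suffices to test against k orthogonal to u and v.
  have hmem : hzL.toLp z - hyL.toLp y ∈ S := by
    rw [← Submodule.orthogonal_orthogonal S, Submodule.mem_orthogonal]
    intro k hk
    have hkL := Lp.memLp k
    have hki : IntervalIntegrable k volume α β := intervalIntegrable_of_memLp hαβ hkL
    obtain ⟨φ, φ', hφ, hφ', hφα, hφ'α⟩ := exists_isPrim_isPrim hαβ hV hki hsmall hαm 0 0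
    -- By the Lagrange identity, orthogonality of k to a homogeneous solution s makes the Wronskian
    -- of φ and conj s vanish at β. For s = u and s = v this yields φ(β) = φ'(β) = 0, so φ extended
    -- by zero is an admissible test function.
    have hbd : ∀ {s s' : ℝ → ℂ}, IsPrim s s' α β →
        IsPrim s' (fun x => pot l q x * s x - (fun _ => 0) x) α β →
        (∫ x in Ioc α β, conj (s x) * k x) = 0 →
        φ' β * conj (s β) - φ β * conj (s' β) = 0 := by
      intro s s' hs hs' hint
      have h1 := (IsPrim.wronskian hαβ hφ hφ' (hs.conj hαβ) (hs'.conj hαβ)).sub_eq hαβ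
      simp only [hφα, hφ'α, zero_mul, sub_zero, map_mul, conj_pot] at h1
      rw [h1, intervalIntegral.integral_of_le hαβ, ← neg_eq_zero, ← integral_neg, ← hint]
      refine integral_congr_ae (Eventually.of_forall fun x => ?_)
      simp only
      ring
    have hku : (∫ x in Ioc α β, conj (u x) * k x) = 0 := by
      rw [← inner_eq huL.coeFn_toLp (EventuallyEq.refl _ k)]
      exact (Submodule.mem_orthogonal _ _).1 hk _ (Submodule.subset_span (by simp))
    have hkv : (∫ x in Ioc α β, conj (v x) * k x) = 0 := by
      rw [← inner_eq hvL.coeFn_toLp (EventuallyEq.refl _ k)]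
      exact (Submodule.mem_orthogonal _ _).1 hk _ (Submodule.subset_span (by simp))
    have hφβ : φ β = 0 := by
      have := hbd hu hu' hku
      simpa [huβ, hu'β] using this
    have hφ'β : φ' β = 0 := by
      have := hbd hv hv' hkv
      simpa [hvβ, hv'β] using this
    obtain ⟨p, hp, hp1, hp2⟩ := exists_mem_graphH hα hαβ hφ hφ' hkL hφα hφ'α hφβ hφ'β
    have h2 := h p hp
    rw [integral_indicator_inner hα hp1, integral_indicator_inner hα hp2] at h2
    rw [inner_sub_right, inner_eq (EventuallyEq.refl _ k) hzL.coeFn_toLp,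
      inner_eq (EventuallyEq.refl _ k) hyL.coeFn_toLp, h2, sub_eq_zero]
    -- Lagrange's identity for y and φ has no boundary terms: y vanishes to first order at α, φ at
    -- β. Hence y satisfies the same weak equation as z against φ.
    have h3 := (IsPrim.wronskian hαβ hy hy' (hφ.conj hαβ) (hφ'.conj hαβ))
    have h4 := h3.sub_eq hαβ
    simp only [hφβ, hφ'β, hyα, hy'α, map_zero, mul_zero, zero_mul, sub_zero, map_mul, map_sub,
      conj_pot] at h4
    rw [intervalIntegral.integral_of_le hαβ] at h4
    rw [← sub_eq_zero, ← integral_sub]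
    · rw [← neg_eq_zero, ← integral_neg, h4]
      refine integral_congr_ae (Eventually.of_forall fun x => ?_)
      simp only
      ring
    · have h5 : MemLp φ 2 (volume.restrict (Ioc α β)) :=
        memLp_of_continuousOn_Icc (hφ.continuousOn hαβ)
      exact h5.star.integrable_mul hwL
    · exact hkL.star.integrable_mul hyL
  obtain ⟨a, b, hab⟩ := Submodule.mem_span_pair.1 hmem
  refine ⟨α, β, fun x => y x + a * u x + b * v x, fun x => y' x + a * u' x + b * v' x, hα,
    ⟨hαx, hxβ⟩, (hy.add_const_mul hu a hαβ).add_const_mul hv b hαβ,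
    ((hy'.add_const_mul hu' a hαβ).add_const_mul hv' b hαβ).congr_right hαβ fun x _ => by ring, ?_⟩
  have h1 : a • huL.toLp u + b • hvL.toLp v + hyL.toLp y = hzL.toLp z := by
    rw [hab]; abel
  filter_upwards [hzL.coeFn_toLp, hyL.coeFn_toLp, huL.coeFn_toLp, hvL.coeFn_toLp,
    Lp.coeFn_add (a • huL.toLp u + b • hvL.toLp v) (hyL.toLp y),
    Lp.coeFn_add (a • huL.toLp u) (b • hvL.toLp v), Lp.coeFn_smul a (huL.toLp u),
    Lp.coeFn_smul b (hvL.toLp v)] with x e1 e2 e3 e4 e5 e6 e7 e8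
  rw [h1, e1, Pi.add_apply, e6, Pi.add_apply, e7, e8, Pi.smul_apply, Pi.smul_apply, e2, e3, e4]
    at e5
  rw [e5, smul_eq_mul, smul_eq_mul]
  ring

/-- Regularity of weak solutions: the adjoint of `H` acts as `τ`. -/
theorem exists_isRegular_of_inner_eq (hq : LocallyIntegrableOn q (Ioi 0)) {z w : L2}
    (h : ∀ p ∈ graphH l q, inner ℂ p.2 z = inner ℂ p.1 w) :
    ∃ f : ℝ → ℂ, IsRegular f ∧ f =ᵐ[volPos] z ∧ tau l q f =ᵐ[volPos] w := by
  have hloc : ∀ x₀ : ℝ, ∃ α β : ℝ, ∃ y y' : ℝ → ℂ, 0 < x₀ → (0 < α ∧ x₀ ∈ Ioo α β ∧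
      IsPrim y y' α β ∧ IsPrim y' (fun x => pot l q x * y x - w x) α β ∧
      ∀ᵐ x ∂volume.restrict (Ioc α β), z x = y x) := by
    intro x₀
    by_cases hx : 0 < x₀
    · obtain ⟨α, β, y, y', h1⟩ := exists_local_solution hq h hx
      exact ⟨α, β, y, y', fun _ => h1⟩
    · exact ⟨0, 0, 0, 0, fun h1 => absurd h1 hx⟩
  choose α β y y' hα hm hy hy' hz using hloc
  have hαβ : ∀ x, 0 < x → α x ≤ β x := fun x hx => ((hm x hx).1.trans (hm x hx).2).le
  have hder : ∀ x, 0 < x → ∀ t ∈ Ioo (α x) (β x), HasDerivAt (y x) (y' x t) t := fun x hx t ht =>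
    (hy x hx).hasDerivAt ht ((hy' x hx).continuousOn (hαβ x hx))
  -- Two local solutions agree almost everywhere with z on the overlap and are continuous, hence
  -- coincide there; the diagonal x ↦ y x x is therefore locally one of them.
  have hagree : ∀ x, 0 < x → ∀ t ∈ Ioo (α x) (β x), y t =ᶠ[𝓝 t] y x := by
    intro x hx t ht
    have ht0 : 0 < t := (hα x hx).trans ht.1
    set a := max (α x) (α t)
    set b := min (β x) (β t)
    have hta : t ∈ Ioo a b := ⟨max_lt ht.1 (hm t ht0).1, lt_min ht.2 (hm t ht0).2⟩
    have h1 : y t =ᵐ[volume.restrict (Ioo a b)] y x := by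
      have hs1 : Ioo a b ⊆ Ioc (α x) (β x) := fun s hs =>
        ⟨(le_max_left _ _).trans_lt hs.1, (hs.2.trans_le (min_le_left _ _)).le⟩
      have hs2 : Ioo a b ⊆ Ioc (α t) (β t) := fun s hs =>
        ⟨(le_max_right _ _).trans_lt hs.1, (hs.2.trans_le (min_le_right _ _)).le⟩
      filter_upwards [ae_restrict_of_ae_restrict_of_subset hs1 (hz x hx),
        ae_restrict_of_ae_restrict_of_subset hs2 (hz t ht0)] with s h2 h3
      rw [← h2, ← h3]
    have h2 : EqOn (y t) (y x) (Ioo a b) := by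
      refine MeasureTheory.Measure.eqOn_of_ae_eq h1 ?_ ?_ (by rw [interior_Ioo]; exact subset_closure)
      · intro s hs
        exact (hder t ht0 s ⟨(le_max_right _ _).trans_lt hs.1,
          hs.2.trans_le (min_le_right _ _)⟩).continuousAt.continuousWithinAt
      · intro s hs
        exact (hder x hx s ⟨(le_max_left _ _).trans_lt hs.1,
          hs.2.trans_le (min_le_left _ _)⟩).continuousAt.continuousWithinAt
    filter_upwards [Ioo_mem_nhds hta.1 hta.2] with s hs using h2 hs
  have hagree' : ∀ x, 0 < x → ∀ t ∈ Ioo (α x) (β x), y' t t = y' x t := by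
    intro x hx t ht
    have ht0 : 0 < t := (hα x hx).trans ht.1
    exact ((hder t ht0 t (hm t ht0)).congr_of_eventuallyEq (hagree x hx t ht).symm).unique
      (hder x hx t ht)
  set f : ℝ → ℂ := fun x => y x x with hf
  set f' : ℝ → ℂ := fun x => y' x x with hf'
  have hfy : ∀ x, 0 < x → ∀ t ∈ Ioo (α x) (β x), f t = y x t := fun x hx t ht =>
    (hagree x hx t ht).self_of_nhds
  have hfd : ∀ x, 0 < x → HasDerivAt f (f' x) x := by
    intro x hx
    refine (hder x hx x (hm x hx)).congr_of_eventuallyEq ?_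
    filter_upwards [Ioo_mem_nhds (hm x hx).1 (hm x hx).2] with t ht using hfy x hx t ht
  have hint : ∀ a b, 0 < a → a ≤ b → IntervalIntegrable (fun x => pot l q x * f x - w x)
      volume a b := by
    intro a b ha hab
    refine IntervalIntegrable.sub ((intervalIntegrable_pot hq ha hab).mul_continuousOn ?_)
      (intervalIntegrable_of_memLp hab (memLp_restrict_Ioc w ha))
    rw [uIcc_of_le hab]
    exact fun x hx => (hfd x (ha.trans_le hx.1)).continuousAt.continuousWithinAt
  have hint' : ∀ a b, 0 < a → 0 < b → IntervalIntegrable (fun x => pot l q x * f x - w x)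
      volume a b := by
    intro a b ha hb
    rcases le_total a b with hab | hab
    · exact hint a b ha hab
    · exact (hint b a hb hab).symm
  -- The local integral equations say that f' minus the global primitive is locally constant;
  -- connectedness of (0, ∞) makes it constant.
  have hE : ∀ x ∈ Ioi (0 : ℝ), HasDerivAt
      (fun t => f' t - ∫ s in (1 : ℝ)..t, (pot l q s * f s - w s)) 0 x := by
    intro x hx
    have hx : 0 < x := hx
    refine (hasDerivAt_const x (f' x - ∫ s in (1 : ℝ)..x, (pot l q s * f s - w s))).congr_of_eventuallyEq ?_
    filter_upwards [Ioo_mem_nhds (hm x hx).1 (hm x hx).2] with t ht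
    have ht0 : 0 < t := (hα x hx).trans ht.1
    have h1 : f' t = y' x t := hagree' x hx t ht
    have h2 := (hy' x hx).2 t (Ioo_subset_Icc_self ht)
    have h3 := (hy' x hx).2 x (Ioo_subset_Icc_self (hm x hx))
    have hi : ∀ s ∈ Ioo (α x) (β x), IntervalIntegrable (fun r => pot l q r * y x r - w r) volume
        (α x) s := fun s hs => (hy' x hx).1.mono_set (by
          rw [uIcc_of_le hs.1.le, uIcc_of_le (hαβ x hx)]; exact Icc_subset_Icc_right hs.2.le)
    have h4 : ∫ s in x..t, (pot l q s * y x s - w s) = y' x t - y' x x := by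
      rw [h2, h3, ← intervalIntegral.integral_interval_sub_left (hi t ht) (hi x (hm x hx))]
      ring
    have h5 : ∫ s in x..t, (pot l q s * f s - w s) = ∫ s in x..t, (pot l q s * y x s - w s) := by
      refine intervalIntegral.integral_congr fun s hs => ?_
      have hs' : s ∈ Ioo (α x) (β x) := by
        have hsub : uIcc x t ⊆ Ioo (α x) (β x) :=
          (ordConnected_Ioo.uIcc_subset (hm x hx) ht)
        exact hsub hs
      simp only [hfy x hx s hs']
    have h6 := intervalIntegral.integral_interval_sub_left (hint' 1 t one_pos ht0)
      (hint' 1 x one_pos hx)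
    rw [h5, h4] at h6
    have h7 : f' x = y' x x := rfl
    rw [h1, h7]
    linear_combination -h6
  have hconst : ∀ x ∈ Ioi (0 : ℝ), ∀ t ∈ Ioi (0 : ℝ),
      f' x - ∫ s in (1 : ℝ)..x, (pot l q s * f s - w s)
        = f' t - ∫ s in (1 : ℝ)..t, (pot l q s * f s - w s) := by
    intro x hx t ht
    refine isOpen_Ioi.is_const_of_deriv_eq_zero isPreconnected_Ioi
      (fun s hs => (hE s hs).differentiableAt.differentiableWithinAt)
      (fun s hs => (hE s hs).deriv) hx ht
  have hprim : ∀ a b, 0 < a → a ≤ b → IsPrim f' (fun x => pot l q x * f x - w x) a b := by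
    intro a b ha hab
    refine ⟨hint a b ha hab, fun x hx => ?_⟩
    have hx0 : 0 < x := ha.trans_le hx.1
    have h1 := hconst x hx0 a ha
    have h2 := intervalIntegral.integral_interval_sub_left (hint' 1 x one_pos hx0)
      (hint' 1 a one_pos ha)
    rw [← h2]
    linear_combination h1
  have hfz : f =ᵐ[volPos] z := by
    rw [EventuallyEq, ae_restrict_iff' measurableSet_Ioi]
    refine measure_null_of_locally_null _ fun x hx => ?_
    have hx : 0 < x := by
      by_contra h1
      exact hx fun h2 => absurd h2 h1
    refine ⟨_, inter_mem_nhdsWithin _ (Ioo_mem_nhds (hm x hx).1 (hm x hx).2), ?_⟩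
    have h1 := ae_restrict_of_ae_restrict_of_subset Ioo_subset_Ioc_self (hz x hx)
    rw [ae_restrict_iff' measurableSet_Ioo] at h1
    refine measure_mono_null (fun t ht => ?_) h1
    exact fun h2 => ht.1 fun _ => (hfy x hx t ht.2).trans (h2 ht.2).symm
  refine ⟨f, IsRegular.of_isPrim hfd hprim, hfz, ?_⟩
  filter_upwards [deriv_deriv_ae_eq hfd hprim] with x hx
  rw [tau, hx, pot]
  ring

end WeakSolutions

/-! ### The integral operator with kernel 1/max(x,s) on L²(0,1). -/

section HilbertKernel

/-- Splitting at s = x reduces the integral to two powers; δ < 1 gives convergence at 0, and γ + δ >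
1 at infinity. -/
theorem integral_max_rpow {x γ δ : ℝ} (hx : 0 < x) (hδ : δ < 1) (hγ : 1 < γ + δ) :
    IntegrableOn (fun s => (max x s) ^ (-γ) * s ^ (-δ)) (Ioi 0) ∧
      ∫ s in Ioi 0, (max x s) ^ (-γ) * s ^ (-δ)
        = x ^ (1 - γ - δ) * (1 / (1 - δ) + 1 / (γ + δ - 1)) := by
  have h1 : EqOn (fun s => (max x s) ^ (-γ) * s ^ (-δ)) (fun s => x ^ (-γ) * s ^ (-δ))
      (Ioc 0 x) := fun s hs => by simp only [max_eq_left hs.2]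
  have h2 : EqOn (fun s => (max x s) ^ (-γ) * s ^ (-δ)) (fun s => s ^ (-γ - δ)) (Ioi x) := by
    intro s hs
    have hs : x < s := hs
    simp only [max_eq_right hs.le]
    rw [← Real.rpow_add (hx.trans hs), sub_eq_add_neg]
  have hi1 : IntegrableOn (fun s => x ^ (-γ) * s ^ (-δ)) (Ioc 0 x) := by
    have := (intervalIntegral.intervalIntegrable_rpow' (a := 0) (b := x)
      (by linarith : -1 < -δ)).1
    exact this.const_mul _
  have hi2 : IntegrableOn (fun s : ℝ => s ^ (-γ - δ)) (Ioi x) :=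
    integrableOn_Ioi_rpow_of_lt (by linarith) hx
  have hi1' := hi1.congr_fun h1.symm measurableSet_Ioc
  have hi2' := hi2.congr_fun h2.symm measurableSet_Ioi
  rw [← Ioc_union_Ioi_eq_Ioi hx.le]
  refine ⟨hi1'.union hi2', ?_⟩
  rw [setIntegral_union (Ioc_disjoint_Ioi le_rfl) measurableSet_Ioi hi1' hi2',
    setIntegral_congr_fun measurableSet_Ioc h1, setIntegral_congr_fun measurableSet_Ioi h2,
    integral_Ioi_rpow_of_lt (by linarith) hx, integral_const_mul,
    ← intervalIntegral.integral_of_le hx.le, integral_rpow (Or.inl (by linarith)),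
    Real.zero_rpow (by linarith), sub_zero, mul_add, ← mul_div_assoc, ← Real.rpow_add hx]
  have e1 : -γ + (-δ + 1) = 1 - γ - δ := by ring
  have e2 : -γ - δ + 1 = 1 - γ - δ := by ring
  have e3 : -δ + 1 = 1 - δ := by ring
  rw [e1, e2, e3]
  have h3 : 1 - γ - δ ≠ 0 := by linarith
  have h4 : γ + δ - 1 ≠ 0 := by linarith
  have h5 : 1 - δ ≠ 0 := by linarith
  field_simp
  ring

/-- The integral operator on `(0, 1)` with kernel `1 / max x s`. -/
def maxKernelIntegral (p : ℝ → ℝ) (x : ℝ) : ℝ := ∫ s in Ioo (0 : ℝ) 1, (max x s)⁻¹ * p s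

theorem integrable_maxKernel {p : ℝ → ℝ} (hp : IntegrableOn p (Ioo 0 1)) {x : ℝ} (hx : 0 < x) :
    IntegrableOn (fun s => (max x s)⁻¹ * p s) (Ioo 0 1) := by
  refine hp.bdd_mul (c := x⁻¹) ?_ ?_
  · have : Measurable fun s : ℝ => (max x s)⁻¹ := by fun_prop
    exact this.aestronglyMeasurable
  · refine Eventually.of_forall fun s => ?_
    have h1 : x ≤ max x s := le_max_left _ _
    rw [Real.norm_of_nonneg (by positivity)]
    exact inv_anti₀ hx h1

theorem maxKernelIntegral_nonneg {p : ℝ → ℝ} (hp0 : ∀ s, 0 ≤ p s) {x : ℝ} (hx : 0 < x) :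
    0 ≤ maxKernelIntegral p x :=
  integral_nonneg fun s => by
    have h1 : 0 < max x s := hx.trans_le (le_max_left _ _)
    have := hp0 s
    simp only [Pi.zero_apply]
    positivity

/-- Pointwise bound for the kernel `1 / max x s` on `L²`. -/
theorem maxKernelIntegral_le {p : ℝ → ℝ} (hp : MemLp p 2 (volume.restrict (Ioo 0 1))) {x : ℝ}
    (hx : 0 < x) :
    maxKernelIntegral p x ≤ (1 + (∫ s in Ioo (0 : ℝ) 1, p s ^ 2) / 2) / √x := by
  have hsx : 0 < √x := Real.sqrt_pos.2 hx
  have hp2 : IntegrableOn (fun s => p s ^ 2) (Ioo 0 1) := hp.integrable_sq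
  obtain ⟨h1, h2⟩ := integral_max_rpow (γ := 2) (δ := 0) hx one_pos (by norm_num)
  have hsub : Ioo (0 : ℝ) 1 ⊆ Ioi 0 := fun s hs => hs.1
  have h3 : ∫ s in Ioo (0 : ℝ) 1, (max x s) ^ (-2 : ℝ) * s ^ (-0 : ℝ)
      ≤ x ^ (1 - 2 - 0 : ℝ) * (1 / (1 - 0) + 1 / (2 + 0 - 1)) := by
    rw [← h2]
    refine setIntegral_mono_set h1 (ae_restrict_of_forall_mem measurableSet_Ioi fun s hs => ?_)
      hsub.eventuallyLE
    have hs : (0 : ℝ) < s := hs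
    simp only [Pi.zero_apply]
    positivity
  -- Cauchy-Schwarz in the form of Young's inequality with weight √x, which balances ∫ max(x,s)⁻² ds
  -- ≤ 2/x against ∫ p².
  have h4 : maxKernelIntegral p x ≤ ∫ s in Ioo (0 : ℝ) 1,
      (√x / 2 * ((max x s) ^ (-2 : ℝ) * s ^ (-0 : ℝ)) + 1 / (2 * √x) * p s ^ 2) := by
    refine setIntegral_mono_on (integrable_maxKernel (hp.integrable (by norm_num)) hx)
      (((h1.mono_set hsub).const_mul _).add (hp2.const_mul _)) measurableSet_Ioo fun s hs => ?_
    have hm : 0 < max x s := hx.trans_le (le_max_left _ _)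
    rw [neg_zero, Real.rpow_zero, mul_one, Real.rpow_neg hm.le, Real.rpow_two]
    have h5 : 0 ≤ (√x * (max x s)⁻¹ - p s) ^ 2 / (2 * √x) := by positivity
    have h6 : (√x * (max x s)⁻¹ - p s) ^ 2 / (2 * √x)
        = √x / 2 * (max x s ^ 2)⁻¹ + 1 / (2 * √x) * p s ^ 2 - (max x s)⁻¹ * p s := by
      field_simp
      ring
    linarith
  rw [integral_add ((h1.mono_set hsub).const_mul _) (hp2.const_mul _), integral_const_mul,
    integral_const_mul] at h4
  have h7 : x ^ (1 - 2 - 0 : ℝ) = (√x * √x)⁻¹ := by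
    rw [Real.mul_self_sqrt hx.le, ← Real.rpow_neg_one]; norm_num
  rw [h7] at h3
  refine h4.trans ?_
  have h8 := mul_le_mul_of_nonneg_left h3 (by positivity : 0 ≤ √x / 2)
  have h9 : √x / 2 * ((√x * √x)⁻¹ * (1 / (1 - 0) + 1 / (2 + 0 - 1))) = 1 / √x := by
    field_simp
    norm_num
  rw [h9] at h8
  calc _ ≤ 1 / √x + 1 / (2 * √x) * ∫ s in Ioo (0 : ℝ) 1, p s ^ 2 := by linarith
    _ = _ := by field_simp

/-- The Schur test for the kernel `1 / max x s`. -/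
theorem memLp_maxKernelIntegral {p : ℝ → ℝ} (hp : MemLp p 2 (volume.restrict (Ioo 0 1)))
    (hp0 : ∀ s, 0 ≤ p s) :
    MemLp (maxKernelIntegral p) 2 (volume.restrict (Ioo 0 1)) := by
  have hpm := hp.aestronglyMeasurable
  have hmeas : AEStronglyMeasurable (maxKernelIntegral p) (volume.restrict (Ioo 0 1)) := by
    have h1 : AEStronglyMeasurable (fun z : ℝ × ℝ => (max z.1 z.2)⁻¹ * p z.2)
        ((volume.restrict (Ioo (0 : ℝ) 1)).prod (volume.restrict (Ioo (0 : ℝ) 1))) := by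
      refine AEStronglyMeasurable.mul ?_ hpm.comp_snd
      have : Measurable fun z : ℝ × ℝ => (max z.1 z.2)⁻¹ := by fun_prop
      exact this.aestronglyMeasurable
    exact h1.integral_prod_right'
  have hp2 : IntegrableOn (fun s => p s ^ 2) (Ioo 0 1) := hp.integrable_sq
  -- Schur's test with weight s^(-1/2), for which the constant is 1/(1 - 1/2) + 1/(1 + 1/2 - 1) = 4.
  have hA : ∀ x : ℝ, 0 < x → ∫⁻ s in Ioo (0 : ℝ) 1,
      ENNReal.ofReal ((max x s)⁻¹ * s ^ (-(1 / 2) : ℝ)) ≤ ENNReal.ofReal (4 * x ^ (-(1 / 2) : ℝ)) := by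
    intro x hx
    obtain ⟨h1, h2⟩ := integral_max_rpow (γ := 1) (δ := 1 / 2) hx (by norm_num) (by norm_num)
    have h3 : ∀ s ∈ Ioo (0 : ℝ) 1, ENNReal.ofReal ((max x s)⁻¹ * s ^ (-(1 / 2) : ℝ))
        = ENNReal.ofReal ((max x s) ^ (-1 : ℝ) * s ^ (-(1 / 2) : ℝ)) := fun s _ => by
      rw [Real.rpow_neg_one]
    rw [setLIntegral_congr_fun measurableSet_Ioo h3]
    have h4 : 4 * x ^ (-(1 / 2) : ℝ) = ∫ s in Ioi 0, (max x s) ^ (-1 : ℝ) * s ^ (-(1 / 2) : ℝ) := by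
      rw [h2]; norm_num; ring
    rw [h4, ofReal_integral_eq_lintegral_ofReal h1]
    · exact lintegral_mono_set fun s hs => hs.1
    · refine ae_restrict_of_forall_mem measurableSet_Ioi fun s hs => ?_
      have hs : (0 : ℝ) < s := hs
      simp only [Pi.zero_apply]
      positivity
  set B : ℝ → ℝ := fun x => ∫ s in Ioo (0 : ℝ) 1, (max x s)⁻¹ * (s ^ (1 / 2 : ℝ) * p s ^ 2) with hB
  have hqi : IntegrableOn (fun s => s ^ (1 / 2 : ℝ) * p s ^ 2) (Ioo 0 1) := by
    refine hp2.bdd_mul (c := 1) ?_ ?_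
    · exact (Real.continuous_rpow_const (by norm_num)).aestronglyMeasurable
    · refine ae_restrict_of_forall_mem measurableSet_Ioo fun s hs => ?_
      rw [Real.norm_of_nonneg (Real.rpow_nonneg hs.1.le _)]
      exact Real.rpow_le_one hs.1.le hs.2.le (by norm_num)
  have hBi : ∀ x : ℝ, 0 < x →
      IntegrableOn (fun s => (max x s)⁻¹ * (s ^ (1 / 2 : ℝ) * p s ^ 2)) (Ioo 0 1) :=
    fun x hx => integrable_maxKernel hqi hx
  have hAi : ∀ x : ℝ, 0 < x →
      IntegrableOn (fun s => (max x s)⁻¹ * s ^ (-(1 / 2) : ℝ)) (Ioo 0 1) := by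
    intro x hx
    refine integrable_maxKernel ?_ hx
    have := (intervalIntegral.intervalIntegrable_rpow' (a := 0) (b := 1)
      (by norm_num : -1 < (-(1 / 2) : ℝ))).1
    exact this.mono_set Ioo_subset_Ioc_self
  have hsq : ∀ x ∈ Ioo (0 : ℝ) 1, maxKernelIntegral p x ^ 2 ≤ 4 * x ^ (-(1 / 2) : ℝ) * B x := by
    intro x hx
    have hx0 : 0 < x := hx.1
    set a := ∫ s in Ioo (0 : ℝ) 1, (max x s)⁻¹ * s ^ (-(1 / 2) : ℝ) with ha
    have hB0 : 0 ≤ B x := setIntegral_nonneg measurableSet_Ioo fun s hs => by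
      have h1 : 0 < max x s := hx0.trans_le (le_max_left _ _)
      have h2 : 0 < s := hs.1
      positivity
    have ha4 : a ≤ 4 * x ^ (-(1 / 2) : ℝ) := by
      have h1 := hA x hx0
      rw [← ofReal_integral_eq_lintegral_ofReal (hAi x hx0)] at h1
      · exact (ENNReal.ofReal_le_ofReal_iff (by positivity)).1 h1
      · refine ae_restrict_of_forall_mem measurableSet_Ioo fun s hs => ?_
        have h1 : 0 < max x s := hx0.trans_le (le_max_left _ _)
        have h2 : 0 < s := hs.1
        simp only [Pi.zero_apply]
        positivity
    set b := 4 * x ^ (-(1 / 2) : ℝ) with hb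
    have hb0 : 0 < b := by positivity
    have hH0 : 0 ≤ maxKernelIntegral p x := maxKernelIntegral_nonneg hp0 hx0
    -- This quadratic inequality in t, taken at t = `maxKernelIntegral p x / b`, yields the weighted
    -- Cauchy-Schwarz inequality.
    have key : ∀ t : ℝ, 0 < t → 2 * t * maxKernelIntegral p x ≤ t ^ 2 * b + B x := by
      intro t ht
      have h1 : 2 * t * maxKernelIntegral p x ≤ t ^ 2 * a + B x := by
        rw [maxKernelIntegral, ha, hB, ← integral_const_mul, ← integral_const_mul,
          ← integral_add ((hAi x hx0).const_mul _) (hBi x hx0)]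
        refine setIntegral_mono_on ((integrable_maxKernel (hp.integrable (by norm_num)) hx0).const_mul _)
          (((hAi x hx0).const_mul _).add (hBi x hx0)) measurableSet_Ioo fun s hs => ?_
        have hm : 0 < max x s := hx0.trans_le (le_max_left _ _)
        have hs0 : 0 < s := hs.1
        have h3 : s ^ (-(1 / 2) : ℝ) = (√s)⁻¹ := by
          rw [Real.rpow_neg hs0.le, Real.sqrt_eq_rpow]
        have h4 : s ^ (1 / 2 : ℝ) = √s := (Real.sqrt_eq_rpow s).symm
        have hss : 0 < √s := Real.sqrt_pos.2 hs0
        rw [h3, h4]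
        have h5 : 0 ≤ (max x s)⁻¹ * ((t - √s * p s) ^ 2 / √s) := by positivity
        have h6 : (max x s)⁻¹ * ((t - √s * p s) ^ 2 / √s)
            = t ^ 2 * ((max x s)⁻¹ * (√s)⁻¹) + (max x s)⁻¹ * (√s * p s ^ 2)
              - 2 * t * ((max x s)⁻¹ * p s) := by
          field_simp
          ring
        linarith
      nlinarith [mul_le_mul_of_nonneg_left ha4 (sq_nonneg t)]
    rcases hH0.eq_or_lt with h1 | h1
    · rw [← h1]; nlinarith [mul_nonneg hb0.le hB0]
    · have h2 := key (maxKernelIntegral p x / b) (by positivity)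
      have h3 : 2 * (maxKernelIntegral p x / b) * maxKernelIntegral p x
          = 2 * (maxKernelIntegral p x ^ 2 / b) := by ring
      have h4 : (maxKernelIntegral p x / b) ^ 2 * b = maxKernelIntegral p x ^ 2 / b := by
        field_simp
      rw [h3, h4] at h2
      have h5 : maxKernelIntegral p x ^ 2 / b ≤ B x := by linarith
      rw [div_le_iff₀ hb0] at h5
      linarith
  rw [memLp_two_iff_integrable_sq hmeas]
  refine ⟨hmeas.pow 2, ?_⟩
  rw [hasFiniteIntegral_iff_ofReal (Eventually.of_forall fun x => sq_nonneg _)]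
  have h1 : ∫⁻ x in Ioo (0 : ℝ) 1, ENNReal.ofReal (maxKernelIntegral p x ^ 2)
      ≤ ∫⁻ x in Ioo (0 : ℝ) 1, ∫⁻ s in Ioo (0 : ℝ) 1,
        ENNReal.ofReal (4 * (s ^ (1 / 2 : ℝ) * p s ^ 2)) *
          ENNReal.ofReal ((max s x)⁻¹ * x ^ (-(1 / 2) : ℝ)) := by
    refine setLIntegral_mono' measurableSet_Ioo fun x hx => ?_
    have hx0 : 0 < x := hx.1
    refine (ENNReal.ofReal_le_ofReal (hsq x hx)).trans ?_
    rw [hB, ← integral_const_mul, ofReal_integral_eq_lintegral_ofReal ((hBi x hx0).const_mul _)]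
    · refine setLIntegral_mono' measurableSet_Ioo fun s hs => ?_
      have hs0 : 0 < s := hs.1
      rw [← ENNReal.ofReal_mul (by positivity), max_comm]
      exact le_of_eq (by ring_nf)
    · refine ae_restrict_of_forall_mem measurableSet_Ioo fun s hs => ?_
      have h1 : 0 < max x s := hx0.trans_le (le_max_left _ _)
      have h2 : 0 < s := hs.1
      simp only [Pi.zero_apply]
      positivity
  refine h1.trans_lt ?_
  -- After exchanging the integrals, the symmetry of the kernel allows the Schur bound once more;
  -- the total constant is 4 · 4 = 16.
  rw [lintegral_lintegral_swap]
  · have h2 : ∫⁻ s in Ioo (0 : ℝ) 1, ∫⁻ x in Ioo (0 : ℝ) 1,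
        ENNReal.ofReal (4 * (s ^ (1 / 2 : ℝ) * p s ^ 2)) *
          ENNReal.ofReal ((max s x)⁻¹ * x ^ (-(1 / 2) : ℝ))
        ≤ ∫⁻ s in Ioo (0 : ℝ) 1, ENNReal.ofReal (16 * p s ^ 2) := by
      refine setLIntegral_mono' measurableSet_Ioo fun s hs => ?_
      have hs0 : 0 < s := hs.1
      rw [lintegral_const_mul' _ _ ENNReal.ofReal_ne_top]
      refine (mul_le_mul_right (hA s hs0) _).trans ?_
      rw [← ENNReal.ofReal_mul (by positivity)]
      refine ENNReal.ofReal_le_ofReal (le_of_eq ?_)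
      have h3 : s ^ (1 / 2 : ℝ) * s ^ (-(1 / 2) : ℝ) = 1 := by
        rw [← Real.rpow_add hs0]; norm_num
      linear_combination 16 * p s ^ 2 * h3
    refine h2.trans_lt ?_
    have h3 := (hp2.const_mul 16).2
    rwa [hasFiniteIntegral_iff_ofReal (Eventually.of_forall fun x => by
      simp only [Pi.zero_apply]; positivity)] at h3
  · have h3 : AEMeasurable (fun s => ENNReal.ofReal (4 * (s ^ (1 / 2 : ℝ) * p s ^ 2)))
        (volume.restrict (Ioo 0 1)) := (hqi.aemeasurable.const_mul 4).ennreal_ofReal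
    have h4 : Measurable fun z : ℝ × ℝ =>
        ENNReal.ofReal ((max z.2 z.1)⁻¹ * z.1 ^ (-(1 / 2) : ℝ)) := by
      fun_prop
    exact h3.comp_snd.mul h4.aemeasurable

end HilbertKernel

/-! ### The Bessel kernel and an abstract fixed-point estimate. -/

section BesselKernel

/-- The kernel of the inverse of the unperturbed Bessel operator, up to the factor `2 l + 1`. -/
def besselKernel (l x s : ℝ) : ℝ := min (x ^ (-l) * s ^ (l + 1)) (x ^ (l + 1) * s ^ (-l))

variable {l x s t : ℝ}

theorem besselKernel_nonneg (hx : 0 < x) (hs : 0 < s) : 0 ≤ besselKernel l x s :=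
  le_min (by positivity) (by positivity)

theorem besselKernel_le_left : besselKernel l x s ≤ x ^ (-l) * s ^ (l + 1) := min_le_left _ _

theorem besselKernel_le_right : besselKernel l x s ≤ x ^ (l + 1) * s ^ (-l) := min_le_right _ _

theorem rpow_add_one_mul_rpow_neg (hs : 0 < s) : s ^ (l + 1) * s ^ (-l) = s := by
  rw [← Real.rpow_add hs]; simp

/-- This makes x ↦ k(x,t) a weight that the kernel reproduces up to the factor s. Each branch of the
minimum on the right is obtained from the same branch of both factors on the left, and s^(l+1)
s^(-l) = s. -/
theorem besselKernel_mul_le (hx : 0 < x) (hs : 0 < s) (ht : 0 < t) :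
    besselKernel l x s * besselKernel l s t ≤ s * besselKernel l x t := by
  have h1 := rpow_add_one_mul_rpow_neg (l := l) hs
  have h0 := besselKernel_nonneg (l := l) hs ht
  rw [besselKernel, besselKernel, besselKernel, mul_min_of_nonneg _ _ hs.le]
  refine le_min ?_ ?_
  · calc _ ≤ (x ^ (-l) * s ^ (l + 1)) * (s ^ (-l) * t ^ (l + 1)) :=
          mul_le_mul (min_le_left _ _) (min_le_left _ _) h0 (by positivity)
      _ = _ := by linear_combination x ^ (-l) * t ^ (l + 1) * h1
  · calc _ ≤ (x ^ (l + 1) * s ^ (-l)) * (s ^ (l + 1) * t ^ (-l)) :=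
          mul_le_mul (min_le_right _ _) (min_le_right _ _) h0 (by positivity)
      _ = _ := by linear_combination x ^ (l + 1) * t ^ (-l) * h1

theorem besselKernel_mul_rpow_add_one_le (hs : 0 < s) :
    besselKernel l x s * s ^ (l + 1) ≤ s * x ^ (l + 1) := by
  have h1 := rpow_add_one_mul_rpow_neg (l := l) hs
  calc _ ≤ (x ^ (l + 1) * s ^ (-l)) * s ^ (l + 1) :=
        mul_le_mul_of_nonneg_right besselKernel_le_right (by positivity)
    _ = _ := by linear_combination x ^ (l + 1) * h1

theorem besselKernel_mul_rpow_neg_le (hs : 0 < s) :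
    besselKernel l x s * s ^ (-l) ≤ s * x ^ (-l) := by
  have h1 := rpow_add_one_mul_rpow_neg (l := l) hs
  calc _ ≤ (x ^ (-l) * s ^ (l + 1)) * s ^ (-l) :=
        mul_le_mul_of_nonneg_right besselKernel_le_left (by positivity)
    _ = _ := by linear_combination x ^ (-l) * h1

theorem besselKernel_of_le (hl : 0 ≤ l) (hs : 0 < s) (h : s ≤ x) :
    besselKernel l x s = x ^ (-l) * s ^ (l + 1) := by
  have hx := hs.trans_le h
  refine min_eq_left ?_
  rw [mul_comm (x ^ (l + 1))]
  exact mul_le_mul (Real.rpow_le_rpow_of_nonpos hs h (by linarith))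
    (Real.rpow_le_rpow hs.le h (by linarith)) (by positivity) (by positivity)

theorem besselKernel_of_ge (hl : 0 ≤ l) (hx : 0 < x) (h : x ≤ s) :
    besselKernel l x s = x ^ (l + 1) * s ^ (-l) := by
  have hs := hx.trans_le h
  refine min_eq_right ?_
  rw [mul_comm (x ^ (-l))]
  exact mul_le_mul (Real.rpow_le_rpow hx.le h (by linarith))
    (Real.rpow_le_rpow_of_nonpos hx h (by linarith)) (by positivity) (by positivity)

theorem measurable_besselKernel (l x : ℝ) : Measurable (besselKernel l x) := by
  unfold besselKernel; fun_prop

/-- A fixed-point estimate: a function bounded by a multiple of the weight `w` and satisfying an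
integral inequality with small kernel is bounded by `2 w`. -/
theorem le_two_mul_of_integral_le {k : ℝ → ℝ → ℝ} {θ P w : ℝ → ℝ} {S : Set ℝ}
    (hS : MeasurableSet S)
    (hk : ∀ x ∈ S, ∀ s ∈ S, 0 ≤ k x s) (hθ0 : ∀ s, 0 ≤ θ s) (hP0 : ∀ s, 0 ≤ P s)
    (hw0 : ∀ s ∈ S, 0 ≤ w s) (hθ : IntegrableOn (fun s => s * θ s) S)
    (hsmall : ∫ s in S, s * θ s ≤ 1 / 4) (hkw : ∀ x ∈ S, ∀ s ∈ S, k x s * w s ≤ s * w x)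
    (hP : ∀ x ∈ S, P x ≤ w x + ∫ s in S, k x s * (θ s * P s))
    {B : ℝ} (hB0 : 0 ≤ B) (hB : ∀ x ∈ S, P x ≤ B * w x) : ∀ x ∈ S, P x ≤ 2 * w x := by
  have step : ∀ B : ℝ, 0 ≤ B → (∀ x ∈ S, P x ≤ B * w x) →
      ∀ x ∈ S, ∫ s in S, k x s * (θ s * P s) ≤ B / 4 * w x := by
    intro B hB0 hB x hx
    have h1 : ∫ s in S, k x s * (θ s * P s) ≤ ∫ s in S, B * w x * (s * θ s) := by
      refine integral_mono_of_nonneg (ae_restrict_of_forall_mem hS fun s hs => ?_)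
        (hθ.const_mul _) (ae_restrict_of_forall_mem hS fun s hs => ?_)
      · exact mul_nonneg (hk x hx s hs) (mul_nonneg (hθ0 s) (hP0 s))
      · have h2 := mul_le_mul_of_nonneg_left (hB s hs) (mul_nonneg (hk x hx s hs) (hθ0 s))
        have h3 := mul_le_mul_of_nonneg_left (hkw x hx s hs) (mul_nonneg hB0 (hθ0 s))
        simp only
        nlinarith
    rw [integral_const_mul] at h1
    have h2 := mul_le_mul_of_nonneg_left hsmall (mul_nonneg hB0 (hw0 x hx))
    linarith
  -- One application of the integral inequality replaces the constant B by 1 + B/4, whose iterates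
  -- stay below 2 + B/4ⁿ.
  have iter : ∀ n : ℕ, ∀ x ∈ S, P x ≤ (2 + B * (1 / 4) ^ n) * w x := by
    intro n
    induction n with
    | zero =>
      intro x hx
      have := hB x hx
      have := hw0 x hx
      rw [pow_zero, mul_one]
      nlinarith
    | succ n ih =>
      intro x hx
      have h1 := step _ (by positivity) ih x hx
      have h2 := hP x hx
      have := hw0 x hx
      rw [pow_succ]
      nlinarith
  intro x hx
  have h1 : Tendsto (fun n : ℕ => (2 + B * (1 / 4) ^ n) * w x) atTop (𝓝 ((2 + B * 0) * w x)) :=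
    ((tendsto_pow_atTop_nhds_zero_of_lt_one (by norm_num) (by norm_num)).const_mul B
      |>.const_add 2).mul_const _
  rw [mul_zero, add_zero] at h1
  exact ge_of_tendsto' h1 fun n => iter n x hx

end BesselKernel

/-! ### Wronskians with the unperturbed solutions. -/

section NearZero

/-- The power `x ^ s` as a complex-valued function. -/
def cpowR (s : ℝ) (x : ℝ) : ℂ := ((x ^ s : ℝ) : ℂ)

theorem norm_cpowR {s x : ℝ} (hx : 0 < x) : ‖cpowR s x‖ = x ^ s := by
  rw [cpowR, Complex.norm_real, Real.norm_of_nonneg (by positivity)]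

theorem hasDerivAt_cpowR (s : ℝ) {x : ℝ} (hx : 0 < x) :
    HasDerivAt (cpowR s) (s * cpowR (s - 1) x) x := by
  have h1 := (Real.hasDerivAt_rpow_const (p := s) (Or.inl hx.ne')).ofReal_comp
  exact HasDerivAt.congr_deriv (f := cpowR s) h1 (by simp [cpowR])

theorem continuousOn_cpowR (s : ℝ) : ContinuousOn (cpowR s) (Ioi 0) := fun _ hx =>
  (hasDerivAt_cpowR s hx).continuousAt.continuousWithinAt

theorem isPrim_cpowR (s : ℝ) {a b : ℝ} (ha : 0 < a) (hab : a ≤ b) :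
    IsPrim (cpowR s) (fun x => s * cpowR (s - 1) x) a b :=
  isPrim_of_hasDerivAt (fun _ hx => hasDerivAt_cpowR s (ha.trans_le hx.1))
    (continuousOn_const.mul ((continuousOn_cpowR _).mono fun _ hx => ha.trans_le hx.1)) hab

theorem cpowR_sub_two (s : ℝ) {x : ℝ} (hx : 0 < x) : cpowR (s - 2) x = cpowR s x / (x : ℂ) ^ 2 := by
  rw [cpowR, cpowR, Real.rpow_sub hx, Real.rpow_two]; push_cast; rfl

/-- The Wronskian of `f` and `x ^ s`. -/
def wronskPow (s : ℝ) (f : ℝ → ℂ) (x : ℝ) : ℂ :=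
  deriv f x * cpowR s x - f x * (s * cpowR (s - 1) x)

/-- The condition on s says that x^s solves the unperturbed equation, so the centrifugal term
cancels in the Lagrange identity. -/
theorem isPrim_wronskPow {l s : ℝ} {q : ℝ → ℝ} {f : ℝ → ℂ} (hs : s * (s - 1) = l * (l + 1))
    (hf : IsRegular f) {a b : ℝ} (ha : 0 < a) (hab : a ≤ b) :
    IsPrim (wronskPow s f) (fun x => (q x * f x - tau l q f x) * cpowR s x) a b := by
  have h1 : IsPrim (fun x => s * cpowR (s - 1) x) (fun x => s * ((s - 1) * cpowR (s - 2) x)) a b := by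
    refine isPrim_of_hasDerivAt (fun x hx => ?_) ?_ hab
    · have := (hasDerivAt_cpowR (s - 1) (ha.trans_le hx.1)).const_mul (s : ℂ)
      rw [show s - 1 - 1 = s - 2 by ring] at this
      simpa using this
    · exact continuousOn_const.mul (continuousOn_const.mul
        ((continuousOn_cpowR _).mono fun _ hx => ha.trans_le hx.1))
  refine (IsPrim.wronskian hab (hf.isPrim ha hab) (hf.isPrim_deriv ha hab) (isPrim_cpowR s ha hab)
    h1).congr_right hab fun x hx => ?_
  have hx0 := ha.trans_le hx.1
  have hs' : (s : ℂ) * (s - 1) = l * (l + 1) := by exact_mod_cast hs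
  rw [deriv_deriv_eq l q, cpowR_sub_two s hx0]
  push_cast
  linear_combination (-(f x) * cpowR s x / (x : ℂ) ^ 2) * hs'

/-- The setting for the estimates near `0`. -/
structure NearZero (l : ℝ) (q : ℝ → ℝ) (f : ℝ → ℂ) (a : ℝ) : Prop where
  hl : 0 ≤ l
  ha : 0 < a
  ha1 : a < 1
  hf : IsRegular f
  hqi : IntegrableOn (fun s => s * |q s|) (Ioo 0 1)
  hqm : AEStronglyMeasurable q (volume.restrict (Ioo 0 1))
  hsmall : ∫ s in Ioc 0 a, s * |q s| ≤ 1 / 4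
  hgm : AEStronglyMeasurable (tau l q f) (volume.restrict (Ioo 0 1))
  hgi : IntegrableOn (fun s => s ^ (l + 1) * ‖tau l q f s‖) (Ioo 0 1)

variable {l : ℝ} {q : ℝ → ℝ} {f : ℝ → ℂ} {a : ℝ}

theorem cpowR_add {s t x : ℝ} (hx : 0 < x) : cpowR s x * cpowR t x = cpowR (s + t) x := by
  rw [cpowR, cpowR, cpowR, Real.rpow_add hx]; push_cast; rfl

theorem cpowR_zero {x : ℝ} : cpowR 0 x = 1 := by simp [cpowR]

theorem cpowR_one {x : ℝ} : cpowR 1 x = x := by simp [cpowR]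

/-- The Wronskian of x^(-l) and x^(l+1) is the constant 2l + 1, so f is recovered from its two
Wronskians by variation of parameters. -/
theorem wronskPow_combination {x : ℝ} (hx : 0 < x) :
    (2 * l + 1 : ℂ) * f x
      = cpowR (l + 1) x * wronskPow (-l) f x - cpowR (-l) x * wronskPow (l + 1) f x := by
  have h1 : cpowR (l + 1) x * cpowR (-l - 1) x = 1 := by
    rw [cpowR_add hx, show l + 1 + (-l - 1) = 0 by ring, cpowR_zero]
  have h2 : cpowR (-l) x * cpowR (l + 1 - 1) x = 1 := by
    rw [cpowR_add hx, show -l + (l + 1 - 1) = 0 by ring, cpowR_zero]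
  simp only [wronskPow]
  push_cast
  linear_combination (-l * f x) * h1 - (l + 1) * f x * h2

theorem mul_deriv_eq_wronskPow {x : ℝ} (hx : 0 < x) :
    (x : ℂ) * deriv f x = (l + 1 : ℂ) * f x + cpowR (-l) x * wronskPow (l + 1) f x := by
  have h1 : cpowR (-l) x * cpowR (l + 1) x = x := by
    rw [cpowR_add hx, show -l + (l + 1) = 1 by ring, cpowR_one]
  have h2 : cpowR (-l) x * cpowR (l + 1 - 1) x = 1 := by
    rw [cpowR_add hx, show -l + (l + 1 - 1) = 0 by ring, cpowR_zero]
  simp only [wronskPow]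
  push_cast
  linear_combination (-deriv f x) * h1 + (l + 1) * f x * h2

theorem norm_le_wronskPow (hl : 0 ≤ l) {x : ℝ} (hx : 0 < x) :
    ‖f x‖ ≤ x ^ (l + 1) * ‖wronskPow (-l) f x‖ + x ^ (-l) * ‖wronskPow (l + 1) f x‖ := by
  have h1 := congrArg norm (wronskPow_combination (l := l) (f := f) hx)
  have h2 := norm_sub_le (cpowR (l + 1) x * wronskPow (-l) f x)
    (cpowR (-l) x * wronskPow (l + 1) f x)
  rw [norm_mul, norm_mul, norm_cpowR hx, norm_cpowR hx] at h2
  rw [norm_mul] at h1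
  have h3 : ‖(2 * l + 1 : ℂ)‖ = 2 * l + 1 := by
    have : (2 * l + 1 : ℂ) = ((2 * l + 1 : ℝ) : ℂ) := by push_cast; rfl
    rw [this, Complex.norm_real, Real.norm_of_nonneg (by positivity)]
  rw [h3] at h1
  nlinarith [norm_nonneg (f x), mul_nonneg hl (norm_nonneg (f x))]

theorem norm_wronskPow_sub_le {s : ℝ} (hs : s * (s - 1) = l * (l + 1)) (hf : IsRegular f)
    {x y : ℝ} (hx : 0 < x) (hxy : x ≤ y) :
    ‖wronskPow s f y - wronskPow s f x‖
      ≤ ∫ t in Ioc x y, t ^ s * ‖(q t : ℂ) * f t - tau l q f t‖ := by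
  have h1 := (isPrim_wronskPow (q := q) hs hf hx hxy).sub_eq hxy
  have h2 := intervalIntegral.norm_integral_le_integral_norm (f := fun x =>
    (q x * f x - tau l q f x) * cpowR s x) (μ := volume) hxy
  rw [← h1, intervalIntegral.integral_of_le hxy] at h2
  have h3 : ∫ t in Ioc x y, ‖(q t * f t - tau l q f t) * cpowR s t‖
      = ∫ t in Ioc x y, t ^ s * ‖(q t : ℂ) * f t - tau l q f t‖ := by
    refine setIntegral_congr_fun measurableSet_Ioc fun t ht => ?_
    rw [norm_mul, norm_cpowR (hx.trans ht.1), mul_comm]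
  rwa [h3] at h2

theorem integrableOn_rpow_mul_norm {s : ℝ} (hs : s * (s - 1) = l * (l + 1)) (hf : IsRegular f)
    {x y : ℝ} (hx : 0 < x) (hxy : x ≤ y) :
    IntegrableOn (fun t => t ^ s * ‖(q t : ℂ) * f t - tau l q f t‖) (Ioc x y) := by
  have h1 := (isPrim_wronskPow (q := q) hs hf hx hxy).1.1.norm
  refine IntegrableOn.congr_fun h1 (fun t ht => ?_) measurableSet_Ioc
  rw [norm_mul, norm_cpowR (hx.trans ht.1), mul_comm]

theorem mul_sub_one_neg : -l * (-l - 1) = l * (l + 1) := by ring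

theorem mul_sub_one_add : (l + 1) * (l + 1 - 1) = l * (l + 1) := by ring

end NearZero

/-! ### The integral inequality near 0 and its solution. -/

section NearZero

variable {l : ℝ} {q : ℝ → ℝ} {f : ℝ → ℂ} {a : ℝ}

/-- The source term `q f - τ f` of the unperturbed equation. -/
def resid (l : ℝ) (q : ℝ → ℝ) (f : ℝ → ℂ) (t : ℝ) : ℝ := ‖(q t : ℂ) * f t - tau l q f t‖

theorem resid_nonneg (t : ℝ) : 0 ≤ resid l q f t := norm_nonneg _

theorem resid_le (t : ℝ) : resid l q f t ≤ |q t| * ‖f t‖ + ‖tau l q f t‖ := by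
  refine (norm_sub_le _ _).trans ?_
  rw [norm_mul, Complex.norm_real, Real.norm_eq_abs]

/-- The integral of the Bessel kernel against `‖g‖`. -/
def besselIntegral (l : ℝ) (g : ℝ → ℂ) (x : ℝ) : ℝ :=
  ∫ t in Ioo (0 : ℝ) 1, besselKernel l x t * ‖g t‖

theorem besselIntegral_nonneg {g : ℝ → ℂ} {x : ℝ} (hx : 0 < x) : 0 ≤ besselIntegral l g x :=
  setIntegral_nonneg measurableSet_Ioo fun _ ht =>
    mul_nonneg (besselKernel_nonneg hx ht.1) (norm_nonneg _)

theorem integrableOn_besselKernel_mul {p : ℝ → ℝ} {S : Set ℝ} (hS : MeasurableSet S)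
    (hS0 : S ⊆ Ioi 0) (hp0 : ∀ t, 0 ≤ p t)
    (hpm : AEStronglyMeasurable p (volume.restrict S))
    (hp : IntegrableOn (fun t => t ^ (l + 1) * p t) S) {x : ℝ} (hx : 0 < x) :
    IntegrableOn (fun t => besselKernel l x t * p t) S := by
  refine Integrable.mono' (hp.const_mul (x ^ (-l)))
    ((measurable_besselKernel l x).aestronglyMeasurable.mul hpm)
    (ae_restrict_of_forall_mem hS fun t ht => ?_)
  have ht0 : 0 < t := hS0 ht
  rw [Real.norm_of_nonneg (mul_nonneg (besselKernel_nonneg hx ht0) (hp0 t)), ← mul_assoc]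
  exact mul_le_mul_of_nonneg_right besselKernel_le_left (hp0 t)

namespace NearZero

variable (h : NearZero l q f a)

include h

theorem Ioc_subset : Ioc 0 a ⊆ Ioo (0 : ℝ) 1 := fun _ hx => ⟨hx.1, hx.2.trans_lt h.ha1⟩

/-- An a priori bound without any boundary condition. At a maximum point z of t^l |f| on [x, a],
both Wronskians are estimated by their values at a and the source term, of which the q-part is at
most a quarter of the maximum m. It enters twice, giving m ≤ m/2 + const, uniformly in x. -/
theorem exists_bound : ∃ M, 0 ≤ M ∧ ∀ x ∈ Ioc 0 a, x ^ l * ‖f x‖ ≤ M := by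
  set G1 := ∫ t in Ioo (0 : ℝ) 1, t ^ (l + 1) * ‖tau l q f t‖ with hG1
  have hG0 : 0 ≤ G1 := setIntegral_nonneg measurableSet_Ioo fun t ht =>
    mul_nonneg (Real.rpow_nonneg ht.1.le _) (norm_nonneg _)
  refine ⟨2 * (‖wronskPow (-l) f a‖ + ‖wronskPow (l + 1) f a‖ + 2 * G1), by positivity,
    fun x hx => ?_⟩
  have hc : ContinuousOn (fun t => t ^ l * ‖f t‖) (Icc x a) := by
    refine ContinuousOn.mul ?_ ?_
    · exact (Real.continuous_rpow_const h.hl).continuousOn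
    · exact (h.hf.1.continuousOn.mono fun t ht => hx.1.trans_le ht.1).norm
  obtain ⟨z, hz, hmax⟩ := isCompact_Icc.exists_isMaxOn (nonempty_Icc.2 hx.2) hc
  have hz0 : 0 < z := hx.1.trans_le hz.1
  have hza : z ≤ a := hz.2
  have hz1 : z ≤ 1 := hza.trans h.ha1.le
  refine (hmax (left_mem_Icc.2 hx.2)).trans ?_
  simp only
  set m := z ^ l * ‖f z‖ with hm
  have hIl := integrableOn_rpow_mul_norm (q := q) (l := l) mul_sub_one_add h.hf hz0 hza
  have hIr := integrableOn_rpow_mul_norm (q := q) (l := l) mul_sub_one_neg h.hf hz0 hza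
  set I := ∫ t in Ioc z a, t ^ (l + 1) * resid l q f t with hI
  have hU : ‖wronskPow (l + 1) f z‖ ≤ ‖wronskPow (l + 1) f a‖ + I := by
    have h1 := norm_wronskPow_sub_le (q := q) (l := l) mul_sub_one_add h.hf hz0 hza
    have h2 := norm_sub_norm_le (wronskPow (l + 1) f z) (wronskPow (l + 1) f a)
    rw [norm_sub_rev] at h2
    exact (sub_le_iff_le_add'.1 (h2.trans h1))
  have hV : z ^ l * z ^ (l + 1) * ‖wronskPow (-l) f z‖ ≤ ‖wronskPow (-l) f a‖ + I := by
    have h1 := norm_wronskPow_sub_le (q := q) (l := l) mul_sub_one_neg h.hf hz0 hza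
    have h2 := norm_sub_norm_le (wronskPow (-l) f z) (wronskPow (-l) f a)
    rw [norm_sub_rev] at h2
    have h3 := sub_le_iff_le_add'.1 (h2.trans h1)
    have h4 : z ^ l * z ^ (l + 1) * ∫ t in Ioc z a, t ^ (-l) * resid l q f t ≤ I := by
      rw [← integral_const_mul]
      refine setIntegral_mono_on (hIr.const_mul _) hIl measurableSet_Ioc fun t ht => ?_
      have ht0 : 0 < t := hz0.trans ht.1
      rw [← mul_assoc]
      refine mul_le_mul_of_nonneg_right ?_ (resid_nonneg t)
      have h5 : z ^ l ≤ t ^ l := Real.rpow_le_rpow hz0.le ht.1.le h.hl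
      have h6 : z ^ (l + 1) ≤ t ^ (l + 1) := Real.rpow_le_rpow hz0.le ht.1.le (by linarith [h.hl])
      calc z ^ l * z ^ (l + 1) * t ^ (-l) ≤ t ^ l * t ^ (l + 1) * t ^ (-l) := by gcongr
        _ = t ^ (l + 1) := by
          rw [mul_comm (t ^ l), mul_assoc, ← Real.rpow_add ht0 l]; simp
    have h5 : z ^ l * z ^ (l + 1) ≤ 1 :=
      mul_le_one₀ (Real.rpow_le_one hz0.le hz1 h.hl) (by positivity)
        (Real.rpow_le_one hz0.le hz1 (by linarith [h.hl]))
    have h6 : 0 ≤ z ^ l * z ^ (l + 1) := by positivity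
    calc _ ≤ z ^ l * z ^ (l + 1) * (‖wronskPow (-l) f a‖
          + ∫ t in Ioc z a, t ^ (-l) * resid l q f t) := mul_le_mul_of_nonneg_left h3 h6
      _ ≤ _ := by nlinarith [norm_nonneg (wronskPow (-l) f a)]
  have h1 : m ≤ z ^ l * z ^ (l + 1) * ‖wronskPow (-l) f z‖ + ‖wronskPow (l + 1) f z‖ := by
    have h2 := mul_le_mul_of_nonneg_left (norm_le_wronskPow h.hl hz0)
      (by positivity : 0 ≤ z ^ l) (b := ‖f z‖)
    have h3 : z ^ l * z ^ (-l) = 1 := by rw [← Real.rpow_add hz0]; simp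
    calc m ≤ _ := h2
      _ = z ^ l * z ^ (l + 1) * ‖wronskPow (-l) f z‖
          + (z ^ l * z ^ (-l)) * ‖wronskPow (l + 1) f z‖ := by ring
      _ = _ := by rw [h3, one_mul]
  have hsub : Ioc z a ⊆ Ioc 0 a := Ioc_subset_Ioc_left hz0.le
  have hqi := h.hqi.mono_set (hsub.trans h.Ioc_subset)
  have hgi := h.hgi.mono_set (hsub.trans h.Ioc_subset)
  have hm0 : 0 ≤ m := by positivity
  have h2 : I ≤ ∫ t in Ioc z a, (m * (t * |q t|) + t ^ (l + 1) * ‖tau l q f t‖) := by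
    refine setIntegral_mono_on hIl ((hqi.const_mul _).add hgi) measurableSet_Ioc fun t ht => ?_
    have ht0 : 0 < t := hz0.trans ht.1
    have h3 : t ^ l * ‖f t‖ ≤ m := hmax ⟨hz.1.trans ht.1.le, ht.2⟩
    have h4 : t ^ (l + 1) = t * t ^ l := by rw [Real.rpow_add ht0, Real.rpow_one, mul_comm]
    have h5 := mul_le_mul_of_nonneg_left (resid_le (l := l) (q := q) (f := f) t)
      (by positivity : 0 ≤ t ^ (l + 1))
    have h6 := mul_le_mul_of_nonneg_right h3 (by positivity : 0 ≤ t * |q t|)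
    refine h5.trans ?_
    rw [mul_add]
    refine add_le_add_left ?_ _
    rw [h4]
    calc _ = t ^ l * ‖f t‖ * (t * |q t|) := by ring
      _ ≤ _ := h6
  rw [integral_add (hqi.const_mul _) hgi, integral_const_mul] at h2
  have h3 : ∫ t in Ioc z a, t * |q t| ≤ 1 / 4 := by
    refine (setIntegral_mono_set (h.hqi.mono_set h.Ioc_subset) ?_ hsub.eventuallyLE).trans h.hsmall
    exact ae_restrict_of_forall_mem measurableSet_Ioc fun t ht =>
      mul_nonneg ht.1.le (abs_nonneg _)
  have h4 : ∫ t in Ioc z a, t ^ (l + 1) * ‖tau l q f t‖ ≤ G1 := by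
    refine setIntegral_mono_set h.hgi ?_ (hsub.trans h.Ioc_subset).eventuallyLE
    exact ae_restrict_of_forall_mem measurableSet_Ioo fun t ht =>
      mul_nonneg (Real.rpow_nonneg ht.1.le _) (norm_nonneg _)
  nlinarith

theorem aestronglyMeasurable_resid :
    AEStronglyMeasurable (resid l q f) (volume.restrict (Ioc 0 a)) := by
  have hq := h.hqm.mono_measure (Measure.restrict_mono h.Ioc_subset le_rfl)
  have hg := h.hgm.mono_measure (Measure.restrict_mono h.Ioc_subset le_rfl)
  have hf : AEStronglyMeasurable f (volume.restrict (Ioc 0 a)) :=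
    (h.hf.1.continuousOn.mono fun t ht => ht.1).aestronglyMeasurable measurableSet_Ioc
  have hq' : AEStronglyMeasurable (fun t => (q t : ℂ)) (volume.restrict (Ioc 0 a)) :=
    Complex.continuous_ofReal.comp_aestronglyMeasurable hq
  exact ((hq'.mul hf).sub hg).norm

theorem integrableOn_resid : IntegrableOn (fun t => t ^ (l + 1) * resid l q f t) (Ioc 0 a) := by
  obtain ⟨M, hM0, hM⟩ := h.exists_bound
  refine Integrable.mono' (((h.hqi.mono_set h.Ioc_subset).const_mul M).add
    (h.hgi.mono_set h.Ioc_subset)) ?_ (ae_restrict_of_forall_mem measurableSet_Ioc fun t ht => ?_)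
  · exact (Real.continuous_rpow_const (by linarith [h.hl])).aestronglyMeasurable.mul
      h.aestronglyMeasurable_resid
  · have ht0 : 0 < t := ht.1
    have h4 : t ^ (l + 1) = t * t ^ l := by rw [Real.rpow_add ht0, Real.rpow_one, mul_comm]
    rw [Real.norm_of_nonneg (mul_nonneg (by positivity) (resid_nonneg t))]
    have h5 := mul_le_mul_of_nonneg_left (resid_le (l := l) (q := q) (f := f) t)
      (by positivity : 0 ≤ t ^ (l + 1))
    have h6 := mul_le_mul_of_nonneg_right (hM t ht) (by positivity : 0 ≤ t * |q t|)
    refine h5.trans ?_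
    rw [mul_add]
    refine add_le_add_left ?_ _
    rw [h4]
    calc _ = t ^ l * ‖f t‖ * (t * |q t|) := by ring
      _ ≤ _ := h6

/-- Vanishing of the Wronskian at 0 allows its derivative to be integrated from 0, where the source
is integrable by the a priori bound. -/
theorem norm_wronskPow_le (hU : Tendsto (wronskPow (l + 1) f) (𝓝[>] 0) (𝓝 0)) {x : ℝ}
    (hx : x ∈ Ioc 0 a) :
    ‖wronskPow (l + 1) f x‖ ≤ ∫ t in Ioc 0 x, t ^ (l + 1) * resid l q f t := by
  have h1 : Tendsto (fun y => ‖wronskPow (l + 1) f y‖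
      + ∫ t in Ioc 0 x, t ^ (l + 1) * resid l q f t) (𝓝[>] 0)
      (𝓝 (‖(0 : ℂ)‖ + ∫ t in Ioc 0 x, t ^ (l + 1) * resid l q f t)) := hU.norm.add_const _
  rw [norm_zero, zero_add] at h1
  refine ge_of_tendsto h1 ?_
  filter_upwards [Ioo_mem_nhdsGT hx.1] with y hy
  have h2 := norm_wronskPow_sub_le (q := q) (l := l) mul_sub_one_add h.hf hy.1 hy.2.le
  have h3 := norm_sub_norm_le (wronskPow (l + 1) f x) (wronskPow (l + 1) f y)
  have h4 : ∫ t in Ioc y x, t ^ (l + 1) * resid l q f t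
      ≤ ∫ t in Ioc 0 x, t ^ (l + 1) * resid l q f t := by
    refine setIntegral_mono_set (h.integrableOn_resid.mono_set (Ioc_subset_Ioc_right hx.2)) ?_
      (Ioc_subset_Ioc_left hy.1.le).eventuallyLE
    exact ae_restrict_of_forall_mem measurableSet_Ioc fun t ht =>
      mul_nonneg (Real.rpow_nonneg ht.1.le _) (resid_nonneg t)
  exact (sub_le_iff_le_add'.1 (h3.trans h2)).trans (add_le_add_right h4 _)

/-- The Wronskian with x^(l+1) is integrated over (0, x) and the one with x^(-l) over (x, a); for l
≥ 0 these are the two regimes of the Bessel kernel. -/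
theorem wronskPow_le_kernel (hU : Tendsto (wronskPow (l + 1) f) (𝓝[>] 0) (𝓝 0)) {x : ℝ}
    (hx : x ∈ Ioc 0 a) :
    x ^ (l + 1) * ‖wronskPow (-l) f x‖ + x ^ (-l) * ‖wronskPow (l + 1) f x‖
      ≤ ‖wronskPow (-l) f a‖ * x ^ (l + 1)
        + ∫ t in Ioc 0 a, besselKernel l x t * resid l q f t := by
  have hx0 : 0 < x := hx.1
  have hki : IntegrableOn (fun t => besselKernel l x t * resid l q f t) (Ioc 0 a) :=
    integrableOn_besselKernel_mul measurableSet_Ioc (fun t ht => ht.1) resid_nonneg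
      h.aestronglyMeasurable_resid h.integrableOn_resid hx0
  have hs1 : Ioc 0 x ⊆ Ioc 0 a := Ioc_subset_Ioc_right hx.2
  have hs2 : Ioc x a ⊆ Ioc 0 a := Ioc_subset_Ioc_left hx0.le
  rw [← Ioc_union_Ioc_eq_Ioc hx0.le hx.2, setIntegral_union (Ioc_disjoint_Ioc_of_le le_rfl)
    measurableSet_Ioc (hki.mono_set hs1) (hki.mono_set hs2)]
  have e1 : ∫ t in Ioc 0 x, besselKernel l x t * resid l q f t
      = x ^ (-l) * ∫ t in Ioc 0 x, t ^ (l + 1) * resid l q f t := by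
    rw [← integral_const_mul]
    refine setIntegral_congr_fun measurableSet_Ioc fun t ht => ?_
    rw [besselKernel_of_le h.hl ht.1 ht.2, mul_assoc]
  have e2 : ∫ t in Ioc x a, besselKernel l x t * resid l q f t
      = x ^ (l + 1) * ∫ t in Ioc x a, t ^ (-l) * resid l q f t := by
    rw [← integral_const_mul]
    refine setIntegral_congr_fun measurableSet_Ioc fun t ht => ?_
    rw [besselKernel_of_ge h.hl hx0 ht.1.le, mul_assoc]
  have h1 := norm_wronskPow_sub_le (q := q) (l := l) mul_sub_one_neg h.hf hx0 hx.2
  have h2 := norm_sub_norm_le (wronskPow (-l) f x) (wronskPow (-l) f a)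
  rw [norm_sub_rev] at h2
  have h3 := mul_le_mul_of_nonneg_left (sub_le_iff_le_add'.1 (h2.trans h1))
    (by positivity : 0 ≤ x ^ (l + 1))
  have h4 := mul_le_mul_of_nonneg_left (h.norm_wronskPow_le hU hx)
    (by positivity : 0 ≤ x ^ (-l))
  rw [e1, e2]
  have h5 : ∫ t in Ioc x a, t ^ (-l) * resid l q f t
      = ∫ t in Ioc x a, t ^ (-l) * ‖(q t : ℂ) * f t - tau l q f t‖ := rfl
  rw [h5]
  linarith

/-- The integral inequality for `f` near `0` with the source term `τ f` separated. -/
theorem wronskPow_le_weight (hU : Tendsto (wronskPow (l + 1) f) (𝓝[>] 0) (𝓝 0)) {x : ℝ}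
    (hx : x ∈ Ioc 0 a) :
    x ^ (l + 1) * ‖wronskPow (-l) f x‖ + x ^ (-l) * ‖wronskPow (l + 1) f x‖
      ≤ (‖wronskPow (-l) f a‖ * x ^ (l + 1) + besselIntegral l (tau l q f) x)
        + ∫ t in Ioc 0 a, besselKernel l x t * (|q t| * ‖f t‖) := by
  have hx0 : 0 < x := hx.1
  obtain ⟨M, hM0, hM⟩ := h.exists_bound
  have hgI : IntegrableOn (fun t => besselKernel l x t * ‖tau l q f t‖) (Ioo 0 1) :=
    integrableOn_besselKernel_mul measurableSet_Ioo (fun t ht => ht.1) (fun _ => norm_nonneg _)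
      h.hgm.norm h.hgi hx0
  have hqI : IntegrableOn (fun t => besselKernel l x t * (|q t| * ‖f t‖)) (Ioc 0 a) := by
    have hf : AEStronglyMeasurable f (volume.restrict (Ioc 0 a)) :=
      (h.hf.1.continuousOn.mono fun t ht => ht.1).aestronglyMeasurable measurableSet_Ioc
    have hm : AEStronglyMeasurable (fun t => |q t| * ‖f t‖) (volume.restrict (Ioc 0 a)) :=
      (h.hqm.mono_measure (Measure.restrict_mono h.Ioc_subset le_rfl)).norm.mul hf.norm
    refine integrableOn_besselKernel_mul measurableSet_Ioc (fun t ht => ht.1)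
      (fun t => by positivity) hm ?_ hx0
    refine Integrable.mono' ((h.hqi.mono_set h.Ioc_subset).const_mul M)
      ((Real.continuous_rpow_const (by linarith [h.hl])).aestronglyMeasurable.mul hm)
      (ae_restrict_of_forall_mem measurableSet_Ioc fun t ht => ?_)
    have ht0 : 0 < t := ht.1
    have h4 : t ^ (l + 1) = t * t ^ l := by rw [Real.rpow_add ht0, Real.rpow_one, mul_comm]
    have h6 := mul_le_mul_of_nonneg_right (hM t ht) (by positivity : 0 ≤ t * |q t|)
    rw [Real.norm_of_nonneg (by positivity), h4]
    calc _ = t ^ l * ‖f t‖ * (t * |q t|) := by ring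
      _ ≤ _ := h6
  have h1 := h.wronskPow_le_kernel hU hx
  have h2 : ∫ t in Ioc 0 a, besselKernel l x t * resid l q f t
      ≤ ∫ t in Ioc 0 a, (besselKernel l x t * ‖tau l q f t‖
        + besselKernel l x t * (|q t| * ‖f t‖)) := by
    refine setIntegral_mono_on (integrableOn_besselKernel_mul measurableSet_Ioc
      (fun t ht => ht.1) resid_nonneg h.aestronglyMeasurable_resid h.integrableOn_resid hx0)
      ((hgI.mono_set h.Ioc_subset).add hqI) measurableSet_Ioc fun t ht => ?_
    rw [← mul_add]
    refine mul_le_mul_of_nonneg_left ?_ (besselKernel_nonneg hx0 ht.1)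
    linarith [resid_le (l := l) (q := q) (f := f) t]
  rw [integral_add (hgI.mono_set h.Ioc_subset) hqI] at h2
  have h3 : ∫ t in Ioc 0 a, besselKernel l x t * ‖tau l q f t‖ ≤ besselIntegral l (tau l q f) x :=
    setIntegral_mono_set hgI (ae_restrict_of_forall_mem measurableSet_Ioo fun t ht =>
      mul_nonneg (besselKernel_nonneg hx0 ht.1) (norm_nonneg _)) h.Ioc_subset.eventuallyLE
  linarith

theorem besselKernel_mul_besselIntegral_le {x s : ℝ} (hx : 0 < x) (hs : 0 < s) :
    besselKernel l x s * besselIntegral l (tau l q f) s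
      ≤ s * besselIntegral l (tau l q f) x := by
  have hi : ∀ x, 0 < x →
      IntegrableOn (fun t => besselKernel l x t * ‖tau l q f t‖) (Ioo 0 1) := fun x hx =>
    integrableOn_besselKernel_mul measurableSet_Ioo (fun t ht => ht.1) (fun _ => norm_nonneg _)
      h.hgm.norm h.hgi hx
  rw [besselIntegral, besselIntegral, ← integral_const_mul, ← integral_const_mul]
  refine setIntegral_mono_on ((hi s hs).const_mul _) ((hi x hx).const_mul _) measurableSet_Ioo
    fun t ht => ?_
  rw [← mul_assoc, ← mul_assoc]
  exact mul_le_mul_of_nonneg_right (besselKernel_mul_le hx hs ht.1) (norm_nonneg _)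

/-- The fixed-point estimate requires f to be dominated by some multiple of the weight in advance.
Adding η x^(-l) achieves this by the a priori bound, and the resulting constant 2 does not depend on
η, so η → 0. -/
theorem norm_le_weight (hU : Tendsto (wronskPow (l + 1) f) (𝓝[>] 0) (𝓝 0)) {x : ℝ}
    (hx : x ∈ Ioc 0 a) :
    ‖f x‖ ≤ 2 * (‖wronskPow (-l) f a‖ * x ^ (l + 1) + besselIntegral l (tau l q f) x) := by
  obtain ⟨M, hM0, hM⟩ := h.exists_bound
  set c := ‖wronskPow (-l) f a‖ with hc
  have hc0 : 0 ≤ c := norm_nonneg _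
  have key : ∀ η : ℝ, 0 < η → ∀ x ∈ Ioc 0 a, ‖f x‖ ≤
      2 * (c * x ^ (l + 1) + besselIntegral l (tau l q f) x + η * x ^ (-l)) := by
    intro η hη
    refine le_two_mul_of_integral_le (k := besselKernel l) (θ := fun t => |q t|)
      (P := fun t => ‖f t‖)
      (w := fun x => c * x ^ (l + 1) + besselIntegral l (tau l q f) x + η * x ^ (-l))
      measurableSet_Ioc (fun x hx s hs => besselKernel_nonneg hx.1 hs.1) (fun _ => abs_nonneg _)
      (fun _ => norm_nonneg _) (fun s hs => ?_) (h.hqi.mono_set h.Ioc_subset) h.hsmall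
      (fun x hx s hs => ?_) (fun x hx => ?_) (B := M / η) (by positivity) (fun x hx => ?_)
    · have hs0 : 0 < s := hs.1
      have := besselIntegral_nonneg (l := l) (g := tau l q f) hs0
      positivity
    · have hs0 : 0 < s := hs.1
      have hx0 : 0 < x := hx.1
      have h1 := mul_le_mul_of_nonneg_left (besselKernel_mul_rpow_add_one_le (l := l) (x := x) hs0) hc0
      have h2 := mul_le_mul_of_nonneg_left (besselKernel_mul_rpow_neg_le (l := l) (x := x) hs0) hη.le
      have h3 := h.besselKernel_mul_besselIntegral_le hx0 hs0
      nlinarith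
    · have hx0 : 0 < x := hx.1
      have h1 := norm_le_wronskPow (f := f) h.hl hx0
      have h2 := h.wronskPow_le_weight hU hx
      have h3 : 0 ≤ η * x ^ (-l) := by positivity
      linarith
    · have hx0 : 0 < x := hx.1
      have h1 := hM x hx
      have h2 : x ^ l * x ^ (-l) = 1 := by rw [← Real.rpow_add hx0]; simp
      have h3 := mul_le_mul_of_nonneg_right h1 (by positivity : 0 ≤ x ^ (-l))
      have h4 : x ^ l * ‖f x‖ * x ^ (-l) = ‖f x‖ := by linear_combination ‖f x‖ * h2
      have h5 := besselIntegral_nonneg (l := l) (g := tau l q f) hx0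
      rw [h4] at h3
      refine h3.trans ?_
      have h6 : M * x ^ (-l) = M / η * (η * x ^ (-l)) := by field_simp
      rw [h6]
      refine mul_le_mul_of_nonneg_left ?_ (by positivity)
      have : 0 ≤ c * x ^ (l + 1) := by positivity
      linarith
  have hlim : Tendsto (fun η : ℝ =>
      2 * (c * x ^ (l + 1) + besselIntegral l (tau l q f) x + η * x ^ (-l))) (𝓝[>] 0)
      (𝓝 (2 * (c * x ^ (l + 1) + besselIntegral l (tau l q f) x + 0 * x ^ (-l)))) :=
    tendsto_nhdsWithin_of_tendsto_nhds (Continuous.tendsto (by fun_prop) 0)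
  rw [zero_mul, add_zero] at hlim
  refine ge_of_tendsto hlim ?_
  filter_upwards [self_mem_nhdsWithin] with η hη using key η hη x hx

/-- By `mul_deriv_eq_wronskPow`, x f' is (l+1) f plus x^(-l) times the Wronskian with x^(l+1). The
first contributes 2(l+1) times the weight, the second at most 2 times. -/
theorem mul_norm_deriv_le_weight (hU : Tendsto (wronskPow (l + 1) f) (𝓝[>] 0) (𝓝 0)) {x : ℝ}
    (hx : x ∈ Ioc 0 a) :
    x * ‖deriv f x‖ ≤ (2 * l + 4) *
      (‖wronskPow (-l) f a‖ * x ^ (l + 1) + besselIntegral l (tau l q f) x) := by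
  have hx0 : 0 < x := hx.1
  set w : ℝ → ℝ := fun x => ‖wronskPow (-l) f a‖ * x ^ (l + 1) + besselIntegral l (tau l q f) x
    with hw
  have hw0 : 0 ≤ w x := by
    have := besselIntegral_nonneg (l := l) (g := tau l q f) hx0
    simp only [hw]; positivity
  have h1 : ∫ t in Ioc 0 a, besselKernel l x t * (|q t| * ‖f t‖)
      ≤ ∫ t in Ioc 0 a, 2 * w x * (t * |q t|) := by
    refine integral_mono_of_nonneg (ae_restrict_of_forall_mem measurableSet_Ioc fun t ht => ?_)
      ((h.hqi.mono_set h.Ioc_subset).const_mul _)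
      (ae_restrict_of_forall_mem measurableSet_Ioc fun t ht => ?_)
    · exact mul_nonneg (besselKernel_nonneg hx0 ht.1) (by positivity)
    · have ht0 : 0 < t := ht.1
      have hk0 := besselKernel_nonneg (l := l) hx0 ht0
      have h2 := mul_le_mul_of_nonneg_left (h.norm_le_weight hU ht)
        (mul_nonneg hk0 (abs_nonneg (q t)))
      have h3 : besselKernel l x t * w t ≤ t * w x := by
        have h4 := mul_le_mul_of_nonneg_left (besselKernel_mul_rpow_add_one_le (l := l) (x := x) ht0)
          (norm_nonneg (wronskPow (-l) f a))
        have h5 := h.besselKernel_mul_besselIntegral_le hx0 ht0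
        simp only [hw]
        linarith
      have h4 := mul_le_mul_of_nonneg_right h3 (abs_nonneg (q t))
      have h5 : besselKernel l x t * |q t| * (2 * w t) ≤ 2 * w x * (t * |q t|) := by linarith
      calc _ = besselKernel l x t * |q t| * ‖f t‖ := by ring
        _ ≤ besselKernel l x t * |q t| * (2 * w t) := h2
        _ ≤ _ := h5
  rw [integral_const_mul] at h1
  have h2 := mul_le_mul_of_nonneg_left h.hsmall (by positivity : 0 ≤ 2 * w x)
  have h3 : x ^ (l + 1) * ‖wronskPow (-l) f x‖ + x ^ (-l) * ‖wronskPow (l + 1) f x‖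
      ≤ w x + ∫ t in Ioc 0 a, besselKernel l x t * (|q t| * ‖f t‖) := h.wronskPow_le_weight hU hx
  have h4 : x ^ (-l) * ‖wronskPow (l + 1) f x‖ ≤ 2 * w x := by
    have : 0 ≤ x ^ (l + 1) * ‖wronskPow (-l) f x‖ := by positivity
    linarith
  have h5 := congrArg norm (mul_deriv_eq_wronskPow (l := l) (f := f) hx0)
  have h6 := norm_add_le ((l + 1 : ℂ) * f x) (cpowR (-l) x * wronskPow (l + 1) f x)
  rw [← h5, norm_mul, norm_mul, norm_mul, norm_cpowR hx0, Complex.norm_real,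
    Real.norm_of_nonneg hx0.le] at h6
  have h7 : ‖(l + 1 : ℂ)‖ = l + 1 := by
    have : (l + 1 : ℂ) = ((l + 1 : ℝ) : ℂ) := by push_cast; rfl
    rw [this, Complex.norm_real, Real.norm_of_nonneg (by linarith [h.hl])]
  rw [h7] at h6
  have h8 := mul_le_mul_of_nonneg_left (h.norm_le_weight hU hx)
    (by linarith [h.hl] : 0 ≤ l + 1)
  have h9 : (l + 1) * (2 * w x) = (2 * l + 2) * w x := by ring
  have h10 : (2 * l + 4) * w x = (2 * l + 2) * w x + 2 * w x := by ring
  change x * ‖deriv f x‖ ≤ (2 * l + 4) * w x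
  change (l + 1) * ‖f x‖ ≤ (l + 1) * (2 * w x) at h8
  linarith

end NearZero

end NearZero

/-! ### The Wronskian limit at 0 and pointwise bounds for the domain of H. -/

section NearZero

variable {l : ℝ} {q : ℝ → ℝ} {f : ℝ → ℂ} {a : ℝ}

theorem Hypothesis.integrableOn_mul_abs (hq : Hypothesis l q) (hl : -(1 / 2) < l) :
    IntegrableOn (fun s => s * |q s|) (Ioo 0 1) := by
  refine IntegrableOn.congr_fun (hq.integrable_of_gt hl).norm (fun s hs => ?_) measurableSet_Ioo
  simp only [norm_mul, Real.norm_eq_abs, abs_of_pos hs.1]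

theorem Hypothesis.aestronglyMeasurable (hq : Hypothesis l q) :
    AEStronglyMeasurable q (volume.restrict (Ioo 0 1)) :=
  hq.locallyIntegrable.aestronglyMeasurable.mono_measure
    (Measure.restrict_mono (fun _ hx => hx.1) le_rfl)

theorem exists_setIntegral_Ioc_le {p : ℝ → ℝ} (hp : IntegrableOn p (Ioo 0 1)) {ε : ℝ}
    (hε : 0 < ε) : ∃ a, 0 < a ∧ a < 1 ∧ ∫ s in Ioc 0 a, p s ≤ ε := by
  have h1 : IntegrableOn p (uIcc 0 (1 / 2)) := by
    rw [uIcc_of_le (by norm_num), integrableOn_Icc_iff_integrableOn_Ioc]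
    exact hp.mono_set fun x hx => ⟨hx.1, by linarith [hx.2]⟩
  have h2 := intervalIntegral.continuousOn_primitive_interval h1
  have h3 : Tendsto (fun x => ∫ t in (0 : ℝ)..x, p t) (𝓝[>] 0) (𝓝 0) := by
    have h4 := h2 0 left_mem_uIcc
    rw [ContinuousWithinAt, intervalIntegral.integral_same, uIcc_of_le (by norm_num)] at h4
    refine h4.mono_left ?_
    rw [← nhdsWithin_Ioc_eq_nhdsGT (show (0 : ℝ) < 1 / 2 by norm_num)]
    exact nhdsWithin_mono _ Ioc_subset_Icc_self
  have h5 := (h3.eventually_le_const hε).and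
    (Ioo_mem_nhdsGT (show (0 : ℝ) < 1 by norm_num))
  obtain ⟨a, ha, ha0, ha1⟩ := h5.exists
  exact ⟨a, ha0, ha1, by rwa [intervalIntegral.integral_of_le ha0.le] at ha⟩

theorem Hypothesis.exists_nearZero (hq : Hypothesis l q) (hl : 0 ≤ l) (hf : IsRegular f)
    (hg : MemLp (tau l q f) 2 (volume.restrict (Ioo 0 1))) : ∃ a, NearZero l q f a := by
  have hqi := hq.integrableOn_mul_abs (by linarith)
  obtain ⟨a, ha, ha1, hsmall⟩ := exists_setIntegral_Ioc_le hqi (show (0 : ℝ) < 1 / 4 by norm_num)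
  refine ⟨a, hl, ha, ha1, hf, hqi, hq.aestronglyMeasurable, hsmall, hg.1, ?_⟩
  have h1 : IntegrableOn (fun s => ‖tau l q f s‖) (Ioo 0 1) :=
    (hg.integrable (by norm_num)).norm
  refine Integrable.mono' h1
    ((Real.continuous_rpow_const (by linarith)).aestronglyMeasurable.mul hg.1.norm)
    (ae_restrict_of_forall_mem measurableSet_Ioo fun s hs => ?_)
  rw [Real.norm_of_nonneg (mul_nonneg (Real.rpow_nonneg hs.1.le _) (norm_nonneg _))]
  exact mul_le_of_le_one_left (norm_nonneg _) (Real.rpow_le_one hs.1.le hs.2.le (by linarith))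

theorem not_integrableOn_inv {δ : ℝ} (hδ : 0 < δ) :
    ¬ IntegrableOn (fun x : ℝ => x⁻¹) (Ioc 0 δ) := by
  intro h
  have h1 : IntervalIntegrable (fun x : ℝ => x⁻¹) volume 0 δ :=
    (intervalIntegrable_iff_integrableOn_Ioc_of_le hδ.le).2 h
  rw [intervalIntegrable_inv_iff] at h1
  rcases h1 with h1 | h1
  · exact hδ.ne h1
  · exact h1 left_mem_uIcc

namespace NearZero

theorem exists_tendsto_wronskPow (h : NearZero l q f a) :
    ∃ c, Tendsto (wronskPow (l + 1) f) (𝓝[>] 0) (𝓝 c) := by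
  set F : ℝ → ℂ := fun x => (q x * f x - tau l q f x) * cpowR (l + 1) x with hF
  have hm : AEStronglyMeasurable F (volume.restrict (Ioc 0 a)) := by
    have hq := h.hqm.mono_measure (Measure.restrict_mono h.Ioc_subset le_rfl)
    have hg := h.hgm.mono_measure (Measure.restrict_mono h.Ioc_subset le_rfl)
    have hf : AEStronglyMeasurable f (volume.restrict (Ioc 0 a)) :=
      (h.hf.1.continuousOn.mono fun t ht => ht.1).aestronglyMeasurable measurableSet_Ioc
    have hq' : AEStronglyMeasurable (fun t => (q t : ℂ)) (volume.restrict (Ioc 0 a)) :=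
      Complex.continuous_ofReal.comp_aestronglyMeasurable hq
    exact ((hq'.mul hf).sub hg).mul
      (((continuousOn_cpowR _).mono fun t ht => ht.1).aestronglyMeasurable measurableSet_Ioc)
  have hi : IntegrableOn F (Ioc 0 a) := by
    refine Integrable.mono' h.integrableOn_resid hm
      (ae_restrict_of_forall_mem measurableSet_Ioc fun t ht => ?_)
    rw [hF, norm_mul, norm_cpowR ht.1, mul_comm]
    rfl
  have h1 : IntegrableOn F (uIcc 0 a) := by
    rwa [uIcc_of_le h.ha.le, integrableOn_Icc_iff_integrableOn_Ioc]
  have h2 := intervalIntegral.continuousOn_primitive_interval_left h1 0 left_mem_uIcc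
  rw [ContinuousWithinAt, uIcc_of_le h.ha.le] at h2
  have h3 : Tendsto (fun x => ∫ t in x..a, F t) (𝓝[>] 0) (𝓝 (∫ t in (0 : ℝ)..a, F t)) := by
    refine h2.mono_left ?_
    rw [← nhdsWithin_Ioc_eq_nhdsGT h.ha]
    exact nhdsWithin_mono _ Ioc_subset_Icc_self
  refine ⟨wronskPow (l + 1) f a - ∫ t in (0 : ℝ)..a, F t,
    (tendsto_const_nhds.sub h3).congr' ?_⟩
  filter_upwards [Ioo_mem_nhdsGT h.ha] with x hx
  have h4 := (isPrim_wronskPow (q := q) (l := l) mul_sub_one_add h.hf hx.1 hx.2.le).sub_eq hx.2.le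
  rw [← h4]
  ring

/-- For x ≤ t one has x^(2l+1) t^(-l) ≤ t^(l+1), so the source term is dominated by an integrable
function and tends to 0 pointwise. -/
theorem tendsto_rpow_mul_wronskPow_neg (h : NearZero l q f a) :
    Tendsto (fun x => x ^ (2 * l + 1) * ‖wronskPow (-l) f x‖) (𝓝[>] 0) (𝓝 0) := by
  have hl := h.hl
  have hpow : Tendsto (fun x : ℝ => x ^ (2 * l + 1)) (𝓝[>] 0) (𝓝 0) := by
    have := (Real.continuous_rpow_const (q := 2 * l + 1) (by linarith)).tendsto 0
    rw [Real.zero_rpow (by linarith)] at this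
    exact tendsto_nhdsWithin_of_tendsto_nhds this
  have hdom : Tendsto (fun x : ℝ => ∫ t in Ioc 0 a,
      (Ioc x a).indicator (fun t => x ^ (2 * l + 1) * (t ^ (-l) * resid l q f t)) t)
      (𝓝[>] 0) (𝓝 (∫ _t in Ioc 0 a, (0 : ℝ))) := by
    refine tendsto_integral_filter_of_dominated_convergence
      (fun t => t ^ (l + 1) * resid l q f t) ?_ ?_ h.integrableOn_resid ?_
    · refine Eventually.of_forall fun x => AEStronglyMeasurable.indicator ?_ measurableSet_Ioc
      refine aestronglyMeasurable_const.mul (AEStronglyMeasurable.mul ?_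
        h.aestronglyMeasurable_resid)
      have : Measurable fun t : ℝ => t ^ (-l) := by fun_prop
      exact this.aestronglyMeasurable
    · filter_upwards [self_mem_nhdsWithin] with x hx
      refine ae_restrict_of_forall_mem measurableSet_Ioc fun t ht => ?_
      have hx0 : 0 < x := hx
      have ht0 : 0 < t := ht.1
      have hr := resid_nonneg (l := l) (q := q) (f := f) t
      by_cases htx : t ∈ Ioc x a
      · rw [indicator_of_mem htx, Real.norm_of_nonneg (by positivity), ← mul_assoc]
        refine mul_le_mul_of_nonneg_right ?_ hr
        calc x ^ (2 * l + 1) * t ^ (-l) ≤ t ^ (2 * l + 1) * t ^ (-l) := by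
              have := Real.rpow_le_rpow hx0.le htx.1.le (show 0 ≤ 2 * l + 1 by linarith)
              gcongr
          _ = t ^ (l + 1) := by rw [← Real.rpow_add ht0]; ring_nf
      · rw [indicator_of_notMem htx, norm_zero]
        positivity
    · refine ae_restrict_of_forall_mem measurableSet_Ioc fun t ht => ?_
      have h1 := hpow.mul_const (t ^ (-l) * resid l q f t)
      rw [zero_mul] at h1
      refine h1.congr' ?_
      filter_upwards [Ioo_mem_nhdsGT ht.1] with x hx
      rw [indicator_of_mem (show t ∈ Ioc x a from ⟨hx.2, ht.2⟩)]
  rw [integral_zero] at hdom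
  have hsum := (hpow.mul_const ‖wronskPow (-l) f a‖).add hdom
  rw [zero_mul, add_zero] at hsum
  refine squeeze_zero' ?_ ?_ hsum
  · filter_upwards [self_mem_nhdsWithin] with x hx
    have hx0 : 0 < x := hx
    positivity
  · filter_upwards [Ioo_mem_nhdsGT h.ha] with x hx
    have hx0 : 0 < x := hx.1
    have h1 := norm_wronskPow_sub_le (q := q) (l := l) mul_sub_one_neg h.hf hx0 hx.2.le
    have h2 := norm_sub_norm_le (wronskPow (-l) f x) (wronskPow (-l) f a)
    rw [norm_sub_rev] at h2
    have h3 := mul_le_mul_of_nonneg_left (sub_le_iff_le_add'.1 (h2.trans h1))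
      (by positivity : 0 ≤ x ^ (2 * l + 1))
    refine h3.trans (le_of_eq ?_)
    rw [setIntegral_indicator measurableSet_Ioc,
      inter_eq_self_of_subset_right (Ioc_subset_Ioc_left hx0.le), integral_const_mul, mul_add]
    rfl

/-- A nonzero limit would force |f| ≥ const · x^(-l) near 0; as 2l ≥ 1 this contradicts f ∈ L²,
because 1/x is not integrable at 0. -/
theorem tendsto_wronskPow_of_memLp (h : NearZero l q f a) (hl : 1 / 2 ≤ l)
    (hf2 : MemLp f 2 volPos) : Tendsto (wronskPow (l + 1) f) (𝓝[>] 0) (𝓝 0) := by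
  obtain ⟨c, hc⟩ := h.exists_tendsto_wronskPow
  by_cases hc0 : c = 0
  · rwa [hc0] at hc
  exfalso
  have h1 := (hc.norm).sub h.tendsto_rpow_mul_wronskPow_neg
  rw [sub_zero] at h1
  have hcpos : 0 < ‖c‖ := norm_pos_iff.2 hc0
  obtain ⟨δ, hδ, hδs⟩ := mem_nhdsGT_iff_exists_Ioc_subset.1
    ((h1.eventually_const_le (show ‖c‖ / 2 < ‖c‖ by linarith)).and
      (Ioo_mem_nhdsGT (show (0 : ℝ) < 1 by norm_num)))
  have hδ0 : 0 < δ := hδ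
  refine not_integrableOn_inv hδ0 ?_
  have hint : IntegrableOn (fun x => ‖f x‖ ^ 2) (Ioc 0 δ) :=
    (hf2.integrable_norm_pow (by norm_num)).mono_measure
      (Measure.restrict_mono (fun _ hx => hx.1) le_rfl)
  refine Integrable.mono' (hint.const_mul ((2 * l + 1) ^ 2 / (‖c‖ / 2) ^ 2))
    measurable_inv.aestronglyMeasurable
    (ae_restrict_of_forall_mem measurableSet_Ioc fun x hx => ?_)
  have hx0 : 0 < x := hx.1
  obtain ⟨h2, -, h3⟩ := hδs hx
  have h4 := congrArg norm (wronskPow_combination (l := l) (f := f) hx0)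
  have h5 := norm_sub_norm_le (cpowR (-l) x * wronskPow (l + 1) f x)
    (cpowR (l + 1) x * wronskPow (-l) f x)
  rw [norm_sub_rev, ← h4, norm_mul, norm_mul, norm_mul, norm_cpowR hx0, norm_cpowR hx0] at h5
  have h6 : ‖(2 * l + 1 : ℂ)‖ = 2 * l + 1 := by
    have : (2 * l + 1 : ℂ) = ((2 * l + 1 : ℝ) : ℂ) := by push_cast; rfl
    rw [this, Complex.norm_real, Real.norm_of_nonneg (by linarith)]
  rw [h6] at h5
  have h7 : x ^ (l + 1) = x ^ (-l) * x ^ (2 * l + 1) := by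
    rw [← Real.rpow_add hx0]; ring_nf
  have h8 : ‖c‖ / 2 * x ^ (-l) ≤ (2 * l + 1) * ‖f x‖ := by
    refine le_trans ?_ h5
    rw [h7, mul_assoc, ← mul_sub, mul_comm]
    exact mul_le_mul_of_nonneg_left h2 (by positivity)
  have h9 : x⁻¹ ≤ (x ^ (-l)) ^ 2 := by
    rw [← Real.rpow_neg_one, ← Real.rpow_natCast, ← Real.rpow_mul hx0.le]
    exact Real.rpow_le_rpow_of_exponent_ge hx0 h3.le (by push_cast; linarith)
  have h10 := pow_le_pow_left₀ (by positivity) h8 2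
  rw [Real.norm_of_nonneg (by positivity), div_mul_eq_mul_div, le_div_iff₀ (by positivity)]
  calc x⁻¹ * (‖c‖ / 2) ^ 2 ≤ (x ^ (-l)) ^ 2 * (‖c‖ / 2) ^ 2 := by gcongr
    _ = (‖c‖ / 2 * x ^ (-l)) ^ 2 := by ring
    _ ≤ _ := h10
    _ = _ := by ring

end NearZero

/-- The quantity in the boundary condition is minus the Wronskian with x^(l+1). -/
theorem BoundaryCondition.tendsto_wronskPow (hb : BoundaryCondition l f) (hl : l < 1 / 2) :
    Tendsto (wronskPow (l + 1) f) (𝓝[>] 0) (𝓝 0) := by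
  have h1 := (hb hl).neg
  rw [neg_zero] at h1
  refine h1.congr' ?_
  filter_upwards [self_mem_nhdsWithin] with x hx
  have hx0 : 0 < x := hx
  have h2 : cpowR (l + 1) x = cpowR l x * x := by
    rw [← cpowR_add hx0, cpowR_one]
  rw [wronskPow, h2, add_sub_cancel_right]
  simp only [cpowR]
  push_cast
  ring

/-- Near `0` the elements of the domain of `H` and their derivatives are dominated by the integral
of the Bessel kernel against `τ f`. -/
theorem Hypothesis.exists_bound (hq : Hypothesis l q) (hl : 0 ≤ l) (hf : IsRegular f)
    (hb : BoundaryCondition l f) (hf2 : MemLp f 2 volPos)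
    (hg : MemLp (tau l q f) 2 (volume.restrict (Ioo 0 1))) :
    ∃ K, 0 ≤ K ∧ ∀ x ∈ Ioo (0 : ℝ) 1,
      ‖f x‖ ≤ K * (x ^ (l + 1) + besselIntegral l (tau l q f) x) ∧
      x * ‖deriv f x‖ ≤ K * (x ^ (l + 1) + besselIntegral l (tau l q f) x) := by
  obtain ⟨a, h⟩ := hq.exists_nearZero hl hf hg
  have hU : Tendsto (wronskPow (l + 1) f) (𝓝[>] 0) (𝓝 0) := by
    rcases lt_or_ge l (1 / 2) with hl2 | hl2
    · exact hb.tendsto_wronskPow hl2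
    · exact h.tendsto_wronskPow_of_memLp hl2 hf2
  set c := ‖wronskPow (-l) f a‖ with hc
  have hsub : Icc a 1 ⊆ Ioi 0 := fun x hx => h.ha.trans_le hx.1
  obtain ⟨M, hM⟩ := isCompact_Icc.exists_bound_of_continuousOn (hf.1.continuousOn.mono hsub)
  obtain ⟨N, hN⟩ := isCompact_Icc.exists_bound_of_continuousOn (hf.continuousOn_deriv.mono hsub)
  have ha := h.ha
  have hc0 : 0 ≤ c := norm_nonneg _
  have hM0 : 0 ≤ M := (norm_nonneg _).trans (hM a ⟨le_rfl, h.ha1.le⟩)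
  have hN0 : 0 ≤ N := (norm_nonneg _).trans (hN a ⟨le_rfl, h.ha1.le⟩)
  -- The first summand serves (0, a]; the second serves [a, 1), where f and f' are bounded by
  -- compactness and x^(l+1) ≥ a^(l+1).
  refine ⟨(2 * l + 4) * (c + 1) + (M + N) / a ^ (l + 1), by positivity, fun x hx => ?_⟩
  have hx0 : 0 < x := hx.1
  have hG := besselIntegral_nonneg (l := l) (g := tau l q f) hx0
  set G := besselIntegral l (tau l q f) x
  have hxp : 0 < x ^ (l + 1) := by positivity
  rcases le_total x a with hxa | hxa
  · have h1 := h.norm_le_weight hU ⟨hx0, hxa⟩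
    have h2 := h.mul_norm_deriv_le_weight hU ⟨hx0, hxa⟩
    have h3 : c * x ^ (l + 1) + G ≤ (c + 1) * (x ^ (l + 1) + G) := by nlinarith
    have h4 : (2 * l + 4) * (c * x ^ (l + 1) + G)
        ≤ (2 * l + 4) * ((c + 1) * (x ^ (l + 1) + G)) :=
      mul_le_mul_of_nonneg_left h3 (by linarith)
    have h5 : 2 * (c * x ^ (l + 1) + G) ≤ (2 * l + 4) * (c * x ^ (l + 1) + G) :=
      mul_le_mul_of_nonneg_right (by linarith) (by positivity)
    have h6 : 0 ≤ (M + N) / a ^ (l + 1) * (x ^ (l + 1) + G) := by positivity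
    constructor
    · change ‖f x‖ ≤ 2 * (c * x ^ (l + 1) + G) at h1
      linarith
    · change x * ‖deriv f x‖ ≤ (2 * l + 4) * (c * x ^ (l + 1) + G) at h2
      linarith
  · have h1 := hM x ⟨hxa, hx.2.le⟩
    have h2 := hN x ⟨hxa, hx.2.le⟩
    have h3 : M + N ≤ (M + N) / a ^ (l + 1) * (x ^ (l + 1) + G) := by
      have h4 := Real.rpow_le_rpow ha.le hxa (by linarith : 0 ≤ l + 1)
      rw [div_mul_eq_mul_div, le_div_iff₀ (by positivity)]
      exact mul_le_mul_of_nonneg_left (by linarith) (by positivity)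
    have h5 : 0 ≤ (2 * l + 4) * (c + 1) * (x ^ (l + 1) + G) := by positivity
    have h6 : x * ‖deriv f x‖ ≤ ‖deriv f x‖ := mul_le_of_le_one_left (norm_nonneg _) hx.2.le
    constructor <;> linarith

theorem besselKernel_le_self (hl : 0 ≤ l) {x s : ℝ} (hx : 0 < x) (hs : 0 < s) :
    besselKernel l x s ≤ x := by
  have h1 : x ^ (-l) * x ^ (l + 1) = x := by rw [mul_comm, rpow_add_one_mul_rpow_neg hx]
  rcases le_total s x with h | h
  · refine besselKernel_le_left.trans ?_
    calc x ^ (-l) * s ^ (l + 1) ≤ x ^ (-l) * x ^ (l + 1) := by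
          have := Real.rpow_le_rpow hs.le h (by linarith : 0 ≤ l + 1)
          gcongr
      _ = x := h1
  · refine besselKernel_le_right.trans ?_
    calc x ^ (l + 1) * s ^ (-l) ≤ x ^ (l + 1) * x ^ (-l) := by
          have := Real.rpow_le_rpow_of_nonpos hx h (by linarith : -l ≤ 0)
          gcongr
      _ = x := by rw [mul_comm, h1]

/-- The source of the gain of two powers. For s ≥ x the kernel carries x^(m+2) x^(l-m-1), and the
hypothesis m + 2 ≤ l + 1 makes the last exponent nonnegative, so that x may be replaced by s in it.
-/
theorem besselKernel_mul_pow_le {m : ℕ} (hm : (m : ℝ) + 2 ≤ l + 1) {x s : ℝ} (hx : 0 < x)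
    (hs : 0 < s) : besselKernel l x s * s ^ m ≤ x ^ (m + 2) * (max x s)⁻¹ := by
  have hl : 0 ≤ l := by have : (0 : ℝ) ≤ m := m.cast_nonneg
                        linarith
  rcases le_total s x with h | h
  · rw [max_eq_left h, besselKernel_of_le hl hs h]
    calc x ^ (-l) * s ^ (l + 1) * s ^ m ≤ x ^ (-l) * x ^ (l + 1) * x ^ m := by
          have := Real.rpow_le_rpow hs.le h (by linarith : 0 ≤ l + 1)
          gcongr
      _ = x ^ (m + 2) * x⁻¹ := by
          rw [mul_comm (x ^ (-l)), rpow_add_one_mul_rpow_neg hx]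
          field_simp
          ring
  · rw [max_eq_right h, besselKernel_of_ge hl hx h]
    have h1 : x ^ (l + 1) = x ^ (m + 2) * x ^ (l - m - 1) := by
      rw [← Real.rpow_natCast, ← Real.rpow_add hx]; push_cast; ring_nf
    have h2 : s ^ (-l) * s ^ m = s ^ (-(l - m - 1)) * s⁻¹ := by
      rw [← Real.rpow_natCast, ← Real.rpow_neg_one s, ← Real.rpow_add hs, ← Real.rpow_add hs]
      ring_nf
    have h3 : x ^ (l - m - 1) ≤ s ^ (l - m - 1) := Real.rpow_le_rpow hx.le h (by linarith)
    have h4 : s ^ (l - m - 1) * s ^ (-(l - m - 1)) = 1 := by rw [← Real.rpow_add hs]; simp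
    rw [mul_assoc, h2, h1]
    calc x ^ (m + 2) * x ^ (l - m - 1) * (s ^ (-(l - m - 1)) * s⁻¹)
        ≤ x ^ (m + 2) * s ^ (l - m - 1) * (s ^ (-(l - m - 1)) * s⁻¹) := by gcongr
      _ = x ^ (m + 2) * s⁻¹ * (s ^ (l - m - 1) * s ^ (-(l - m - 1))) := by ring
      _ = _ := by rw [h4, mul_one]

theorem besselIntegral_le_mul {g : ℝ → ℂ} (hl : 0 ≤ l) (hg : IntegrableOn g (Ioo 0 1)) {x : ℝ}
    (hx : 0 < x) : besselIntegral l g x ≤ x * ∫ s in Ioo (0 : ℝ) 1, ‖g s‖ := by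
  rw [besselIntegral, ← integral_const_mul]
  refine integral_mono_of_nonneg (ae_restrict_of_forall_mem measurableSet_Ioo fun s hs => ?_)
    (hg.norm.const_mul _) (ae_restrict_of_forall_mem measurableSet_Ioo fun s hs => ?_)
  · exact mul_nonneg (besselKernel_nonneg hx hs.1) (norm_nonneg _)
  · exact mul_le_mul_of_nonneg_right (besselKernel_le_self hl hx hs.1) (norm_nonneg _)

theorem besselIntegral_le_maxKernelIntegral {g p : ℝ → ℂ} {m : ℕ} (hm : (m : ℝ) + 2 ≤ l + 1)
    (hp : IntegrableOn p (Ioo 0 1))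
    (hgp : ∀ᵐ s ∂volume.restrict (Ioo (0 : ℝ) 1), g s = (s : ℂ) ^ m * p s) {x : ℝ} (hx : 0 < x) :
    besselIntegral l g x ≤ x ^ (m + 2) * maxKernelIntegral (fun s => ‖p s‖) x := by
  rw [besselIntegral, maxKernelIntegral, ← integral_const_mul]
  refine integral_mono_of_nonneg (ae_restrict_of_forall_mem measurableSet_Ioo fun s hs => ?_)
    ((integrable_maxKernel hp.norm hx).const_mul _) ?_
  · exact mul_nonneg (besselKernel_nonneg hx hs.1) (norm_nonneg _)
  · filter_upwards [hgp, ae_restrict_mem measurableSet_Ioo] with s h1 hs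
    rw [h1, norm_mul, norm_pow, Complex.norm_real, Real.norm_of_nonneg hs.1.le, ← mul_assoc,
      ← mul_assoc]
    exact mul_le_mul_of_nonneg_right (besselKernel_mul_pow_le hm hx hs.1) (norm_nonneg _)

/-- The kernel is at most x and x^(l+1) ≤ x. The bound removes the boundary terms at 0 in all
integrations by parts. -/
theorem Hypothesis.exists_linear_bound (hq : Hypothesis l q) (hl : 0 ≤ l) (hf : IsRegular f)
    (hb : BoundaryCondition l f) (hf2 : MemLp f 2 volPos)
    (hg : MemLp (tau l q f) 2 (volume.restrict (Ioo 0 1))) :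
    ∃ K, 0 ≤ K ∧ ∀ x ∈ Ioo (0 : ℝ) 1, ‖f x‖ ≤ K * x ∧ ‖deriv f x‖ ≤ K := by
  obtain ⟨K, hK, h⟩ := hq.exists_bound hl hf hb hf2 hg
  set c := ∫ s in Ioo (0 : ℝ) 1, ‖tau l q f s‖
  have hc : 0 ≤ c := integral_nonneg fun _ => norm_nonneg _
  refine ⟨K * (1 + c), by positivity, fun x hx => ?_⟩
  have hx0 : 0 < x := hx.1
  have h1 := besselIntegral_le_mul hl (hg.integrable (by norm_num)) hx0
  have h2 : x ^ (l + 1) ≤ x := by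
    have := Real.rpow_le_rpow_of_exponent_ge hx0 hx.2.le (by linarith : 1 ≤ l + 1)
    rwa [Real.rpow_one] at this
  have h3 : K * (x ^ (l + 1) + besselIntegral l (tau l q f) x) ≤ K * (1 + c) * x := by
    rw [mul_assoc]
    refine mul_le_mul_of_nonneg_left ?_ hK
    change besselIntegral l (tau l q f) x ≤ x * c at h1
    linarith
  refine ⟨(h x hx).1.trans h3, ?_⟩
  have h4 := (h x hx).2.trans h3
  rw [mul_comm] at h4
  exact le_of_mul_le_mul_right h4 hx0

end NearZero

/-! ### Symmetry and self-adjointness of H; the gain of two powers. -/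

section Operator

variable {l : ℝ} {q : ℝ → ℝ} {f g : ℝ → ℂ}

theorem deriv_conj (f : ℝ → ℂ) : deriv (fun x => conj (f x)) = fun x => conj (deriv f x) :=
  funext fun _ => deriv.star

theorem tau_conj (l : ℝ) (q : ℝ → ℝ) (f : ℝ → ℂ) :
    tau l q (fun x => conj (f x)) = fun x => conj (tau l q f x) := by
  funext x
  rw [tau, tau, deriv_conj, deriv_conj, map_add, map_neg, map_mul, Complex.conj_ofReal]

theorem IsRegular.conj (hf : IsRegular f) : IsRegular (fun x => conj (f x)) := by
  refine ⟨fun x hx => ?_, fun a b ha hab => ?_⟩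
  · exact ((hf.hasDerivAt hx).star.differentiableAt).differentiableWithinAt
  · rw [deriv_conj]
    exact ac_of_dist_le (fun x y => by
      rw [dist_eq_norm, ← map_sub, RCLike.norm_conj, dist_eq_norm]) (hf.2 a b ha hab)

theorem InMaximalDomain.conj (hf : InMaximalDomain l q f) :
    InMaximalDomain l q (fun x => conj (f x)) := by
  refine ⟨hf.1.conj, hf.2.1.star, ?_⟩
  rw [tau_conj]
  exact hf.2.2.star

theorem tendsto_intervalIntegral_volPos {p : ℝ → ℂ} (hp : Integrable p volPos) :
    Tendsto (fun n : ℕ => ∫ x in (1 / ((n : ℝ) + 1))..((n : ℝ) + 1), p x) atTop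
      (𝓝 (∫ x, p x ∂volPos)) := by
  have hle : ∀ n : ℕ, 1 / ((n : ℝ) + 1) ≤ (n : ℝ) + 1 := fun n => by
    have : (0 : ℝ) ≤ n := n.cast_nonneg
    rw [div_le_iff₀ (by positivity)]
    nlinarith
  have hU : (⋃ n : ℕ, Ioc (1 / ((n : ℝ) + 1)) ((n : ℝ) + 1)) = Ioi 0 := by
    ext x
    simp only [mem_iUnion, mem_Ioc, mem_Ioi]
    refine ⟨fun ⟨n, hn, _⟩ => lt_trans (by positivity) hn, fun hx => ?_⟩
    obtain ⟨k, hk⟩ := exists_nat_gt (max x (1 / x))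
    have h1 := (le_max_left _ _).trans_lt hk
    have h2 := (le_max_right _ _).trans_lt hk
    rw [div_lt_iff₀ hx] at h2
    refine ⟨k, ?_, by linarith⟩
    rw [div_lt_iff₀ (by positivity)]
    linarith
  have h := tendsto_setIntegral_of_monotone (μ := volume) (f := p)
    (s := fun n : ℕ => Ioc (1 / ((n : ℝ) + 1)) ((n : ℝ) + 1)) (fun n => measurableSet_Ioc) ?_ ?_
  · rw [hU] at h
    exact h.congr fun n => (intervalIntegral.integral_of_le (hle n)).symm
  · intro m n hmn
    have h1 : (m : ℝ) ≤ n := by exact_mod_cast hmn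
    exact Ioc_subset_Ioc (one_div_le_one_div_of_le (by positivity) (by linarith)) (by linarith)
  · rwa [hU]

theorem isPrim_wronskian (hf : IsRegular f) (hg : IsRegular g) {a b : ℝ} (ha : 0 < a)
    (hab : a ≤ b) : IsPrim (fun x => deriv f x * g x - f x * deriv g x)
      (fun x => f x * tau l q g x - tau l q f x * g x) a b := by
  refine (IsPrim.wronskian hab (hf.isPrim ha hab) (hf.isPrim_deriv ha hab) (hg.isPrim ha hab)
    (hg.isPrim_deriv ha hab)).congr_right hab fun x hx => ?_
  rw [deriv_deriv_eq l q, deriv_deriv_eq l q]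
  ring

/-- Green's identity. -/
theorem integral_wronskian_eq_zero (hq : Hypothesis l q) (hf : InMaximalDomain l q f)
    (hg : InMaximalDomain l q g)
    (h0 : Tendsto (fun x => f x * deriv g x - deriv f x * g x) (𝓝[>] 0) (𝓝 0)) :
    ∫ x, tau l q f x * g x ∂volPos = ∫ x, f x * tau l q g x ∂volPos := by
  have hi1 : Integrable (fun x => tau l q f x * g x) volPos := hf.2.2.integrable_mul hg.2.1
  have hi2 : Integrable (fun x => f x * tau l q g x) volPos := hf.2.1.integrable_mul hg.2.2
  have h1 := tendsto_intervalIntegral_volPos (hi1.sub hi2)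
  have ht : Tendsto (fun n : ℕ => (n : ℝ) + 1) atTop atTop :=
    tendsto_atTop_add_const_right _ _ tendsto_natCast_atTop_atTop
  have hs : Tendsto (fun n : ℕ => 1 / ((n : ℝ) + 1)) atTop (𝓝[>] 0) :=
    tendsto_nhdsWithin_iff.2 ⟨tendsto_one_div_add_atTop_nhds_zero_nat,
      Eventually.of_forall fun n => by rw [mem_Ioi]; positivity⟩
  have h2 := ((hq.limitPoint f g hf hg).comp ht).sub (h0.comp hs)
  rw [sub_zero] at h2
  have h3 := tendsto_nhds_unique (h1.congr fun n => ?_) h2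
  · rw [integral_sub' hi1 hi2] at h3
    exact sub_eq_zero.1 h3
  · have hle : 1 / ((n : ℝ) + 1) ≤ (n : ℝ) + 1 := by
      have : (0 : ℝ) ≤ n := n.cast_nonneg
      rw [div_le_iff₀ (by positivity)]
      nlinarith
    have h4 := (isPrim_wronskian (l := l) (q := q) hf.1 hg.1 (by positivity :
      0 < 1 / ((n : ℝ) + 1)) hle).sub_eq hle
    have h5 : ∫ x in (1 / ((n : ℝ) + 1))..((n : ℝ) + 1),
        ((fun x => tau l q f x * g x) - fun x => f x * tau l q g x) x
        = -∫ x in (1 / ((n : ℝ) + 1))..((n : ℝ) + 1),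
          (f x * tau l q g x - tau l q f x * g x) := by
      rw [← intervalIntegral.integral_neg]
      refine intervalIntegral.integral_congr fun x _ => ?_
      simp only [Pi.sub_apply]
      ring
    rw [h5, ← h4]
    simp only [Function.comp]
    ring

theorem inMaximalDomain_of_ae_eq {p : L2 × L2} (hf : IsRegular f) (h1 : f =ᵐ[volPos] p.1)
    (h2 : tau l q f =ᵐ[volPos] p.2) : InMaximalDomain l q f :=
  ⟨hf, (memLp_congr_ae h1).2 (Lp.memLp _), (memLp_congr_ae h2).2 (Lp.memLp _)⟩

theorem InMaximalDomain.memLp_tau (hf : InMaximalDomain l q f) :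
    MemLp (tau l q f) 2 (volume.restrict (Ioo 0 1)) :=
  hf.2.2.mono_measure (Measure.restrict_mono (fun _ hx => hx.1) le_rfl)

theorem Hypothesis.tendsto_wronskian (hq : Hypothesis l q) (hl : 0 ≤ l)
    (hf : InMaximalDomain l q f) (hbf : BoundaryCondition l f)
    (hg : InMaximalDomain l q g) (hbg : BoundaryCondition l g) :
    Tendsto (fun x => conj (f x) * deriv g x - conj (deriv f x) * g x) (𝓝[>] 0) (𝓝 0) := by
  obtain ⟨K, hK, hKf⟩ := hq.exists_linear_bound hl hf.1 hbf hf.2.1 hf.memLp_tau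
  obtain ⟨N, hN, hNg⟩ := hq.exists_linear_bound hl hg.1 hbg hg.2.1 hg.memLp_tau
  have h1 : Tendsto (fun x : ℝ => 2 * K * N * x) (𝓝[>] 0) (𝓝 0) := by
    have : Tendsto (fun x : ℝ => 2 * K * N * x) (𝓝 0) (𝓝 (2 * K * N * 0)) :=
      (continuous_const.mul continuous_id).tendsto 0
    rw [mul_zero] at this
    exact tendsto_nhdsWithin_of_tendsto_nhds this
  refine squeeze_zero_norm' ?_ h1
  filter_upwards [Ioo_mem_nhdsGT (show (0 : ℝ) < 1 by norm_num)] with x hx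
  have h2 := hKf x hx
  have h3 := hNg x hx
  have hx0 : 0 < x := hx.1
  refine (norm_sub_le _ _).trans ?_
  rw [norm_mul, norm_mul, RCLike.norm_conj, RCLike.norm_conj]
  have h4 := mul_le_mul h2.1 h3.2 (norm_nonneg _) (by positivity)
  have h5 := mul_le_mul h2.2 h3.1 (norm_nonneg _) (by positivity)
  linarith

/-- The boundary term in Green's identity vanishes at infinity by the limit point condition and at 0
by the linear bounds. -/
theorem Hypothesis.graphSymmetric (hq : Hypothesis l q) (hl : 0 ≤ l) :
    GraphSymmetric (H l q) := by
  intro p hp p' hp'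
  rw [graph_H] at hp hp'
  obtain ⟨f, hf, hbf, hf1, hf2⟩ := hp
  obtain ⟨g, hg, hbg, hg1, hg2⟩ := hp'
  have hf' := inMaximalDomain_of_ae_eq hf hf1 hf2
  have hg' := inMaximalDomain_of_ae_eq hg hg1 hg2
  have h := integral_wronskian_eq_zero hq hf'.conj hg' (by
    rw [deriv_conj]; exact hq.tendsto_wronskian hl hf' hbf hg' hbg)
  rw [tau_conj] at h
  rw [L2.inner_def, L2.inner_def]
  refine Eq.trans (integral_congr_ae ?_) (h.trans (integral_congr_ae ?_))
  · filter_upwards [hf2, hg1] with x h1 h2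
    rw [← h1, ← h2, RCLike.inner_apply, mul_comm]
  · filter_upwards [hf1, hg2] with x h1 h2
    rw [← h1, ← h2, RCLike.inner_apply, mul_comm]

/-- Weak solutions are regular, and for l ≥ 1/2 the boundary condition is vacuous. -/
theorem Hypothesis.adjointLE (hq : Hypothesis l q) (hl : 1 / 2 ≤ l) : AdjointLE (H l q) := by
  intro z w h
  rw [graph_H] at h ⊢
  obtain ⟨f, hf, h1, h2⟩ := exists_isRegular_of_inner_eq hq.locallyIntegrable h
  exact ⟨f, hf, fun h3 => absurd hl (not_le.2 h3), h1, h2⟩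

/-- If w is orthogonal to the domain, the zero function solves τ f = w weakly; its regular
representative vanishes identically, so w = 0. -/
theorem Hypothesis.denseDomain (hq : Hypothesis l q) : DenseDomain (H l q) := by
  intro w h
  rw [graph_H] at h
  obtain ⟨f, hf, h1, h2⟩ := exists_isRegular_of_inner_eq (z := 0) (w := w) hq.locallyIntegrable
    fun p hp => by rw [inner_zero_right, h p hp]
  have h3 : f =ᵐ[volPos] 0 := h1.trans (Lp.coeFn_zero ℂ 2 volPos)
  have h4 : EqOn f 0 (Ioi 0) :=
    MeasureTheory.Measure.eqOn_of_ae_eq h3 hf.1.continuousOn continuousOn_const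
      (by rw [interior_Ioi]; exact subset_closure)
  have hmem : ((0 : L2), w) ∈ graphH l q := by
    refine ⟨f, hf, fun _ => ?_, h1, h2⟩
    refine tendsto_const_nhds.congr' ?_
    filter_upwards [self_mem_nhdsWithin] with x hx
    have h5 : f =ᶠ[𝓝 x] fun _ => 0 := by
      filter_upwards [Ioi_mem_nhds (show (0 : ℝ) < x from hx)] with y hy using h4 hy
    rw [h5.deriv_eq, h4 hx]
    simp
  exact graphH_functional l q _ hmem rfl

theorem memLp_of_norm_le_maxKernelIntegral {p : ℝ → ℂ} {ft : ℝ → ℂ} {K : ℝ}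
    (hp : MemLp p 2 (volume.restrict (Ioo 0 1))) (hft : ContinuousOn ft (Ioo 0 1)) (hK : 0 ≤ K)
    (h : ∀ x ∈ Ioo (0 : ℝ) 1, ‖ft x‖ ≤ K * (1 + maxKernelIntegral (fun s => ‖p s‖) x)) :
    MemLp ft 2 (volume.restrict (Ioo 0 1)) ∧ ∃ C : ℝ, ∀ x ∈ Ioo (0 : ℝ) 1, ‖ft x‖ ≤ C / √x := by
  constructor
  · have h1 : MemLp (fun x => K * (1 + maxKernelIntegral (fun s => ‖p s‖) x)) 2
        (volume.restrict (Ioo 0 1)) :=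
      ((memLp_const (1 : ℝ)).add (memLp_maxKernelIntegral hp.norm fun _ => norm_nonneg _)).const_mul K
    refine h1.mono' (hft.aestronglyMeasurable measurableSet_Ioo)
      (ae_restrict_of_forall_mem measurableSet_Ioo h)
  · set c := 1 + (∫ s in Ioo (0 : ℝ) 1, ‖p s‖ ^ 2) / 2
    refine ⟨K * (1 + c), fun x hx => (h x hx).trans ?_⟩
    have h1 : maxKernelIntegral (fun s => ‖p s‖) x ≤ c / √x := maxKernelIntegral_le hp.norm hx.1
    have h2 : 1 ≤ 1 / √x := by
      rw [le_div_iff₀ (Real.sqrt_pos.2 hx.1), one_mul]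
      exact Real.sqrt_le_one.2 hx.2.le
    calc K * (1 + maxKernelIntegral (fun s => ‖p s‖) x) ≤ K * (1 / √x + c / √x) := by gcongr
      _ = K * (1 + c) / √x := by ring

/-- Decay at `0` of an element of the domain of `H` is better by two powers than that of its
image. -/
theorem Hypothesis.exists_repr_of_mem_graphH (hq : Hypothesis l q) {n : ℕ}
    (hn : (n : ℝ) + 2 ≤ l + 1) {u v : L2} (huv : (u, v) ∈ graphH l q) {p : ℝ → ℂ}
    (hp : MemLp p 2 (volume.restrict (Ioo 0 1)))
    (hvp : ∀ᵐ x ∂volume.restrict (Ioo (0 : ℝ) 1), v x = (x : ℂ) ^ n * p x) :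
    ∃ f ft fh : ℝ → ℂ, f =ᵐ[volPos] u ∧ ContinuousOn f (Ioo 0 1) ∧
      (∀ x ∈ Ioo (0 : ℝ) 1, f x = (x : ℂ) ^ (n + 2) * ft x) ∧
      (∀ x ∈ Ioo (0 : ℝ) 1, HasDerivAt f ((x : ℂ) ^ (n + 1) * fh x) x) ∧
      (MemLp ft 2 (volume.restrict (Ioo 0 1)) ∧ ∃ C : ℝ, ∀ x ∈ Ioo (0 : ℝ) 1, ‖ft x‖ ≤ C / √x) ∧
      (MemLp fh 2 (volume.restrict (Ioo 0 1)) ∧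
        ∃ C : ℝ, ∀ x ∈ Ioo (0 : ℝ) 1, ‖fh x‖ ≤ C / √x) := by
  obtain ⟨f, hf, hbf, hf1, hf2⟩ := huv
  have hf' := inMaximalDomain_of_ae_eq hf hf1 hf2
  have hl : 0 ≤ l := by
    have : (0 : ℝ) ≤ n := n.cast_nonneg
    linarith
  obtain ⟨K, hK, hKf⟩ := hq.exists_bound hl hf hbf hf'.2.1 hf'.memLp_tau
  have hsub : Ioo (0 : ℝ) 1 ⊆ Ioi 0 := fun x hx => hx.1
  have hgp : ∀ᵐ x ∂volume.restrict (Ioo (0 : ℝ) 1), tau l q f x = (x : ℂ) ^ n * p x := by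
    filter_upwards [hvp, ae_restrict_of_ae_restrict_of_subset hsub hf2] with x h1 h2
    rw [h2, ← h1]
  -- Both terms of the bound carry the factor x^(n+2): the homogeneous one because n + 2 ≤ l + 1,
  -- the other by `besselKernel_mul_pow_le`.
  have hw : ∀ x ∈ Ioo (0 : ℝ) 1, K * (x ^ (l + 1) + besselIntegral l (tau l q f) x)
      ≤ x ^ (n + 2) * (K * (1 + maxKernelIntegral (fun s => ‖p s‖) x)) := by
    intro x hx
    have h1 := besselIntegral_le_maxKernelIntegral hn (hp.integrable (by norm_num)) hgp hx.1
    have h2 : x ^ (l + 1) ≤ x ^ (n + 2) := by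
      rw [← Real.rpow_natCast x (n + 2)]
      exact Real.rpow_le_rpow_of_exponent_ge hx.1 hx.2.le (by push_cast; exact hn)
    calc _ ≤ K * (x ^ (n + 2) + x ^ (n + 2) * maxKernelIntegral (fun s => ‖p s‖) x) := by gcongr
      _ = _ := by ring
  have hpow : ∀ k : ℕ, ContinuousOn (fun x : ℝ => (x : ℂ) ^ k) (Ioo 0 1) := fun k =>
    (Complex.continuous_ofReal.pow k).continuousOn
  have hne : ∀ k : ℕ, ∀ x ∈ Ioo (0 : ℝ) 1, (x : ℂ) ^ k ≠ 0 := fun k x hx =>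
    pow_ne_zero _ (Complex.ofReal_ne_zero.2 hx.1.ne')
  have hnorm : ∀ k : ℕ, ∀ x ∈ Ioo (0 : ℝ) 1, ‖(x : ℂ) ^ k‖ = x ^ k := fun k x hx => by
    rw [norm_pow, Complex.norm_real, Real.norm_of_nonneg hx.1.le]
  refine ⟨f, fun x => f x / (x : ℂ) ^ (n + 2), fun x => deriv f x / (x : ℂ) ^ (n + 1), hf1,
    hf.1.continuousOn.mono hsub, fun x hx => ?_, fun x hx => ?_,
    memLp_of_norm_le_maxKernelIntegral hp
      ((hf.1.continuousOn.mono hsub).div (hpow _) (hne _)) hK fun x hx => ?_,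
    memLp_of_norm_le_maxKernelIntegral hp
      ((hf.continuousOn_deriv.mono hsub).div (hpow _) (hne _)) hK fun x hx => ?_⟩
  · have := hne (n + 2) x hx
    field_simp
  · have := hne (n + 1) x hx
    rw [mul_div_cancel₀ _ this]
    exact hf.hasDerivAt hx.1
  · have hx0 := hx.1
    rw [norm_div, hnorm _ x hx, div_le_iff₀ (by positivity), mul_comm]
    exact (hKf x hx).1.trans (hw x hx)
  · have hx0 := hx.1
    rw [norm_div, hnorm _ x hx, div_le_iff₀ (by positivity)]
    have h1 := (hKf x hx).2.trans (hw x hx)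
    rw [pow_succ' x (n + 1), mul_assoc] at h1
    rw [mul_comm (K * _)]
    exact le_of_mul_le_mul_left h1 hx0

end Operator

/-! ### Cutting off near 0. -/

section Cutoff

variable {l : ℝ} {q : ℝ → ℝ} {f g : ℝ → ℂ}

/-- A smooth function with values in `[0, 1]` which is `0` on `(-∞, 1]` and `1` on `[2, ∞)`. -/
def cutoff (x : ℝ) : ℝ := Real.smoothTransition (x - 1)

theorem contDiff_cutoff : ContDiff ℝ (1 + 1) cutoff :=
  Real.smoothTransition.contDiff.comp (contDiff_id.sub contDiff_const)

theorem contDiff_deriv_cutoff : ContDiff ℝ 1 (deriv cutoff) :=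
  (contDiff_succ_iff_deriv.1 contDiff_cutoff).2.2

theorem hasDerivAt_cutoff (x : ℝ) : HasDerivAt cutoff (deriv cutoff x) x :=
  ((contDiff_cutoff.differentiable (by norm_num)) x).hasDerivAt

theorem hasDerivAt_deriv_cutoff (x : ℝ) :
    HasDerivAt (deriv cutoff) (deriv (deriv cutoff) x) x :=
  ((contDiff_deriv_cutoff.differentiable (by norm_num)) x).hasDerivAt

theorem continuous_cutoff : Continuous cutoff := contDiff_cutoff.continuous

theorem continuous_deriv_cutoff : Continuous (deriv cutoff) := contDiff_deriv_cutoff.continuous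

theorem continuous_deriv_deriv_cutoff : Continuous (deriv (deriv cutoff)) :=
  contDiff_deriv_cutoff.continuous_deriv (by norm_num)

theorem cutoff_of_le {x : ℝ} (hx : x ≤ 1) : cutoff x = 0 :=
  Real.smoothTransition.zero_of_nonpos (by linarith)

theorem cutoff_of_ge {x : ℝ} (hx : 2 ≤ x) : cutoff x = 1 :=
  Real.smoothTransition.one_of_one_le (by linarith)

theorem cutoff_nonneg (x : ℝ) : 0 ≤ cutoff x := Real.smoothTransition.nonneg _

theorem cutoff_le_one (x : ℝ) : cutoff x ≤ 1 := Real.smoothTransition.le_one _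

theorem deriv_cutoff_eq_zero {x : ℝ} (hx : x ∉ Icc (1 : ℝ) 2) : deriv cutoff x = 0 := by
  rcases not_and_or.1 hx with h | h
  · have : cutoff =ᶠ[𝓝 x] fun _ => 0 := by
      filter_upwards [Iio_mem_nhds (not_le.1 h)] with y hy using cutoff_of_le (le_of_lt hy)
    rw [this.deriv_eq, deriv_const]
  · have : cutoff =ᶠ[𝓝 x] fun _ => 1 := by
      filter_upwards [Ioi_mem_nhds (not_le.1 h)] with y hy using cutoff_of_ge (le_of_lt hy)
    rw [this.deriv_eq, deriv_const]

theorem deriv_deriv_cutoff_eq_zero {x : ℝ} (hx : x ∉ Icc (1 : ℝ) 2) :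
    deriv (deriv cutoff) x = 0 := by
  have : deriv cutoff =ᶠ[𝓝 x] fun _ => 0 := by
    filter_upwards [isClosed_Icc.isOpen_compl.mem_nhds hx] with y hy using deriv_cutoff_eq_zero hy
  rw [this.deriv_eq, deriv_const]

theorem exists_bound_cutoff : ∃ M : ℝ, 0 ≤ M ∧ ∀ x, |deriv cutoff x| ≤ M ∧
    |deriv (deriv cutoff) x| ≤ M := by
  obtain ⟨M, hM⟩ := (isCompact_Icc (a := (1 : ℝ)) (b := 2)).exists_bound_of_continuousOn
    continuous_deriv_cutoff.continuousOn
  obtain ⟨N, hN⟩ := (isCompact_Icc (a := (1 : ℝ)) (b := 2)).exists_bound_of_continuousOn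
    continuous_deriv_deriv_cutoff.continuousOn
  refine ⟨max 0 (max M N), le_max_left _ _, fun x => ?_⟩
  by_cases hx : x ∈ Icc (1 : ℝ) 2
  · exact ⟨(hM x hx).trans ((le_max_left _ _).trans (le_max_right _ _)),
      (hN x hx).trans ((le_max_right _ _).trans (le_max_right _ _))⟩
  · rw [deriv_cutoff_eq_zero hx, deriv_deriv_cutoff_eq_zero hx, abs_zero]
    exact ⟨le_max_left _ _, le_max_left _ _⟩

theorem isPrim_cutoff {a b : ℝ} (hab : a ≤ b) :
    IsPrim (fun x => (cutoff x : ℂ)) (fun x => ((deriv cutoff x : ℝ) : ℂ)) a b :=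
  isPrim_of_hasDerivAt (fun x _ => (hasDerivAt_cutoff x).ofReal_comp)
    (Complex.continuous_ofReal.comp continuous_deriv_cutoff).continuousOn hab

theorem isPrim_deriv_cutoff {a b : ℝ} (hab : a ≤ b) :
    IsPrim (fun x => ((deriv cutoff x : ℝ) : ℂ)) (fun x => ((deriv (deriv cutoff) x : ℝ) : ℂ)) a b :=
  isPrim_of_hasDerivAt (fun x _ => (hasDerivAt_deriv_cutoff x).ofReal_comp)
    (Complex.continuous_ofReal.comp continuous_deriv_deriv_cutoff).continuousOn hab

/-- The product of `f` with the cutoff function. -/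
def cutoffMul (f : ℝ → ℂ) (x : ℝ) : ℂ := cutoff x * f x

theorem IsRegular.hasDerivAt_cutoffMul (hf : IsRegular f) {x : ℝ} (hx : 0 < x) :
    HasDerivAt (cutoffMul f) (deriv cutoff x * f x + cutoff x * deriv f x) x :=
  (hasDerivAt_cutoff x).ofReal_comp.mul (hf.hasDerivAt hx)

theorem IsRegular.isPrim_deriv_cutoffMul (hf : IsRegular f) {a b : ℝ} (ha : 0 < a) (hab : a ≤ b) :
    IsPrim (fun x => deriv cutoff x * f x + cutoff x * deriv f x)
      (fun x => deriv (deriv cutoff) x * f x + 2 * (deriv cutoff x * deriv f x)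
        + cutoff x * deriv (deriv f) x) a b := by
  have h1 := ((isPrim_deriv_cutoff hab).mul (hf.isPrim ha hab) hab).add_const_mul
    ((isPrim_cutoff hab).mul (hf.isPrim_deriv ha hab) hab) 1 hab
  exact (h1.congr_right hab fun x _ => by ring).congr_left fun x _ => by ring

theorem IsRegular.cutoffMul (hf : IsRegular f) : IsRegular (cutoffMul f) :=
  IsRegular.of_isPrim (fun _ hx => hf.hasDerivAt_cutoffMul hx)
    fun _ _ ha hab => hf.isPrim_deriv_cutoffMul ha hab

theorem IsRegular.tau_cutoffMul (hf : IsRegular f) : tau l q (PerturbedBessel.cutoffMul f)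
    =ᵐ[volPos] fun x => cutoff x * tau l q f x - 2 * (deriv cutoff x * deriv f x)
      - deriv (deriv cutoff) x * f x := by
  filter_upwards [deriv_deriv_ae_eq (fun _ hx => hf.hasDerivAt_cutoffMul hx)
    fun _ _ ha hab => hf.isPrim_deriv_cutoffMul ha hab] with x hx
  rw [tau, hx, tau, PerturbedBessel.cutoffMul]
  ring

theorem memLp_of_bounded_mul {χ : ℝ → ℝ} (hχ : Continuous χ) {M : ℝ} (hM : ∀ x, |χ x| ≤ M)
    (hf : MemLp f 2 volPos) : MemLp (fun x => (χ x : ℂ) * f x) 2 volPos := by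
  refine hf.of_le_mul (c := M)
    ((Complex.continuous_ofReal.comp hχ).aestronglyMeasurable.mul hf.1)
    (Eventually.of_forall fun x => ?_)
  rw [norm_mul, Complex.norm_real]
  exact mul_le_mul_of_nonneg_right (hM x) (norm_nonneg _)

/-- No global control of f' is available; the derivative of the cutoff is supported in [1, 2], where
f' is continuous. -/
theorem IsRegular.memLp_deriv_cutoff_mul (hf : IsRegular f) :
    MemLp (fun x => ((deriv cutoff x : ℝ) : ℂ) * deriv f x) 2 volPos := by
  have h1 : (fun x => ((deriv cutoff x : ℝ) : ℂ) * deriv f x)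
      = (Icc (1 : ℝ) 2).indicator (fun x => ((deriv cutoff x : ℝ) : ℂ) * deriv f x) := by
    funext x
    by_cases hx : x ∈ Icc (1 : ℝ) 2
    · rw [indicator_of_mem hx]
    · rw [indicator_of_notMem hx, deriv_cutoff_eq_zero hx, Complex.ofReal_zero, zero_mul]
  have hsub : Icc (1 : ℝ) 2 ⊆ Ioi 0 := fun x hx => one_pos.trans_le hx.1
  rw [h1, memLp_indicator_iff_restrict measurableSet_Icc,
    Measure.restrict_restrict measurableSet_Icc, inter_eq_self_of_subset_left hsub,
    ← restrict_Ioc_eq_restrict_Icc]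
  exact memLp_of_continuousOn_Icc ((Complex.continuous_ofReal.comp
    continuous_deriv_cutoff).continuousOn.mul (hf.continuousOn_deriv.mono hsub))

theorem InMaximalDomain.cutoffMul (hf : InMaximalDomain l q f) :
    InMaximalDomain l q (cutoffMul f) := by
  obtain ⟨M, -, hM⟩ := exists_bound_cutoff
  have h1 : ∀ x, |cutoff x| ≤ 1 := fun x => by
    rw [abs_of_nonneg (cutoff_nonneg x)]; exact cutoff_le_one x
  refine ⟨hf.1.cutoffMul, memLp_of_bounded_mul continuous_cutoff h1 hf.2.1,
    (memLp_congr_ae hf.1.tau_cutoffMul).2 ?_⟩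
  exact ((memLp_of_bounded_mul continuous_cutoff h1 hf.2.2).sub
    (hf.1.memLp_deriv_cutoff_mul.const_mul 2)).sub
    (memLp_of_bounded_mul continuous_deriv_deriv_cutoff (fun x => (hM x).2) hf.2.1)

theorem boundaryCondition_cutoffMul (l : ℝ) (f : ℝ → ℂ) :
    BoundaryCondition l (cutoffMul f) := fun _ => by
  refine tendsto_const_nhds.congr' ?_
  filter_upwards [Ioo_mem_nhdsGT (show (0 : ℝ) < 1 by norm_num)] with x hx
  have h0 : ∀ y < 1, cutoffMul f y = 0 := fun y hy => by
    rw [cutoffMul, cutoff_of_le hy.le, Complex.ofReal_zero, zero_mul]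
  have h5 : cutoffMul f =ᶠ[𝓝 x] fun _ => 0 := by
    filter_upwards [Iio_mem_nhds hx.2] with y hy using h0 y hy
  rw [h5.deriv_eq, h0 x hx.2]
  simp

theorem re_inner_eq_integral (u v : L2) :
    (inner ℂ u v).re = ∫ x, (conj (u x) * v x).re ∂volPos := by
  have h1 : Integrable (fun x => inner ℂ (u x) (v x)) volPos := L2.integrable_inner u v
  rw [L2.inner_def]
  refine (integral_re h1).symm.trans (integral_congr_ae (Eventually.of_forall fun x => ?_))
  simp only [RCLike.inner_apply]
  rw [mul_comm]
  rfl

theorem norm_sq_eq_integral (u : L2) : ‖u‖ ^ 2 = ∫ x, ‖u x‖ ^ 2 ∂volPos := by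
  rw [← inner_self_eq_norm_sq (𝕜 := ℂ)]
  refine (re_inner_eq_integral u u).trans (integral_congr_ae (Eventually.of_forall fun x => ?_))
  simp only
  rw [mul_comm, Complex.mul_conj, Complex.ofReal_re, Complex.normSq_eq_norm_sq]

/-- The lower bound of `H` gives a lower bound for the form of `τ` on functions cut off near `0`. -/
theorem neg_mul_le_integral_cutoffMul {c : ℝ}
    (hc : ∀ u : (H l q).domain, c * ‖(u : L2)‖ ^ 2 ≤ (inner ℂ (u : L2) (H l q u)).re)
    (hf : InMaximalDomain l q f) :
    -|c| * ∫ x, ‖f x‖ ^ 2 ∂volPos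
      ≤ ∫ x, (conj (cutoffMul f x) * tau l q (cutoffMul f) x).re ∂volPos := by
  have hg := hf.cutoffMul
  set u := hg.2.1.toLp _ with hu
  set v := hg.2.2.toLp _ with hv
  have hmem : (u, v) ∈ (H l q).graph := by
    rw [graph_H]
    exact ⟨_, hg.1, boundaryCondition_cutoffMul l f, (hg.2.1.coeFn_toLp).symm,
      (hg.2.2.coeFn_toLp).symm⟩
  obtain ⟨w, hw1, hw2⟩ := (LinearPMap.mem_graph_iff _).1 hmem
  have h1 := hc w
  simp only at hw1 hw2
  rw [hw1, hw2, norm_sq_eq_integral, re_inner_eq_integral] at h1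
  have h2 : ∫ x, (conj (u x) * v x).re ∂volPos
      = ∫ x, (conj (cutoffMul f x) * tau l q (cutoffMul f) x).re ∂volPos := by
    refine integral_congr_ae ?_
    filter_upwards [hg.2.1.coeFn_toLp, hg.2.2.coeFn_toLp] with x h3 h4
    rw [hu, hv, h3, h4]
  rw [h2] at h1
  refine le_trans ?_ h1
  have h3 : ∫ x, ‖u x‖ ^ 2 ∂volPos ≤ ∫ x, ‖f x‖ ^ 2 ∂volPos := by
    refine integral_mono_ae ((Lp.memLp u).integrable_norm_pow (by norm_num))
      (hf.2.1.integrable_norm_pow (by norm_num)) ?_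
    filter_upwards [hg.2.1.coeFn_toLp] with x h3
    rw [hu, h3, cutoffMul, norm_mul, Complex.norm_real, Real.norm_of_nonneg (cutoff_nonneg x)]
    have := mul_le_of_le_one_left (norm_nonneg (f x)) (cutoff_le_one x)
    have h4 := cutoff_nonneg x
    gcongr
  have h4 : 0 ≤ ∫ x, ‖u x‖ ^ 2 ∂volPos := integral_nonneg fun _ => by positivity
  have h5 := neg_abs_le c
  have h6 := abs_nonneg c
  nlinarith

end Cutoff

/-! ### Localized kinetic energy and form smallness of the potential. -/

section FormEstimate

variable {l : ℝ} {q : ℝ → ℝ} {f : ℝ → ℂ}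

/-- The complementary cutoff function: `1` on `(-∞, 1]`, `0` on `[2, ∞)`. -/
def cocutoff (x : ℝ) : ℝ := 1 - cutoff x ^ 2

theorem cocutoff_nonneg (x : ℝ) : 0 ≤ cocutoff x := by
  have h1 := cutoff_nonneg x
  have h2 := cutoff_le_one x
  rw [cocutoff]; nlinarith

theorem cocutoff_le_one (x : ℝ) : cocutoff x ≤ 1 := by
  rw [cocutoff]; nlinarith [sq_nonneg (cutoff x)]

theorem cocutoff_of_le {x : ℝ} (hx : x ≤ 1) : cocutoff x = 1 := by
  rw [cocutoff, cutoff_of_le hx]; norm_num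

theorem cocutoff_of_ge {x : ℝ} (hx : 2 ≤ x) : cocutoff x = 0 := by
  rw [cocutoff, cutoff_of_ge hx]; norm_num

theorem continuous_cocutoff : Continuous cocutoff := continuous_const.sub (continuous_cutoff.pow 2)

theorem hasDerivAt_cocutoff (x : ℝ) :
    HasDerivAt cocutoff (-(2 * cutoff x * deriv cutoff x)) x := by
  refine (((hasDerivAt_cutoff x).pow 2).const_sub 1).congr_deriv ?_
  ring

theorem isPrim_cocutoff {a b : ℝ} (hab : a ≤ b) :
    IsPrim (fun x => (cocutoff x : ℂ)) (fun x => ((-(2 * cutoff x * deriv cutoff x) : ℝ) : ℂ))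
      a b :=
  isPrim_of_hasDerivAt (fun x _ => (hasDerivAt_cocutoff x).ofReal_comp)
    (Complex.continuous_ofReal.comp
      ((continuous_const.mul continuous_cutoff).mul continuous_deriv_cutoff).neg).continuousOn hab

theorem exists_linear_bound_Ioc (hf : IsRegular f)
    (h : ∃ K, 0 ≤ K ∧ ∀ x ∈ Ioo (0 : ℝ) 1, ‖f x‖ ≤ K * x ∧ ‖deriv f x‖ ≤ K) :
    ∃ K, 0 ≤ K ∧ ∀ x ∈ Ioc (0 : ℝ) 2, ‖f x‖ ≤ K * x ∧ ‖deriv f x‖ ≤ K := by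
  obtain ⟨K, hK, hKf⟩ := h
  have hsub : Icc (1 : ℝ) 2 ⊆ Ioi 0 := fun x hx => one_pos.trans_le hx.1
  obtain ⟨M, hM⟩ := isCompact_Icc.exists_bound_of_continuousOn (hf.1.continuousOn.mono hsub)
  obtain ⟨N, hN⟩ := isCompact_Icc.exists_bound_of_continuousOn (hf.continuousOn_deriv.mono hsub)
  refine ⟨max K (max M N), hK.trans (le_max_left _ _), fun x hx => ?_⟩
  have hx0 : 0 < x := hx.1
  rcases lt_or_ge x 1 with h1 | h1
  · have h2 := hKf x ⟨hx0, h1⟩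
    have h3 : K ≤ max K (max M N) := le_max_left _ _
    exact ⟨h2.1.trans (by gcongr), h2.2.trans h3⟩
  · have h3 : M ≤ max K (max M N) := (le_max_left _ _).trans (le_max_right _ _)
    have h4 : N ≤ max K (max M N) := (le_max_right _ _).trans (le_max_right _ _)
    have h5 := hM x ⟨h1, hx.2⟩
    have h6 : 0 ≤ max K (max M N) := hK.trans (le_max_left _ _)
    exact ⟨by nlinarith, (hN x ⟨h1, hx.2⟩).trans h4⟩

theorem integrableOn_of_continuousOn_bound {E : Type*} [NormedAddCommGroup E] {g : ℝ → E}
    {a b C : ℝ} (hg : ContinuousOn g (Ioc a b)) (hC : ∀ x ∈ Ioc a b, ‖g x‖ ≤ C) :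
    IntegrableOn g (Ioc a b) :=
  IntegrableOn.of_bound (by simp) (hg.aestronglyMeasurable measurableSet_Ioc) C
    (ae_restrict_of_forall_mem measurableSet_Ioc hC)

/-- Cauchy-Schwarz, obtained from the nonnegative variance of p on (0, x]. -/
theorem sq_setIntegral_le {p : ℝ → ℝ} {x : ℝ} (hx : 0 < x) (hp : IntegrableOn p (Ioc 0 x))
    (hp2 : IntegrableOn (fun t => p t ^ 2) (Ioc 0 x)) :
    (∫ t in Ioc 0 x, p t) ^ 2 ≤ x * ∫ t in Ioc 0 x, p t ^ 2 := by
  set I := ∫ t in Ioc 0 x, p t with hI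
  have h1 : 0 ≤ ∫ t in Ioc 0 x, (p t - I / x) ^ 2 := integral_nonneg fun _ => sq_nonneg _
  have h2 : ∫ t in Ioc 0 x, (p t - I / x) ^ 2
      = ∫ t in Ioc 0 x, (p t ^ 2 - 2 * (I / x) * p t + (I / x) ^ 2) := by
    congr 1; funext t; ring
  have hpI : IntegrableOn (fun t => 2 * (I / x) * p t) (Ioc 0 x) := hp.const_mul _
  have hsub : IntegrableOn (fun t => p t ^ 2 - 2 * (I / x) * p t) (Ioc 0 x) := hp2.sub hpI
  rw [h2, integral_add hsub (integrableOn_const (by simp)),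
    integral_sub hp2 hpI, integral_const_mul, ← hI, setIntegral_const] at h1
  simp only [Real.volume_real_Ioc_of_le hx.le, sub_zero, smul_eq_mul] at h1
  have h3 : x * ((∫ t in Ioc 0 x, p t ^ 2) - 2 * (I / x) * I + x * (I / x) ^ 2)
      = x * (∫ t in Ioc 0 x, p t ^ 2) - I ^ 2 := by field_simp; ring
  have h4 := mul_nonneg hx.le h1
  rw [h3] at h4
  linarith

/-- The localized kinetic energy of `f`. -/
def kinetic (f : ℝ → ℂ) : ℝ := ∫ x in Ioc (0 : ℝ) 2, cocutoff x * ‖deriv f x‖ ^ 2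

theorem kinetic_nonneg : 0 ≤ kinetic f :=
  integral_nonneg fun t => mul_nonneg (cocutoff_nonneg t) (by positivity)

theorem Ioc_subset_Ioi_zero {a b : ℝ} (ha : 0 ≤ a) : Ioc a b ⊆ Ioi 0 := fun _ hx => ha.trans_lt hx.1

section Bounded

variable (hf : IsRegular f) {K : ℝ}
  (hK : ∀ x ∈ Ioc (0 : ℝ) 2, ‖f x‖ ≤ K * x ∧ ‖deriv f x‖ ≤ K)

include hf hK

theorem integrableOn_kinetic :
    IntegrableOn (fun x => cocutoff x * ‖deriv f x‖ ^ 2) (Ioc 0 2) := by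
  refine integrableOn_of_continuousOn_bound (C := 1 * K ^ 2) (continuous_cocutoff.continuousOn.mul
    ((hf.continuousOn_deriv.mono (Ioc_subset_Ioi_zero le_rfl)).norm.pow 2)) fun x hx => ?_
  rw [norm_mul, norm_pow, norm_norm, Real.norm_of_nonneg (cocutoff_nonneg x)]
  have h1 := (hK x hx).2
  have h2 := cocutoff_le_one x
  gcongr

/-- The function vanishes at 0, so |f(x)| ≤ ∫₀ˣ |f'|, and Cauchy-Schwarz applies; the weight in the
kinetic energy equals 1 on (0, 1]. -/
theorem norm_sq_le_mul_kinetic {x : ℝ} (hx : x ∈ Ioc (0 : ℝ) 1) :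
    ‖f x‖ ^ 2 ≤ x * kinetic f := by
  have hx0 : 0 < x := hx.1
  have hx2 : x ≤ 2 := hx.2.trans (by norm_num)
  have hsub : Ioc 0 x ⊆ Ioc (0 : ℝ) 2 := Ioc_subset_Ioc_right hx2
  have hc := hf.continuousOn_deriv.mono (Ioc_subset_Ioi_zero (a := 0) (b := x) le_rfl)
  have hi : IntegrableOn (fun t => ‖deriv f t‖) (Ioc 0 x) :=
    (integrableOn_of_continuousOn_bound hc fun t ht => (hK t (hsub ht)).2).norm
  have hi2 : IntegrableOn (fun t => ‖deriv f t‖ ^ 2) (Ioc 0 x) :=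
    integrableOn_of_continuousOn_bound (hc.norm.pow 2) (C := K ^ 2) fun t ht => by
      rw [norm_pow, norm_norm]
      have := (hK t (hsub ht)).2
      gcongr
  have h1 : ‖f x‖ ≤ ∫ t in Ioc 0 x, ‖deriv f t‖ := by
    have h2 : Tendsto (fun y : ℝ => K * y + ∫ t in Ioc 0 x, ‖deriv f t‖) (𝓝[>] 0)
        (𝓝 (K * 0 + ∫ t in Ioc 0 x, ‖deriv f t‖)) :=
      tendsto_nhdsWithin_of_tendsto_nhds (Continuous.tendsto (by fun_prop) 0)
    rw [mul_zero, zero_add] at h2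
    refine ge_of_tendsto h2 ?_
    filter_upwards [Ioo_mem_nhdsGT hx0] with y hy
    have h3 := (hf.isPrim hy.1 hy.2.le).sub_eq hy.2.le
    have h4 := intervalIntegral.norm_integral_le_integral_norm (f := deriv f) (μ := volume) hy.2.le
    rw [← h3, intervalIntegral.integral_of_le hy.2.le] at h4
    have h5 : ∫ t in Ioc y x, ‖deriv f t‖ ≤ ∫ t in Ioc 0 x, ‖deriv f t‖ :=
      setIntegral_mono_set hi (Eventually.of_forall fun _ => norm_nonneg _)
        (Ioc_subset_Ioc_left hy.1.le).eventuallyLE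
    have h6 := (hK y ⟨hy.1, hy.2.le.trans hx2⟩).1
    have h7 := norm_sub_norm_le (f x) (f y)
    linarith
  have h2 : ∫ t in Ioc 0 x, ‖deriv f t‖ ^ 2 ≤ kinetic f := by
    have h3 : ∫ t in Ioc 0 x, ‖deriv f t‖ ^ 2
        = ∫ t in Ioc 0 x, cocutoff t * ‖deriv f t‖ ^ 2 :=
      setIntegral_congr_fun measurableSet_Ioc fun t ht => by
        simp only [cocutoff_of_le (ht.2.trans hx.2), one_mul]
    rw [h3]
    exact setIntegral_mono_set (integrableOn_kinetic hf hK) (Eventually.of_forall fun t =>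
      mul_nonneg (cocutoff_nonneg t) (by positivity)) hsub.eventuallyLE
  calc ‖f x‖ ^ 2 ≤ (∫ t in Ioc 0 x, ‖deriv f t‖) ^ 2 := by gcongr
    _ ≤ _ := sq_setIntegral_le hx0 hi hi2
    _ ≤ _ := by gcongr

/-- The derivative of `cocutoff` · |f|² is integrated from x to 2, where the weight vanishes, with
2|f||f'| ≤ ε|f'|² + |f|²/ε. -/
theorem cocutoff_mul_norm_sq_le {M : ℝ} (hM : ∀ x, |deriv cutoff x| ≤ M) (hf2 : MemLp f 2 volPos)
    {ε : ℝ} (hε : 0 < ε) {x : ℝ} (hx : x ∈ Ioc (0 : ℝ) 2) :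
    cocutoff x * ‖f x‖ ^ 2 ≤ ε * kinetic f + (2 * M + 1 / ε) * ∫ x, ‖f x‖ ^ 2 ∂volPos := by
  have hN : Integrable (fun x => ‖f x‖ ^ 2) volPos := hf2.integrable_norm_pow (by norm_num)
  have hM0 : 0 ≤ M := (abs_nonneg _).trans (hM 0)
  have hsub : Ioc x 2 ⊆ Ioc (0 : ℝ) 2 := Ioc_subset_Ioc_left hx.1.le
  have hp := (isPrim_cocutoff hx.2).mul (((hf.isPrim hx.1 hx.2).conj hx.2).mul
    (hf.isPrim hx.1 hx.2) hx.2) hx.2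
  have h1 := hp.sub_eq hx.2
  have h2 := intervalIntegral.norm_integral_le_integral_norm (μ := volume) hx.2 (f := fun x =>
    ((-(2 * cutoff x * deriv cutoff x) : ℝ) : ℂ) * (conj (f x) * f x)
      + cocutoff x * (conj (deriv f x) * f x + conj (f x) * deriv f x))
  rw [← h1, intervalIntegral.integral_of_le hx.2, cocutoff_of_ge le_rfl, Complex.ofReal_zero,
    zero_mul, zero_sub, norm_neg, norm_mul, norm_mul, Complex.norm_real, RCLike.norm_conj,
    Real.norm_of_nonneg (cocutoff_nonneg x)] at h2
  have hA := integrableOn_kinetic hf hK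
  have hNs := hN.mono_measure (Measure.restrict_mono (Ioc_subset_Ioi_zero (b := 2) le_rfl) le_rfl)
  have h3 : ∫ t in Ioc x 2, ‖((-(2 * cutoff t * deriv cutoff t) : ℝ) : ℂ) * (conj (f t) * f t)
      + cocutoff t * (conj (deriv f t) * f t + conj (f t) * deriv f t)‖
      ≤ ∫ t in Ioc x 2, (ε * (cocutoff t * ‖deriv f t‖ ^ 2) + (2 * M + 1 / ε) * ‖f t‖ ^ 2) := by
    refine setIntegral_mono_on hp.1.1.norm (((hA.mono_set hsub).const_mul _).add
      ((hNs.mono_measure (Measure.restrict_mono hsub le_rfl)).const_mul _)) measurableSet_Ioc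
      fun t _ => ?_
    have hφ0 := cocutoff_nonneg t
    have hφ1 := cocutoff_le_one t
    refine (norm_add_le _ _).trans ?_
    have e1 : ‖((-(2 * cutoff t * deriv cutoff t) : ℝ) : ℂ) * (conj (f t) * f t)‖
        ≤ 2 * M * ‖f t‖ ^ 2 := by
      rw [norm_mul, norm_mul, Complex.norm_real, RCLike.norm_conj, norm_neg, norm_mul, norm_mul,
        Real.norm_of_nonneg (cutoff_nonneg t), Real.norm_eq_abs, Real.norm_eq_abs]
      have e2 := hM t
      have e3 := cutoff_le_one t
      have e4 := cutoff_nonneg t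
      have e5 : |(2 : ℝ)| * cutoff t * |deriv cutoff t| ≤ 2 * 1 * M := by
        rw [abs_of_pos two_pos]; gcongr
      nlinarith [mul_le_mul_of_nonneg_right e5 (mul_nonneg (norm_nonneg (f t)) (norm_nonneg (f t)))]
    have e2 : ‖(cocutoff t : ℂ) * (conj (deriv f t) * f t + conj (f t) * deriv f t)‖
        ≤ cocutoff t * (2 * (‖f t‖ * ‖deriv f t‖)) := by
      rw [norm_mul, Complex.norm_real, Real.norm_of_nonneg hφ0]
      refine mul_le_mul_of_nonneg_left ((norm_add_le _ _).trans (le_of_eq ?_)) hφ0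
      rw [norm_mul, norm_mul, RCLike.norm_conj, RCLike.norm_conj]; ring
    have e3 : 2 * (‖f t‖ * ‖deriv f t‖) ≤ ε * ‖deriv f t‖ ^ 2 + 1 / ε * ‖f t‖ ^ 2 := by
      have : ε * ‖deriv f t‖ ^ 2 + 1 / ε * ‖f t‖ ^ 2 - 2 * (‖f t‖ * ‖deriv f t‖)
          = 1 / ε * (ε * ‖deriv f t‖ - ‖f t‖) ^ 2 := by field_simp; ring
      have h0 : 0 ≤ 1 / ε * (ε * ‖deriv f t‖ - ‖f t‖) ^ 2 := by positivity
      linarith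
    have e4 := mul_le_mul_of_nonneg_left e3 hφ0
    have e5 : cocutoff t * (1 / ε * ‖f t‖ ^ 2) ≤ 1 / ε * ‖f t‖ ^ 2 :=
      mul_le_of_le_one_left (by positivity) hφ1
    linarith
  rw [integral_add ((hA.mono_set hsub).const_mul _)
    ((hNs.mono_measure (Measure.restrict_mono hsub le_rfl)).const_mul _), integral_const_mul,
    integral_const_mul] at h3
  have h4 : ∫ t in Ioc x 2, cocutoff t * ‖deriv f t‖ ^ 2 ≤ kinetic f :=
    setIntegral_mono_set hA (Eventually.of_forall fun t =>
      mul_nonneg (cocutoff_nonneg t) (by positivity)) hsub.eventuallyLE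
  have h5 : ∫ t in Ioc x 2, ‖f t‖ ^ 2 ≤ ∫ x, ‖f x‖ ^ 2 ∂volPos :=
    setIntegral_mono_set hN (Eventually.of_forall fun t => by simp only [Pi.zero_apply]; positivity)
      (Ioc_subset_Ioi_zero hx.1.le).eventuallyLE
  have h6 := mul_le_mul_of_nonneg_left h4 hε.le
  have h7 := mul_le_mul_of_nonneg_left h5 (by positivity : 0 ≤ 2 * M + 1 / ε)
  rw [sq]
  linarith

end Bounded

theorem Hypothesis.integrableOn_mul_abs_Ioc (hq : Hypothesis l q) (hl : 0 ≤ l) :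
    IntegrableOn (fun s => s * |q s|) (Ioc 0 2) := by
  have h1 := hq.integrableOn_mul_abs (by linarith)
  have h2 : IntegrableOn q (Icc 1 2) := hq.locallyIntegrable.integrableOn_compact_subset
    (fun x hx => one_pos.trans_le hx.1) isCompact_Icc
  have h3 : IntegrableOn (fun s => s * |q s|) (Icc 1 2) :=
    IntegrableOn.continuousOn_mul continuousOn_id h2.norm isCompact_Icc
  rw [← Ioo_union_Icc_eq_Ioc one_pos one_le_two]
  exact h1.union h3

/-- The potential `q` is form bounded with small bound with respect to the kinetic energy. -/
theorem Hypothesis.exists_potential_bound (hq : Hypothesis l q) (hl : 0 ≤ l) :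
    ∃ C, 0 ≤ C ∧ ∀ f : ℝ → ℂ, IsRegular f → MemLp f 2 volPos →
      (∃ K, 0 ≤ K ∧ ∀ x ∈ Ioc (0 : ℝ) 2, ‖f x‖ ≤ K * x ∧ ‖deriv f x‖ ≤ K) →
      IntegrableOn (fun x => cocutoff x * (q x * ‖f x‖ ^ 2)) (Ioc 0 2) ∧
      -(1 / 2 * kinetic f + C * ∫ x, ‖f x‖ ^ 2 ∂volPos)
        ≤ ∫ x in Ioc (0 : ℝ) 2, cocutoff x * (q x * ‖f x‖ ^ 2) := by
  have hqi := hq.integrableOn_mul_abs_Ioc hl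
  obtain ⟨M, hM0, hM⟩ := exists_bound_cutoff
  obtain ⟨δ, hδ0, hδ1, hδ⟩ := exists_setIntegral_Ioc_le (hq.integrableOn_mul_abs (by linarith))
    (show (0 : ℝ) < 1 / 4 by norm_num)
  set Q := ∫ s in Ioc δ 2, |q s| with hQ
  have hQ0 : 0 ≤ Q := integral_nonneg fun _ => abs_nonneg _
  have hqδ : IntegrableOn (fun s => |q s|) (Ioc δ 2) :=
    ((hq.locallyIntegrable.integrableOn_compact_subset (fun x hx => hδ0.trans_le hx.1)
      isCompact_Icc).mono_set Ioc_subset_Icc_self).norm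
  -- Near 0 the bound |f|² ≤ x · `kinetic f` and ∫₀^δ x|q| ≤ 1/4 cost a quarter of the kinetic
  -- energy; on (δ, 2] this ε costs Qε ≤ 1/4 more.
  set ε := 1 / (4 * (Q + 1)) with hε
  have hε0 : 0 < ε := by positivity
  refine ⟨Q * (2 * M + 1 / ε), by positivity, fun f hf hf2 ⟨K, hK0, hK⟩ => ?_⟩
  have hN0 : 0 ≤ ∫ x, ‖f x‖ ^ 2 ∂volPos := integral_nonneg fun _ => by positivity
  set N := ∫ x, ‖f x‖ ^ 2 ∂volPos with hN
  have hA0 := kinetic_nonneg (f := f)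
  have hmeas : AEStronglyMeasurable (fun x => cocutoff x * (q x * ‖f x‖ ^ 2))
      (volume.restrict (Ioc 0 2)) := by
    refine continuous_cocutoff.aestronglyMeasurable.mul (AEStronglyMeasurable.mul ?_ ?_)
    · exact hq.locallyIntegrable.aestronglyMeasurable.mono_measure
        (Measure.restrict_mono (Ioc_subset_Ioi_zero le_rfl) le_rfl)
    · exact ((hf.1.continuousOn.mono (Ioc_subset_Ioi_zero le_rfl)).norm.pow 2).aestronglyMeasurable
        measurableSet_Ioc
  have hint : IntegrableOn (fun x => cocutoff x * (q x * ‖f x‖ ^ 2)) (Ioc 0 2) := by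
    refine Integrable.mono' (hqi.const_mul (2 * K ^ 2)) hmeas
      (ae_restrict_of_forall_mem measurableSet_Ioc fun x hx => ?_)
    have hx0 : 0 < x := hx.1
    rw [norm_mul, norm_mul, norm_pow, norm_norm, Real.norm_of_nonneg (cocutoff_nonneg x),
      Real.norm_eq_abs]
    have h1 := (hK x hx).1
    calc cocutoff x * (|q x| * ‖f x‖ ^ 2) ≤ 1 * (|q x| * (K * x) ^ 2) := by
          have := cocutoff_le_one x
          gcongr
      _ = x * (K ^ 2 * (x * |q x|)) := by ring
      _ ≤ 2 * (K ^ 2 * (x * |q x|)) := by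
          have := hx.2
          gcongr
      _ = _ := by ring
  refine ⟨hint, ?_⟩
  have hs1 : Ioc 0 δ ⊆ Ioc (0 : ℝ) 2 := Ioc_subset_Ioc_right (by linarith)
  have hs2 : Ioc δ 2 ⊆ Ioc (0 : ℝ) 2 := Ioc_subset_Ioc_left hδ0.le
  rw [← Ioc_union_Ioc_eq_Ioc hδ0.le (show δ ≤ 2 by linarith), setIntegral_union
    (Ioc_disjoint_Ioc_of_le le_rfl) measurableSet_Ioc (hint.mono_set hs1) (hint.mono_set hs2)]
  have h1 : -∫ x in Ioc 0 δ, kinetic f * (x * |q x|)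
      ≤ ∫ x in Ioc 0 δ, cocutoff x * (q x * ‖f x‖ ^ 2) := by
    rw [← integral_neg]
    refine setIntegral_mono_on ((hqi.mono_set hs1).const_mul _).neg (hint.mono_set hs1)
      measurableSet_Ioc fun x hx => ?_
    have h2 := norm_sq_le_mul_kinetic hf hK ⟨hx.1, hx.2.trans hδ1.le⟩
    rw [cocutoff_of_le (hx.2.trans hδ1.le), one_mul]
    have h3 := mul_le_mul_of_nonneg_left h2 (abs_nonneg (q x))
    have h4 := mul_le_mul_of_nonneg_right (neg_abs_le (q x)) (sq_nonneg ‖f x‖)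
    linarith
  have h2 : -∫ x in Ioc δ 2, (ε * kinetic f + (2 * M + 1 / ε) * N) * |q x|
      ≤ ∫ x in Ioc δ 2, cocutoff x * (q x * ‖f x‖ ^ 2) := by
    rw [← integral_neg]
    refine setIntegral_mono_on (hqδ.const_mul _).neg (hint.mono_set hs2)
      measurableSet_Ioc fun x hx => ?_
    have h2 := cocutoff_mul_norm_sq_le hf hK (fun x => (hM x).1) hf2 hε0 (hs2 hx)
    have h3 := mul_le_mul_of_nonneg_left h2 (abs_nonneg (q x))
    have h4 := mul_le_mul_of_nonneg_right (neg_abs_le (q x))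
      (mul_nonneg (cocutoff_nonneg x) (sq_nonneg ‖f x‖))
    linarith
  rw [integral_const_mul] at h1 h2
  have h3 := mul_le_mul_of_nonneg_left hδ hA0
  have h4 : Q * ε ≤ 1 / 4 := by
    rw [hε, mul_one_div, div_le_div_iff₀ (by positivity) (by norm_num)]
    linarith
  have h5 := mul_le_mul_of_nonneg_right h4 hA0
  linarith

end FormEstimate

/-! ### The localization formula and control of the kinetic energy by the form. -/

section FormEstimate

variable {l : ℝ} {q : ℝ → ℝ} {f : ℝ → ℂ}

/-- The derivative of `cocutoff * conj f * f'`. -/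
def boundaryTermDeriv (f : ℝ → ℂ) (x : ℝ) : ℂ :=
  ((-(2 * cutoff x * deriv cutoff x) : ℝ) : ℂ) * (conj (f x) * deriv f x)
    + cocutoff x * (conj (deriv f x) * deriv f x + conj (f x) * deriv (deriv f) x)

theorem isPrim_boundaryTerm (hf : IsRegular f) {a b : ℝ} (ha : 0 < a) (hab : a ≤ b) :
    IsPrim (fun x => cocutoff x * (conj (f x) * deriv f x)) (boundaryTermDeriv f) a b :=
  (isPrim_cocutoff hab).mul (((hf.isPrim ha hab).conj hab).mul (hf.isPrim_deriv ha hab) hab) hab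

/-- The localization formula, pointwise. -/
theorem re_conj_mul_tau_eq (hf : IsRegular f) : ∀ᵐ x ∂volPos,
    (conj (f x) * tau l q f x).re - (conj (cutoffMul f x) * tau l q (cutoffMul f) x).re
        - cutoff x * deriv (deriv cutoff) x * ‖f x‖ ^ 2
      = cocutoff x * ‖deriv f x‖ ^ 2 + cocutoff x * (l * (l + 1) / x ^ 2 * ‖f x‖ ^ 2)
        + cocutoff x * (q x * ‖f x‖ ^ 2) - (boundaryTermDeriv f x).re := by
  filter_upwards [hf.tau_cutoffMul (l := l) (q := q)] with x hx
  have h1 : ((‖f x‖ ^ 2 : ℝ) : ℂ) = conj (f x) * f x := by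
    rw [mul_comm, Complex.mul_conj, Complex.normSq_eq_norm_sq]
  have h2 : ((‖deriv f x‖ ^ 2 : ℝ) : ℂ) = conj (deriv f x) * deriv f x := by
    rw [mul_comm, Complex.mul_conj, Complex.normSq_eq_norm_sq]
  have key : conj (f x) * tau l q f x - conj (cutoffMul f x) * tau l q (cutoffMul f) x
      - ((cutoff x * deriv (deriv cutoff) x * ‖f x‖ ^ 2 : ℝ) : ℂ)
      = ((cocutoff x * ‖deriv f x‖ ^ 2 + cocutoff x * (l * (l + 1) / x ^ 2 * ‖f x‖ ^ 2)
        + cocutoff x * (q x * ‖f x‖ ^ 2) : ℝ) : ℂ) - boundaryTermDeriv f x := by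
    rw [hx, boundaryTermDeriv, deriv_deriv_eq l q, cutoffMul, map_mul, Complex.conj_ofReal]
    simp only [Complex.ofReal_add, Complex.ofReal_mul (_ : ℝ) (‖_‖ ^ 2), Complex.ofReal_mul, h1, h2,
      cocutoff, Complex.ofReal_sub, Complex.ofReal_one, Complex.ofReal_pow (cutoff x),
      Complex.ofReal_neg, Complex.ofReal_ofNat]
    ring
  have := congrArg Complex.re key
  simpa only [Complex.sub_re, Complex.ofReal_re] using this

theorem integrableOn_centrifugal (hl : 0 ≤ l) (hf : IsRegular f) {K : ℝ}
    (hK : ∀ x ∈ Ioc (0 : ℝ) 2, ‖f x‖ ≤ K * x ∧ ‖deriv f x‖ ≤ K) :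
    IntegrableOn (fun x => cocutoff x * (l * (l + 1) / x ^ 2 * ‖f x‖ ^ 2)) (Ioc 0 2) := by
  have hsub : Ioc (0 : ℝ) 2 ⊆ Ioi 0 := Ioc_subset_Ioi_zero le_rfl
  refine integrableOn_of_continuousOn_bound (C := l * (l + 1) * K ^ 2)
    (continuous_cocutoff.continuousOn.mul (ContinuousOn.mul (continuousOn_const.div
      (continuousOn_pow 2) fun x hx => pow_ne_zero 2 (hsub hx).ne')
      ((hf.1.continuousOn.mono hsub).norm.pow 2))) fun x hx => ?_
  have hx0 : 0 < x := hx.1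
  have h0 := cocutoff_nonneg x
  have h1 := cocutoff_le_one x
  have h2 := (hK x hx).1
  rw [Real.norm_of_nonneg (by positivity)]
  calc cocutoff x * (l * (l + 1) / x ^ 2 * ‖f x‖ ^ 2)
      ≤ 1 * (l * (l + 1) / x ^ 2 * (K * x) ^ 2) := by gcongr
    _ = _ := by field_simp

/-- The integrand is a total derivative; the primitive vanishes at 2 through the weight, and is O(x)
at 0. -/
theorem integral_boundaryTermDeriv (hf : IsRegular f) {K : ℝ}
    (hK : ∀ x ∈ Ioc (0 : ℝ) 2, ‖f x‖ ≤ K * x ∧ ‖deriv f x‖ ≤ K)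
    (hi : IntegrableOn (fun x => (boundaryTermDeriv f x).re) (Ioc 0 2)) :
    ∫ x in Ioc (0 : ℝ) 2, (boundaryTermDeriv f x).re = 0 := by
  have h1 : IntegrableOn (fun x => (boundaryTermDeriv f x).re) (uIcc 0 2) := by
    rwa [uIcc_of_le zero_le_two, integrableOn_Icc_iff_integrableOn_Ioc]
  have h2 := intervalIntegral.continuousOn_primitive_interval_left h1 0 left_mem_uIcc
  rw [ContinuousWithinAt, uIcc_of_le zero_le_two] at h2
  have h3 : Tendsto (fun x => ∫ t in x..2, (boundaryTermDeriv f t).re) (𝓝[>] 0)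
      (𝓝 (∫ t in (0 : ℝ)..2, (boundaryTermDeriv f t).re)) := by
    refine h2.mono_left ?_
    rw [← nhdsWithin_Ioc_eq_nhdsGT (zero_lt_two (α := ℝ))]
    exact nhdsWithin_mono _ Ioc_subset_Icc_self
  rw [intervalIntegral.integral_of_le zero_le_two] at h3
  refine tendsto_nhds_unique h3 ?_
  have h4 : Tendsto (fun x : ℝ => K * K * x) (𝓝[>] 0) (𝓝 0) := by
    have : Tendsto (fun x : ℝ => K * K * x) (𝓝 0) (𝓝 (K * K * 0)) :=
      (continuous_const.mul continuous_id).tendsto 0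
    rw [mul_zero] at this
    exact tendsto_nhdsWithin_of_tendsto_nhds this
  refine squeeze_zero_norm' ?_ h4
  filter_upwards [Ioo_mem_nhdsGT (zero_lt_two (α := ℝ))] with x hx
  have hp := isPrim_boundaryTerm hf hx.1 hx.2.le
  have h5 : ∫ t in x..2, (boundaryTermDeriv f t).re = (∫ t in x..2, boundaryTermDeriv f t).re :=
    Complex.reCLM.intervalIntegral_comp_comm hp.1
  rw [h5, ← hp.sub_eq hx.2.le, cocutoff_of_ge le_rfl, Complex.ofReal_zero, zero_mul, zero_sub,
    Complex.neg_re, norm_neg]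
  refine (Complex.abs_re_le_norm _).trans ?_
  rw [norm_mul, norm_mul, Complex.norm_real, RCLike.norm_conj,
    Real.norm_of_nonneg (cocutoff_nonneg x)]
  have hx' : x ∈ Ioc (0 : ℝ) 2 := ⟨hx.1, hx.2.le⟩
  have h6 := mul_le_mul (hK x hx').1 (hK x hx').2 (norm_nonneg _)
    ((norm_nonneg _).trans (hK x hx').1)
  have h7 : cocutoff x * (‖f x‖ * ‖deriv f x‖) ≤ ‖f x‖ * ‖deriv f x‖ :=
    mul_le_of_le_one_left (by positivity) (cocutoff_le_one x)
  linarith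

/-- If `H` is bounded from below, its form controls the kinetic energy near `0`. -/
theorem Hypothesis.exists_kinetic_le (hq : Hypothesis l q) (hl : 0 ≤ l)
    (hH : IsBoundedBelow (H l q)) : ∃ C, 0 ≤ C ∧ ∀ f : ℝ → ℂ, InMaximalDomain l q f →
      BoundaryCondition l f →
      kinetic f ≤ 2 * ∫ x, (conj (f x) * tau l q f x).re ∂volPos
        + C * ∫ x, ‖f x‖ ^ 2 ∂volPos := by
  obtain ⟨c, hc⟩ := hH
  obtain ⟨M, hM0, hM⟩ := exists_bound_cutoff
  obtain ⟨C, hC0, hC⟩ := hq.exists_potential_bound hl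
  -- The lower bound of H costs |c|, the cutoff error M, and the potential C plus half the kinetic
  -- energy. The centrifugal term is nonnegative for l ≥ 0 and is dropped; absorbing the half
  -- doubles everything.
  refine ⟨2 * (|c| + M + C), by positivity, fun f hf hb => ?_⟩
  obtain ⟨K, hK0, hK⟩ := exists_linear_bound_Ioc hf.1
    (hq.exists_linear_bound hl hf.1 hb hf.2.1 hf.memLp_tau)
  obtain ⟨hiq, hq2⟩ := hC f hf.1 hf.2.1 ⟨K, hK0, hK⟩
  have hN : Integrable (fun x => ‖f x‖ ^ 2) volPos := hf.2.1.integrable_norm_pow (by norm_num)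
  have hN0 : 0 ≤ ∫ x, ‖f x‖ ^ 2 ∂volPos := integral_nonneg fun _ => by positivity
  have hcut := neg_mul_le_integral_cutoffMul hc hf
  have hχ : ∀ x, |cutoff x * deriv (deriv cutoff) x| ≤ M := fun x => by
    rw [abs_mul, abs_of_nonneg (cutoff_nonneg x)]
    exact (mul_le_of_le_one_left (abs_nonneg _) (cutoff_le_one x)).trans (hM x).2
  have i1 : Integrable (fun x => (conj (f x) * tau l q f x).re) volPos :=
    (hf.2.1.star.integrable_mul hf.2.2).re
  have i2 : Integrable (fun x => (conj (cutoffMul f x) * tau l q (cutoffMul f) x).re) volPos :=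
    (hf.cutoffMul.2.1.star.integrable_mul hf.cutoffMul.2.2).re
  have i3 : Integrable (fun x => cutoff x * deriv (deriv cutoff) x * ‖f x‖ ^ 2) volPos :=
    hN.bdd_mul (c := M) (continuous_cutoff.mul continuous_deriv_deriv_cutoff).aestronglyMeasurable
      (Eventually.of_forall hχ)
  have i12 : Integrable (fun x => (conj (f x) * tau l q f x).re
      - (conj (cutoffMul f x) * tau l q (cutoffMul f) x).re) volPos := i1.sub i2
  have hid := re_conj_mul_tau_eq (l := l) (q := q) hf.1
  have hR := (integrable_congr hid).1 (i12.sub i3)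
  have hsub : Ioc (0 : ℝ) 2 ⊆ Ioi 0 := Ioc_subset_Ioi_zero le_rfl
  have j1 := integrableOn_kinetic hf.1 hK
  have j2 := integrableOn_centrifugal hl hf.1 hK
  have j12 : IntegrableOn (fun x => cocutoff x * ‖deriv f x‖ ^ 2
      + cocutoff x * (l * (l + 1) / x ^ 2 * ‖f x‖ ^ 2)) (Ioc 0 2) := j1.add j2
  have j123 : IntegrableOn (fun x => cocutoff x * ‖deriv f x‖ ^ 2
      + cocutoff x * (l * (l + 1) / x ^ 2 * ‖f x‖ ^ 2)
      + cocutoff x * (q x * ‖f x‖ ^ 2)) (Ioc 0 2) := j12.add hiq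
  have hRS := hR.mono_measure (Measure.restrict_mono hsub le_rfl)
  -- Integrability of this term is read off from the localization identity, all of whose other terms
  -- are integrable.
  have hp : IntegrableOn (fun x => (boundaryTermDeriv f x).re) (Ioc 0 2) := by
    refine (j123.sub hRS).congr (Eventually.of_forall fun x => ?_)
    simp only [Pi.sub_apply]
    ring
  have e1 := integral_congr_ae hid
  rw [integral_sub i12 i3, integral_sub i1 i2] at e1
  have e2 := setIntegral_eq_of_subset_of_forall_sdiff_eq_zero (μ := volume) measurableSet_Ioi hsub
    (f := fun x => cocutoff x * ‖deriv f x‖ ^ 2 + cocutoff x * (l * (l + 1) / x ^ 2 * ‖f x‖ ^ 2)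
        + cocutoff x * (q x * ‖f x‖ ^ 2) - (boundaryTermDeriv f x).re) fun x hx => by
      have hx2 : 2 < x := not_le.1 fun h => hx.2 ⟨hx.1, h⟩
      have h1 : deriv cutoff x = 0 := deriv_cutoff_eq_zero fun h => absurd h.2 (not_le.2 hx2)
      simp [boundaryTermDeriv, cocutoff_of_ge hx2.le, h1]
  rw [e2, integral_sub j123 hp, integral_add j12 hiq, integral_add j1 j2,
    integral_boundaryTermDeriv hf.1 hK hp, sub_zero] at e1
  have h1 : 0 ≤ ∫ x in Ioc (0 : ℝ) 2, cocutoff x * (l * (l + 1) / x ^ 2 * ‖f x‖ ^ 2) :=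
    integral_nonneg fun x => mul_nonneg (cocutoff_nonneg x) (by positivity)
  have h2 : -(M * ∫ x, ‖f x‖ ^ 2 ∂volPos)
      ≤ ∫ x, cutoff x * deriv (deriv cutoff) x * ‖f x‖ ^ 2 ∂volPos := by
    rw [← integral_const_mul, ← integral_neg]
    refine integral_mono (hN.const_mul M).neg i3 fun x => ?_
    have h3 := mul_le_mul_of_nonneg_right ((abs_le.1 (hχ x)).1) (sq_nonneg ‖f x‖)
    simp only
    linarith
  have h3 : kinetic f = ∫ x in Ioc (0 : ℝ) 2, cocutoff x * ‖deriv f x‖ ^ 2 := rfl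
  rw [← h3] at e1
  linarith

theorem setIntegral_norm_deriv_sq_le_kinetic (hf : IsRegular f) {K : ℝ}
    (hK : ∀ x ∈ Ioc (0 : ℝ) 2, ‖f x‖ ≤ K * x ∧ ‖deriv f x‖ ≤ K) :
    ∫ x in Ioo (0 : ℝ) 1, ‖deriv f x‖ ^ 2 ≤ kinetic f := by
  have h1 : ∫ x in Ioo (0 : ℝ) 1, ‖deriv f x‖ ^ 2
      = ∫ x in Ioo (0 : ℝ) 1, cocutoff x * ‖deriv f x‖ ^ 2 :=
    setIntegral_congr_fun measurableSet_Ioo fun x hx => by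
      simp only [cocutoff_of_le hx.2.le, one_mul]
  rw [h1]
  refine setIntegral_mono_set (integrableOn_kinetic hf hK) (Eventually.of_forall fun t =>
    mul_nonneg (cocutoff_nonneg t) (by positivity)) (LE.le.eventuallyLE fun x hx => ?_)
  exact ⟨hx.1, by linarith [hx.2]⟩

end FormEstimate

/-! ### Elements of 𝔥₁ as primitives of L² functions near 0. -/

section FormDomain

variable {l : ℝ} {q : ℝ → ℝ} {f : ℝ → ℂ}

/-- The Hilbert space `L²(0, 1)`. -/
abbrev L2Unit : Type := Lp ℂ 2 (volume.restrict (Ioo (0 : ℝ) 1))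

/-- The pairs `(u, p)` with `u x = ∫₀ˣ p` on `(0, 1)`. -/
def primitiveRel : Set (L2 × L2Unit) :=
  {z | ∀ᵐ x ∂volume.restrict (Ioo (0 : ℝ) 1), z.1 x = ∫ s in Ioo 0 x, z.2 s}

theorem tendsto_setIntegral_of_tendsto {p : ℕ → L2Unit} {p₀ : L2Unit}
    (h : Tendsto p atTop (𝓝 p₀)) {x : ℝ} (hx : x ∈ Ioo (0 : ℝ) 1) :
    Tendsto (fun k => ∫ s in Ioo 0 x, p k s) atTop (𝓝 (∫ s in Ioo 0 x, p₀ s)) := by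
  have hm : volume.restrict (Ioo (0 : ℝ) 1) (Ioo 0 x) ≠ ⊤ := measure_ne_top _ _
  have h1 : ∀ p : L2Unit, inner ℂ (indicatorConstLp 2 measurableSet_Ioo hm (1 : ℂ)) p
      = ∫ s in Ioo 0 x, p s := fun p => by
    rw [L2.inner_indicatorConstLp_one, Measure.restrict_restrict measurableSet_Ioo,
      inter_eq_self_of_subset_left (Ioo_subset_Ioo_right hx.2.le)]
  simp only [← h1]
  exact tendsto_const_nhds.inner h

/-- Along a subsequence the left sides converge almost everywhere; the right sides converge for
every x, being inner products with an indicator function. -/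
theorem isClosed_primitiveRel : IsClosed primitiveRel := by
  refine IsSeqClosed.isClosed fun z z₀ hz hlim => ?_
  have h1 : Tendsto (fun k => (z k).1) atTop (𝓝 z₀.1) := (continuous_fst.tendsto _).comp hlim
  have h2 : Tendsto (fun k => (z k).2) atTop (𝓝 z₀.2) := (continuous_snd.tendsto _).comp hlim
  obtain ⟨ns, hns, hae⟩ := (tendstoInMeasure_of_tendsto_Lp h1).exists_seq_tendsto_ae
  have hsub : Ioo (0 : ℝ) 1 ⊆ Ioi 0 := fun x hx => hx.1
  have hz' : ∀ᵐ x ∂volume.restrict (Ioo (0 : ℝ) 1), ∀ k, (z k).1 x = ∫ s in Ioo 0 x, (z k).2 s :=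
    ae_all_iff.2 hz
  change ∀ᵐ x ∂volume.restrict (Ioo (0 : ℝ) 1), z₀.1 x = ∫ s in Ioo 0 x, z₀.2 s
  filter_upwards [hz', ae_restrict_of_ae_restrict_of_subset hsub hae,
    ae_restrict_mem measurableSet_Ioo] with x h3 h4 hx
  refine tendsto_nhds_unique h4 (((tendsto_setIntegral_of_tendsto h2 hx).comp
    hns.tendsto_atTop).congr fun k => ?_)
  exact (h3 (ns k)).symm

/-- A regular representative of the first component of an element of the graph of `H`. -/
def graphRep (p : (H l q).graph) : ℝ → ℂ :=
  Classical.choose (show (p : L2 × L2) ∈ graphH l q from graph_H l q ▸ p.2)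

theorem graphRep_spec (p : (H l q).graph) : IsRegular (graphRep p) ∧
    BoundaryCondition l (graphRep p) ∧ graphRep p =ᵐ[volPos] p.1.1 ∧
    tau l q (graphRep p) =ᵐ[volPos] p.1.2 :=
  Classical.choose_spec (show (p : L2 × L2) ∈ graphH l q from graph_H l q ▸ p.2)

theorem graphRep_inMaximalDomain (p : (H l q).graph) : InMaximalDomain l q (graphRep p) :=
  inMaximalDomain_of_ae_eq (graphRep_spec p).1 (graphRep_spec p).2.2.1 (graphRep_spec p).2.2.2

theorem deriv_eq_of_ae_eq {g : ℝ → ℂ} (hf : IsRegular f) (hg : IsRegular g)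
    (h : f =ᵐ[volPos] g) {x : ℝ} (hx : 0 < x) : deriv f x = deriv g x := by
  have h4 : EqOn f g (Ioi 0) :=
    MeasureTheory.Measure.eqOn_of_ae_eq h hf.1.continuousOn hg.1.continuousOn
      (by rw [interior_Ioi]; exact subset_closure)
  exact (h4.eventuallyEq_of_mem (Ioi_mem_nhds hx)).deriv_eq

theorem memLp_deriv_of_bound (hf : IsRegular f) {K : ℝ}
    (hK : ∀ x ∈ Ioo (0 : ℝ) 1, ‖deriv f x‖ ≤ K) :
    MemLp (deriv f) 2 (volume.restrict (Ioo 0 1)) :=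
  MemLp.of_bound ((hf.continuousOn_deriv.mono fun _ hx => hx.1).aestronglyMeasurable
    measurableSet_Ioo) K (ae_restrict_of_forall_mem measurableSet_Ioo hK)

theorem Hypothesis.memLp_deriv_graphRep (hq : Hypothesis l q) (hl : 0 ≤ l)
    (p : (H l q).graph) : MemLp (deriv (graphRep p)) 2 (volume.restrict (Ioo 0 1)) := by
  have h := graphRep_inMaximalDomain p
  obtain ⟨K, -, hK⟩ := hq.exists_linear_bound hl h.1 (graphRep_spec p).2.1 h.2.1 h.memLp_tau
  exact memLp_deriv_of_bound h.1 fun x hx => (hK x hx).2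

/-- The derivative near `0` as a linear map on the graph of `H`. -/
def derivMap (hq : Hypothesis l q) (hl : 0 ≤ l) : (H l q).graph →ₗ[ℂ] L2Unit where
  toFun p := (hq.memLp_deriv_graphRep hl p).toLp _
  map_add' p r := by
    have h1 := graphRep_spec p
    have h2 := graphRep_spec r
    have h3 := graphRep_spec (p + r)
    have h4 : graphRep (p + r) =ᵐ[volPos] graphRep p + graphRep r :=
      h3.2.2.1.trans ((Lp.coeFn_add p.1.1 r.1.1).trans (h1.2.2.1.add h2.2.2.1).symm)
    rw [← MemLp.toLp_add]
    refine MemLp.toLp_congr _ _ (ae_restrict_of_forall_mem measurableSet_Ioo fun x hx => ?_)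
    rw [deriv_eq_of_ae_eq h3.1 (h1.1.add h2.1) h4 hx.1, h1.1.deriv_add h2.1 hx.1]
  map_smul' c p := by
    have h1 := graphRep_spec p
    have h3 := graphRep_spec (c • p)
    have h4 : graphRep (c • p) =ᵐ[volPos] c • graphRep p :=
      h3.2.2.1.trans ((Lp.coeFn_smul c p.1.1).trans (h1.2.2.1.const_smul c).symm)
    rw [RingHom.id_apply, ← MemLp.toLp_const_smul]
    refine MemLp.toLp_congr _ _ (ae_restrict_of_forall_mem measurableSet_Ioo fun x hx => ?_)
    rw [deriv_eq_of_ae_eq h3.1 (h1.1.smul c) h4 hx.1, h1.1.deriv_smul c hx.1]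

theorem eq_setIntegral_deriv (hf : IsRegular f) {K : ℝ}
    (hK : ∀ x ∈ Ioo (0 : ℝ) 1, ‖f x‖ ≤ K * x ∧ ‖deriv f x‖ ≤ K) {x : ℝ}
    (hx : x ∈ Ioo (0 : ℝ) 1) : f x = ∫ s in Ioo 0 x, deriv f s := by
  have hx0 : 0 < x := hx.1
  have hi : IntegrableOn (deriv f) (uIcc 0 x) := by
    rw [uIcc_of_le hx0.le, integrableOn_Icc_iff_integrableOn_Ioc]
    exact integrableOn_of_continuousOn_bound (hf.continuousOn_deriv.mono
      (Ioc_subset_Ioi_zero le_rfl)) fun t ht => (hK t ⟨ht.1, ht.2.trans_lt hx.2⟩).2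
  have h2 := intervalIntegral.continuousOn_primitive_interval_left hi 0 left_mem_uIcc
  rw [ContinuousWithinAt, uIcc_of_le hx0.le] at h2
  have h3 : Tendsto (fun y => ∫ t in y..x, deriv f t) (𝓝[>] 0)
      (𝓝 (∫ t in (0 : ℝ)..x, deriv f t)) := by
    refine h2.mono_left ?_
    rw [← nhdsWithin_Ioc_eq_nhdsGT hx0]
    exact nhdsWithin_mono _ Ioc_subset_Icc_self
  have h4 : Tendsto f (𝓝[>] 0) (𝓝 0) := by
    have h5 : Tendsto (fun x : ℝ => K * x) (𝓝[>] 0) (𝓝 0) := by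
      have : Tendsto (fun x : ℝ => K * x) (𝓝 0) (𝓝 (K * 0)) :=
        (continuous_const.mul continuous_id).tendsto 0
      rw [mul_zero] at this
      exact tendsto_nhdsWithin_of_tendsto_nhds this
    refine squeeze_zero_norm' ?_ h5
    filter_upwards [Ioo_mem_nhdsGT (zero_lt_one (α := ℝ))] with y hy using (hK y hy).1
  have h5 : Tendsto (fun y => f x - f y) (𝓝[>] 0) (𝓝 (f x - 0)) := tendsto_const_nhds.sub h4
  rw [sub_zero] at h5
  rw [intervalIntegral.integral_of_le hx0.le, integral_Ioc_eq_integral_Ioo] at h3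
  refine tendsto_nhds_unique h5 (h3.congr' ?_)
  filter_upwards [Ioo_mem_nhdsGT hx0] with y hy
  exact ((hf.isPrim hy.1 hy.2.le).sub_eq hy.2.le).symm

/-- If `H` is bounded from below, the elements of the form domain of `H` are near `0` the
primitives of functions in `L²(0, 1)`. -/
theorem Hypothesis.exists_primitive_of_mem_scale_one (hq : Hypothesis l q) (hl : 0 ≤ l)
    (hH : IsBoundedBelow (H l q)) {u : L2} (hu : u ∈ scale (H l q) 1) :
    ∃ p : L2Unit, ∀ᵐ x ∂volume.restrict (Ioo (0 : ℝ) 1), u x = ∫ s in Ioo 0 x, p s := by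
  obtain ⟨C, hC0, hC⟩ := hq.exists_kinetic_le hl hH
  refine (hq.graphSymmetric hl).exists_mem_of_mem_scale_one hq.denseDomain (derivMap hq hl) C hC0
    (fun p => ?_) isClosed_primitiveRel (fun p => ?_) hu
  · have h1 := graphRep_spec p
    have h2 := graphRep_inMaximalDomain p
    obtain ⟨K, -, hK⟩ := exists_linear_bound_Ioc h1.1
      (hq.exists_linear_bound hl h1.1 h1.2.1 h2.2.1 h2.memLp_tau)
    have h3 := (setIntegral_norm_deriv_sq_le_kinetic h1.1 hK).trans (hC _ h2 h1.2.1)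
    have hT := (hq.memLp_deriv_graphRep hl p)
    have h4 : ‖derivMap hq hl p‖ ^ 2 = ∫ x in Ioo (0 : ℝ) 1, ‖deriv (graphRep p) x‖ ^ 2 := by
      rw [← inner_self_eq_norm_sq (𝕜 := ℂ), L2.inner_def]
      refine (integral_re (L2.integrable_inner _ _)).symm.trans (integral_congr_ae ?_)
      filter_upwards [hT.coeFn_toLp] with x h5
      rw [← inner_self_eq_norm_sq (𝕜 := ℂ)]
      have : (derivMap hq hl p : L2Unit) x = deriv (graphRep p) x := h5
      rw [this]
    have h5 : ∫ x, ‖graphRep p x‖ ^ 2 ∂volPos = ‖p.1.1‖ ^ 2 := by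
      rw [norm_sq_eq_integral]
      refine integral_congr_ae ?_
      filter_upwards [h1.2.2.1] with x h6
      rw [h6]
    have h6 : ∫ x, (conj (graphRep p x) * tau l q (graphRep p) x).re ∂volPos
        = (inner ℂ p.1.1 p.1.2).re := by
      rw [re_inner_eq_integral]
      refine integral_congr_ae ?_
      filter_upwards [h1.2.2.1, h1.2.2.2] with x h6 h7
      rw [h6, h7]
    rw [h4, ← h5, ← h6]
    exact h3
  · have h1 := graphRep_spec p
    have h2 := graphRep_inMaximalDomain p
    obtain ⟨K, -, hK⟩ := hq.exists_linear_bound hl h1.1 h1.2.1 h2.2.1 h2.memLp_tau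
    have hsub : Ioo (0 : ℝ) 1 ⊆ Ioi 0 := fun x hx => hx.1
    change ∀ᵐ x ∂volume.restrict (Ioo (0 : ℝ) 1), p.1.1 x = ∫ s in Ioo 0 x, derivMap hq hl p s
    filter_upwards [ae_restrict_of_ae_restrict_of_subset hsub h1.2.2.1,
      ae_restrict_mem measurableSet_Ioo] with x h3 hx
    rw [← h3, eq_setIntegral_deriv h1.1 hK hx]
    refine integral_congr_ae (ae_restrict_of_ae_restrict_of_subset
      (Ioo_subset_Ioo_right hx.2.le) ?_)
    exact (hq.memLp_deriv_graphRep hl p).coeFn_toLp.symm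

/-- For s < x the factor 1/x equals 1/max(x,s), so the quotient of the primitive by x is dominated
by `maxKernelIntegral`. -/
theorem Hypothesis.exists_repr_of_mem_scale_one (hq : Hypothesis l q) (hl : 0 ≤ l)
    (hH : IsBoundedBelow (H l q)) {u : L2} (hu : u ∈ scale (H l q) 1) :
    ∃ f ft : ℝ → ℂ, f =ᵐ[volPos] u ∧ ContinuousOn f (Ioo 0 1) ∧
      (∀ x ∈ Ioo (0 : ℝ) 1, f x = (x : ℂ) * ft x) ∧
      MemLp ft 2 (volume.restrict (Ioo 0 1)) ∧
      ∃ C : ℝ, ∀ x ∈ Ioo (0 : ℝ) 1, ‖ft x‖ ≤ C / √x := by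
  classical
  obtain ⟨p, hp⟩ := hq.exists_primitive_of_mem_scale_one hl hH hu
  have hpL := Lp.memLp p
  have hpi : IntegrableOn p (Ioo 0 1) := hpL.integrable (by norm_num)
  have hcont : ContinuousOn (fun x => ∫ s in Ioo 0 x, p s) (Ioo 0 1) := by
    have h1 : IntegrableOn p (Icc 0 1) :=
      (integrableOn_Icc_iff_integrableOn_Ioo).2 hpi
    refine ((intervalIntegral.continuousOn_primitive h1).mono Ioo_subset_Icc_self).congr
      fun x hx => ?_
    exact (integral_Ioc_eq_integral_Ioo).symm
  have hne : ∀ x ∈ Ioo (0 : ℝ) 1, (x : ℂ) ≠ 0 := fun x hx => Complex.ofReal_ne_zero.2 hx.1.ne'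
  set f : ℝ → ℂ := fun x => if x ∈ Ioo (0 : ℝ) 1 then ∫ s in Ioo 0 x, p s else u x with hf
  have hf1 : ∀ x ∈ Ioo (0 : ℝ) 1, f x = ∫ s in Ioo 0 x, p s := fun x hx => if_pos hx
  have hfc : ContinuousOn f (Ioo 0 1) := hcont.congr hf1
  refine ⟨f, fun x => f x / x, ?_, hfc, fun x hx => ?_,
    memLp_of_norm_le_maxKernelIntegral hpL (hfc.div Complex.continuous_ofReal.continuousOn hne)
      zero_le_one fun x hx => ?_⟩
  · have h1 := (ae_restrict_iff' measurableSet_Ioo).1 hp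
    refine ae_restrict_of_ae ?_
    filter_upwards [h1] with x hx
    by_cases h2 : x ∈ Ioo (0 : ℝ) 1
    · rw [hf1 x h2, hx h2]
    · exact if_neg h2
  · have := hne x hx
    field_simp
  · have hx0 : 0 < x := hx.1
    have hsub : Ioo 0 x ⊆ Ioo (0 : ℝ) 1 := Ioo_subset_Ioo_right hx.2.le
    rw [norm_div, Complex.norm_real, Real.norm_of_nonneg hx0.le, hf1 x hx, one_mul]
    have hk := integrable_maxKernel hpi.norm hx0
    have h1 : ‖∫ s in Ioo 0 x, p s‖ / x ≤ ∫ s in Ioo 0 x, (max x s)⁻¹ * ‖p s‖ := by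
      rw [div_le_iff₀ hx0, mul_comm, ← integral_const_mul]
      refine (norm_integral_le_integral_norm _).trans (le_of_eq ?_)
      refine setIntegral_congr_fun measurableSet_Ioo fun s hs => ?_
      simp only [max_eq_left hs.2.le]
      field_simp
    have h2 : ∫ s in Ioo 0 x, (max x s)⁻¹ * ‖p s‖ ≤ maxKernelIntegral (fun s => ‖p s‖) x := by
      refine setIntegral_mono_set hk (Eventually.of_forall fun s => ?_) hsub.eventuallyLE
      have : 0 < max x s := hx0.trans_le (le_max_left _ _)
      simp only [Pi.zero_apply]
      positivity
    linarith

end FormDomain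

/-! ### Induction along the scale and duality. -/

section Scale

variable {l : ℝ} {q : ℝ → ℝ}

/-- The assumption n + 2 ≤ l + 1 gives l ≥ 1, so H is symmetric and extends its adjoint. -/
theorem Hypothesis.exists_mem_graphH_of_mem_scale (hq : Hypothesis l q) {n : ℕ}
    (hn : (n : ℝ) + 2 ≤ l + 1) {u : L2} (hu : u ∈ scale (H l q) (n + 2)) :
    ∃ v ∈ scale (H l q) n, (u, v) ∈ graphH l q := by
  have hn0 : (0 : ℝ) ≤ n := n.cast_nonneg
  obtain ⟨v, hv, huv⟩ := (hq.adjointLE (by linarith)).exists_mem_graph_of_mem_scale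
    (hq.graphSymmetric (by linarith)) hu
  exact ⟨v, hv, by rwa [graph_H] at huv⟩

/-- Elements of `𝔥ₙ` are, near `0`, of the form `x ^ n * p` with `p ∈ L²(0, 1)`. -/
theorem Hypothesis.exists_memLp_of_mem_scale (hq : Hypothesis l q) : ∀ n : ℕ, (n : ℝ) ≤ l + 1 →
    (IsBoundedBelow (H l q) ∨ Even n) → ∀ u ∈ scale (H l q) n,
    ∃ p : ℝ → ℂ, MemLp p 2 (volume.restrict (Ioo 0 1)) ∧
      ∀ᵐ x ∂volume.restrict (Ioo (0 : ℝ) 1), u x = (x : ℂ) ^ n * p x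
  | 0, _, _, u, _ => ⟨u, (Lp.memLp u).mono_measure (Measure.restrict_mono (fun _ hx => hx.1) le_rfl),
      Eventually.of_forall fun x => by rw [pow_zero, one_mul]⟩
  | 1, hn, hH, u, hu => by
    have hl : 0 ≤ l := by push_cast at hn; linarith
    obtain ⟨f, ft, h1, -, h2, h3, -⟩ := hq.exists_repr_of_mem_scale_one hl
      (hH.resolve_right (by decide)) hu
    refine ⟨ft, h3, ?_⟩
    filter_upwards [ae_restrict_of_ae_restrict_of_subset (fun _ hx => hx.1) h1,
      ae_restrict_mem measurableSet_Ioo] with x h4 hx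
    rw [← h4, h2 x hx, pow_one]
  | n + 2, hn, hH, u, hu => by
    have hn' : (n : ℝ) + 2 ≤ l + 1 := by exact_mod_cast hn
    obtain ⟨v, hv, huv⟩ := hq.exists_mem_graphH_of_mem_scale hn' hu
    obtain ⟨p, hp, hvp⟩ := hq.exists_memLp_of_mem_scale n (by linarith)
      (hH.imp_right fun h => by simpa [Nat.even_add] using h) v hv
    obtain ⟨f, ft, fh, h1, -, h2, -, ⟨h3, -⟩, -⟩ := hq.exists_repr_of_mem_graphH hn' huv hp hvp
    refine ⟨ft, h3, ?_⟩
    filter_upwards [ae_restrict_of_ae_restrict_of_subset (fun _ hx => hx.1) h1,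
      ae_restrict_mem measurableSet_Ioo] with x h4 hx
    rw [← h4, h2 x hx]

/-- Banach-Steinhaus: a functional which is the pointwise limit of continuous functionals is
continuous. -/
theorem exists_clm_of_tendsto {E : Type*} [NormedAddCommGroup E] [NormedSpace ℂ E]
    [CompleteSpace E] (Λ : ℕ → E →L[ℂ] ℂ) {F : E → ℂ}
    (h : ∀ x, Tendsto (fun k => Λ k x) atTop (𝓝 (F x))) : ∃ Λ₀ : E →L[ℂ] ℂ, ∀ x, Λ₀ x = F x :=
  ⟨continuousLinearMapOfTendsto Λ (tendsto_pi_nhds.2 h), fun _ => rfl⟩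

theorem integrable_conj_mul {n : ℕ} {g gt p : ℝ → ℂ} {f : L2}
    (hg : ∀ x ∈ Ioo (0 : ℝ) 1, g x = ((x : ℂ) ^ n)⁻¹ * gt x)
    (hgt : MemLp gt 2 (volume.restrict (Ioo 0 1))) (hg1 : MemLp g 2 (volume.restrict (Ioi 1)))
    (hp : MemLp p 2 (volume.restrict (Ioo 0 1)))
    (hf : ∀ᵐ x ∂volume.restrict (Ioo (0 : ℝ) 1), f x = (x : ℂ) ^ n * p x) :
    Integrable (fun x => conj (g x) * f x) volPos := by
  have h1 : IntegrableOn (fun x => conj (g x) * f x) (Ioo 0 1) := by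
    have h2 : Integrable (fun x => conj (gt x) * p x) (volume.restrict (Ioo 0 1)) :=
      hgt.star.integrable_mul hp
    refine h2.congr ?_
    filter_upwards [hf, ae_restrict_mem measurableSet_Ioo] with x h3 hx
    have h4 : (x : ℂ) ^ n ≠ 0 := pow_ne_zero _ (Complex.ofReal_ne_zero.2 hx.1.ne')
    rw [h3, hg x hx, map_mul, map_inv₀, map_pow, Complex.conj_ofReal]
    field_simp
  have h2 : IntegrableOn (fun x => conj (g x) * f x) (Ioi 1) :=
    hg1.star.integrable_mul ((Lp.memLp f).mono_measure
      (Measure.restrict_mono (Ioi_subset_Ioi zero_le_one) le_rfl))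
  have h3 := h1.union ((integrableOn_Ici_iff_integrableOn_Ioi).2 h2)
  rwa [Ioo_union_Ici_eq_Ioi zero_lt_one] at h3

/-- Beyond δ the singular factor x⁻ⁿ is at most δ⁻ⁿ on (0, 1). -/
theorem memLp_indicator_of_weight {n : ℕ} {g gt : ℝ → ℂ}
    (hg : ∀ x ∈ Ioo (0 : ℝ) 1, g x = ((x : ℂ) ^ n)⁻¹ * gt x)
    (hgt : MemLp gt 2 (volume.restrict (Ioo 0 1))) (hg1 : MemLp g 2 (volume.restrict (Ioi 1)))
    {δ : ℝ} (hδ : 0 < δ) : MemLp ((Ioi δ).indicator g) 2 volPos := by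
  have h1 : MemLp ((Ioi δ).indicator g) 2 (volume.restrict (Ioo 0 1)) := by
    have hm : AEStronglyMeasurable g (volume.restrict (Ioo 0 1)) := by
      have hx : AEStronglyMeasurable (fun x : ℝ => ((x : ℂ) ^ n)⁻¹) (volume.restrict (Ioo 0 1)) :=
        ((Complex.measurable_ofReal.pow_const n).inv).aestronglyMeasurable
      refine (hx.mul hgt.1).congr (ae_restrict_of_forall_mem measurableSet_Ioo fun x hx => ?_)
      exact (hg x hx).symm
    refine hgt.of_le_mul (c := (δ ^ n)⁻¹) (hm.indicator measurableSet_Ioi)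
      (ae_restrict_of_forall_mem measurableSet_Ioo fun x hx => ?_)
    by_cases h2 : x ∈ Ioi δ
    · rw [indicator_of_mem h2, hg x hx, norm_mul, norm_inv, norm_pow, Complex.norm_real,
        Real.norm_of_nonneg hx.1.le]
      have h3 : δ ≤ x := le_of_lt h2
      gcongr
    · rw [indicator_of_notMem h2, norm_zero]
      positivity
  have h2 : MemLp ((Ioi δ).indicator g) 2 (volume.restrict (Ici 1)) := by
    rw [← restrict_Ioi_eq_restrict_Ici]
    exact hg1.indicator measurableSet_Ioi
  have hs1 : Ioo (0 : ℝ) 1 ⊆ Ioi 0 := fun x hx => hx.1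
  have hs2 : Ici (1 : ℝ) ⊆ Ioi 0 := fun x hx => zero_lt_one.trans_le (mem_Ici.1 hx)
  have h3 : MemLp ((Ioo 0 1).indicator ((Ioi δ).indicator g)) 2 volPos := by
    rw [memLp_indicator_iff_restrict measurableSet_Ioo, Measure.restrict_restrict measurableSet_Ioo,
      inter_eq_self_of_subset_left hs1]
    exact h1
  have h4 : MemLp ((Ici 1).indicator ((Ioi δ).indicator g)) 2 volPos := by
    rw [memLp_indicator_iff_restrict measurableSet_Ici, Measure.restrict_restrict measurableSet_Ici,
      inter_eq_self_of_subset_left hs2]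
    exact h2
  refine (memLp_congr_ae (ae_restrict_of_forall_mem measurableSet_Ioi fun x hx => ?_)).1
    (h3.add h4)
  rcases lt_or_ge x 1 with h5 | h5
  · rw [Pi.add_apply, indicator_of_mem (show x ∈ Ioo (0 : ℝ) 1 from ⟨hx, h5⟩),
      indicator_of_notMem (show x ∉ Ici (1 : ℝ) from not_le.2 h5), add_zero]
  · rw [Pi.add_apply, indicator_of_notMem (fun h : x ∈ Ioo (0 : ℝ) 1 => absurd h.2 (not_lt.2 h5)),
      indicator_of_mem (show x ∈ Ici (1 : ℝ) from h5), zero_add]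

theorem Hypothesis.memNegScale (hq : Hypothesis l q) {n : ℕ} (hn : (n : ℝ) ≤ l + 1)
    (hH : IsBoundedBelow (H l q) ∨ Even n) {g gt : ℝ → ℂ}
    (hg : ∀ x ∈ Ioo (0 : ℝ) 1, g x = ((x : ℂ) ^ n)⁻¹ * gt x)
    (hgt : MemLp gt 2 (volume.restrict (Ioo 0 1))) (hg1 : MemLp g 2 (volume.restrict (Ioi 1))) :
    MemNegScale l q n g := by
  have hint : ∀ f ∈ scale (H l q) n, Integrable (fun x => conj (g x) * f x) volPos := by
    intro f hf
    obtain ⟨p, hp, hfp⟩ := hq.exists_memLp_of_mem_scale n hn hH f hf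
    exact integrable_conj_mul hg hgt hg1 hp hfp
  set Q := invOneAddSqrtAbs (H l q) ^ n with hQ
  have hQmem : ∀ h, Q h ∈ scale (H l q) n := fun h => ⟨h, rfl⟩
  have hδ : ∀ k : ℕ, (0 : ℝ) < 1 / ((k : ℝ) + 1) := fun k => by positivity
  have hgk := fun k : ℕ => memLp_indicator_of_weight hg hgt hg1 (hδ k)
  -- The functionals of the truncations of g to (1/(k+1), ∞) converge pointwise by dominated
  -- convergence, absolute convergence being known from the decay of elements of 𝔥ₙ.
  obtain ⟨Λ, hΛ⟩ := exists_clm_of_tendsto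
    (fun k => (innerSL ℂ ((hgk k).toLp _)).comp Q)
    (F := fun h => ∫ x, conj (g x) * Q h x ∂volPos) fun h => by
      have h1 : ∀ k : ℕ, ((innerSL ℂ ((hgk k).toLp _)).comp Q) h
          = ∫ x, (Ioi (1 / ((k : ℝ) + 1))).indicator (fun x => conj (g x) * Q h x) x ∂volPos := by
        intro k
        rw [ContinuousLinearMap.comp_apply, innerSL_apply_apply, L2.inner_def]
        refine integral_congr_ae ?_
        filter_upwards [(hgk k).coeFn_toLp] with x hx
        rw [hx, RCLike.inner_apply, mul_comm]
        by_cases h2 : x ∈ Ioi (1 / ((k : ℝ) + 1))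
        · rw [indicator_of_mem h2, indicator_of_mem h2]
        · rw [indicator_of_notMem h2, indicator_of_notMem h2, map_zero, zero_mul]
      simp only [h1]
      have h2 := hint _ (hQmem h)
      refine tendsto_integral_of_dominated_convergence _
        (fun k => h2.1.indicator measurableSet_Ioi) h2.norm
        (fun k => Eventually.of_forall fun x => norm_indicator_le_norm_self _ _)
        (ae_restrict_of_forall_mem measurableSet_Ioi fun x hx => ?_)
      refine tendsto_const_nhds.congr' ?_
      filter_upwards [tendsto_one_div_add_atTop_nhds_zero_nat.eventually_lt_const
        (show (0 : ℝ) < x from hx)] with k hk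
      rw [indicator_of_mem (show x ∈ Ioi (1 / ((k : ℝ) + 1)) from hk)]
  -- The functional depends on h only through Q h, so it vanishes on the kernel of Q.
  obtain ⟨G, hG⟩ := exists_pairing_eq (H l q) n Λ fun h h0 => by
    rw [hΛ h]
    have h0' : Q h = 0 := h0
    rw [h0']
    refine integral_eq_zero_of_ae ?_
    filter_upwards [Lp.coeFn_zero ℂ 2 volPos] with x hx
    rw [hx, Pi.zero_apply, mul_zero]
  refine ⟨G, fun f hf => ⟨hint f hf, ?_⟩⟩
  obtain ⟨h, rfl⟩ := hf
  exact (hG h).trans (hΛ h)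

theorem Hypothesis.exists_repr_of_mem_scale (hq : Hypothesis l q) : ∀ n : ℕ, (n : ℝ) ≤ l + 1 →
    (IsBoundedBelow (H l q) ∨ Even n) → ∀ u ∈ scale (H l q) n, ∃ f ft fh : ℝ → ℂ,
      f =ᵐ[volPos] u ∧
      (∀ x ∈ Ioo (0 : ℝ) 1, f x = (x : ℂ) ^ n * ft x) ∧
      MemLp ft 2 (volume.restrict (Ioo 0 1)) ∧
      (1 ≤ n → ContinuousOn f (Ioo 0 1) ∧
        ∃ C : ℝ, ∀ x ∈ Ioo (0 : ℝ) 1, ‖ft x‖ ≤ C / √x) ∧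
      (2 ≤ n →
        (∀ x ∈ Ioo (0 : ℝ) 1, HasDerivAt f ((x : ℂ) ^ (n - 1) * fh x) x) ∧
        MemLp fh 2 (volume.restrict (Ioo 0 1)) ∧
        ∃ C : ℝ, ∀ x ∈ Ioo (0 : ℝ) 1, ‖fh x‖ ≤ C / √x)
  | 0, _, _, u, _ => ⟨u, u, 0, ae_eq_refl _, fun x _ => by rw [pow_zero, one_mul],
      (Lp.memLp u).mono_measure (Measure.restrict_mono (fun _ hx => hx.1) le_rfl),
      fun h => absurd h (by norm_num), fun h => absurd h (by norm_num)⟩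
  | 1, hn, hH, u, hu => by
    have hl : 0 ≤ l := by push_cast at hn; linarith
    obtain ⟨f, ft, h1, h2, h3, h4, h5⟩ := hq.exists_repr_of_mem_scale_one hl
      (hH.resolve_right (by decide)) hu
    exact ⟨f, ft, 0, h1, fun x hx => by rw [pow_one, h3 x hx], h4, fun _ => ⟨h2, h5⟩,
      fun h => absurd h (by norm_num)⟩
  | n + 2, hn, hH, u, hu => by
    have hn' : (n : ℝ) + 2 ≤ l + 1 := by exact_mod_cast hn
    obtain ⟨v, hv, huv⟩ := hq.exists_mem_graphH_of_mem_scale hn' hu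
    obtain ⟨p, hp, hvp⟩ := hq.exists_memLp_of_mem_scale n (by linarith)
      (hH.imp_right fun h => by simpa [Nat.even_add] using h) v hv
    obtain ⟨f, ft, fh, h1, h2, h3, h4, h5, h6⟩ := hq.exists_repr_of_mem_graphH hn' huv hp hvp
    exact ⟨f, ft, fh, h1, h3, h5.1, fun _ => ⟨h2, h5.2⟩, fun _ => ⟨h4, h6⟩⟩

end Scale

end PerturbedBessel

end

theorem lemma4p3 (l : ℝ) (q : ℝ → ℝ) (hq : PerturbedBessel.Hypothesis l q)
    (n : ℕ) (hn : n ≤ ⌊l + 1⌋₊)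
    (hH : PerturbedBessel.IsBoundedBelow (PerturbedBessel.H l q) ∨ Even n) :
    (∀ u ∈ PerturbedBessel.scale (PerturbedBessel.H l q) n, ∃ f ft fh : ℝ → ℂ,
      f =ᵐ[PerturbedBessel.volPos] u ∧
      (∀ x ∈ Ioo (0 : ℝ) 1, f x = (x : ℂ) ^ n * ft x) ∧
      MemLp ft 2 (volume.restrict (Ioo 0 1)) ∧
      (1 ≤ n → ContinuousOn f (Ioo 0 1) ∧
        ∃ C : ℝ, ∀ x ∈ Ioo (0 : ℝ) 1, ‖ft x‖ ≤ C / √x) ∧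
      (2 ≤ n →
        (∀ x ∈ Ioo (0 : ℝ) 1, HasDerivAt f ((x : ℂ) ^ (n - 1) * fh x) x) ∧
        MemLp fh 2 (volume.restrict (Ioo 0 1)) ∧
        ∃ C : ℝ, ∀ x ∈ Ioo (0 : ℝ) 1, ‖fh x‖ ≤ C / √x)) ∧
    (∀ g gt : ℝ → ℂ,
      (∀ x ∈ Ioo (0 : ℝ) 1, g x = ((x : ℂ) ^ n)⁻¹ * gt x) →
      MemLp gt 2 (volume.restrict (Ioo 0 1)) →
      MemLp g 2 (volume.restrict (Ioi 1)) →
      PerturbedBessel.MemNegScale l q n g) := by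
  have hn' : (n : ℝ) ≤ l + 1 :=
    (Nat.cast_le.2 hn).trans (Nat.floor_le (by linarith [hq.l_ge]))
  exact ⟨hq.exists_repr_of_mem_scale n hn' hH, fun _ _ => hq.memNegScale hn' hH⟩
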